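/- **Conventions.** Operads are classical non-symmetric operads in a category with finite products, with tensor product the categorical product. For a category $\mathcal V$, a *$\mathcal V$-graph* $A$ is a set $A_0$ with an object $A(a,a')\in\mathcal V$ for all $a,a'\in A_0$; a morphism is a function on objects together with morphisms $A(a,a')\to B(Fa,Fa')$. For an operad $P$ in $\mathcal V$, a *$(\mathcal V,P)$-category* is a $\mathcal V$-graph $A$ with morphisms $$\gamma: P(k)\times A(a_{k-1},a_k)\times\cdots\times A(a_0,a_1)\to A(a_0,a_k)\qquad(k\ge 0,\ a_0,\dots,a_k\in A_0)$$ compatible with the unit and the composition of $P$; a morphism is a $\mathcal V$-graph morphism commuting with all $\gamma$. If the forgetful functor $(\mathcal V,P)\text{-}\mathbf{Cat}\to\mathcal V\text{-}\mathbf{Gph}$ has a left adjoint, $\mathrm{fc}_{(\mathcal V,P)}$ denotes the induced monad (the free $(\mathcal V,P)$-category monad) on $\mathcal V\text{-}\mathbf{Gph}$. A functor $F$ induces $F_*$ on graphs (identity on objects, $F$ on hom-objects), and a monad $T$ on $\mathcal V$ induces a monad $T_*$ on $\mathcal V\text{-}\mathbf{Gph}$. A set is *contractible* if it has exactly one element;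 a $(\mathcal V,P)$-category is *contractible* if it has an object and all its hom-objects are contractible; an operad is *contractible* if all its objects $P(k)$ are. An *iterative operadic theory of $n$-categories* consists of categories $\mathcal V_n$ (with finite products) and contractible operads $P_n$ in $\mathcal V_n$ $(n\ge 0)$ with $\mathcal V_0=\mathbf{Set}$ and $\mathcal V_{n+1}=(\mathcal V_n,P_n)\text{-}\mathbf{Cat}$. An *$n$-globular set* is a globular set with no cells in dimensions $>n$; these form $n\text{-}\mathbf{GSet}$. We use the canonical equivalences $\mathbf{Set}\simeq 0\text{-}\mathbf{GSet}$ and $(n\text{-}\mathbf{GSet})\text{-}\mathbf{Gph}\simeq(n+1)\text{-}\mathbf{GSet}$; iterating the forgetful functors gives $U_n:\mathcal V_n\to n\text{-}\mathbf{GSet}$. **Theorem.** Let $(\mathcal V_n,P_n)_{n\ge0}$ be an iterative operadic theory of $n$-categories. Then for all $n\ge 0$ there are monads $Q^{(n)}$ on $n\text{-}\mathbf{GSet}$ such that: 1. for every $n$ there is an equivalence between $\mathcal V_n$ and the category of $Q^{(n)}$-algebras, under which $U_n$ corresponds, up to isomorphism, to the forgetful functor from algebras; 2. $Q^{(0)}\cong\mathrm{id}$;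 3. for every $n$, let $\mathcal W=n\text{-}\mathbf{GSet}$ and let $UP_n$ be the operad in $\mathcal W$ with $(UP_n)(k)=U(P_n(k))$, the underlying object of the $Q^{(n)}$-algebra corresponding to $P_n(k)$. Then $\mathrm{fc}_{(\mathcal W,UP_n)}$ exists, is the identity on objects (up to the bijection given by its unit), and $$(\mathrm{fc}_{(\mathcal W,UP_n)}A)(a,a')=\coprod_{k\ge 0,\ a=a_0,\dots,a_k=a'}UP_n(k)\times A(a_{k-1},a_k)\times\cdots\times A(a_0,a_1);$$ there is a distributive law $$\lambda:Q^{(n)}_*\circ\mathrm{fc}_{(\mathcal W,UP_n)}\Rightarrow\mathrm{fc}_{(\mathcal W,UP_n)}\circ Q^{(n)}_*$$ given on the summands by the morphisms $Q^{(n)}\big(UP_n(k)\times\prod_i A(a_{i-1},a_i)\big)\to UP_n(k)\times\prod_i Q^{(n)}A(a_{i-1},a_i)$ induced by the projections and the algebra action $Q^{(n)}UP_n(k)\to UP_n(k)$; and, along the equivalence $(n\text{-}\mathbf{GSet})\text{-}\mathbf{Gph}\simeq(n+1)\text{-}\mathbf{GSet}$, $Q^{(n+1)}$ is isomorphic to the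 composite monad $\mathrm{fc}_{(\mathcal W,UP_n)}\circ Q^{(n)}_*$ induced by $\lambda$; 4. every $Q^{(n)}$ preserves small coproducts. -/

import Mathlib

open CategoryTheory CategoryTheory.Limits

universe u

namespace IterOp

/-! ### Enriched graphs -/

/-- A `V`-graph: a set of objects and, for every pair of objects, a hom-object in `V`. -/
structure VGraph (V : Type (u + 1)) where
  obj : Type u
  hom : obj → obj → V

namespace VGraph

variable {V : Type (u + 1)} [Category.{u} V]

/-- A morphism of `V`-graphs. -/
@[ext]
structure Hom (A B : VGraph V) where
  obj : A.obj → B.obj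
  map : ∀ x y : A.obj, A.hom x y ⟶ B.hom (obj x) (obj y)

instance : Category (VGraph V) where
  Hom := Hom
  id A := ⟨id, fun x y => 𝟙 (A.hom x y)⟩
  comp F G := ⟨G.obj ∘ F.obj, fun x y => F.map x y ≫ G.map (F.obj x) (F.obj y)⟩
  id_comp F := by apply Hom.ext <;> simp
  comp_id F := by apply Hom.ext <;> simp
  assoc F G H := by apply Hom.ext <;> simp [Function.comp_assoc]

/-- The identification of hom-objects along equalities of endpoints. -/
def castHom (A : VGraph V) {x y x' y' : A.obj} (hx : x = x') (hy : y = y') :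
    A.hom x y ⟶ A.hom x' y' :=
  eqToHom (by rw [hx, hy])

/-- The arrows of the `V`-graph `A` of shape `X`: generalized elements `X ⟶ A(x, y)`, together with
their endpoints `x` and `y`. -/
structure Arr (X : V) (A : VGraph V) where
  src : A.obj
  tgt : A.obj
  arr : X ⟶ A.hom src tgt

/-- The paths with `k` steps in the object set of `A` from `x` to `y`, for all `k`. -/
def Walk (A : VGraph V) (x y : A.obj) : Type u :=
  Σ k : ℕ, {a : Fin (k + 1) → A.obj // a 0 = x ∧ a (Fin.last k) = y}

variable {W : Type (u + 1)} [Category.{u} W]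

/-- The functor `F_*`: the identity on objects, and `F` on hom-objects. -/
def mapFunctor (F : V ⥤ W) : VGraph V ⥤ VGraph W where
  obj A := ⟨A.obj, fun x y => F.obj (A.hom x y)⟩
  map f := ⟨f.obj, fun x y => F.map (f.map x y)⟩
  map_id A := Hom.ext rfl (heq_of_eq (by funext x y; exact F.map_id _))
  map_comp f g := Hom.ext rfl (heq_of_eq (by funext x y; exact F.map_comp _ _))

/-- The monad `T_*` on `V`-graphs induced by a monad `T` on `V`. -/
def mapMonad (T : CategoryTheory.Monad V) : CategoryTheory.Monad (VGraph V) where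
  toFunctor := mapFunctor T.toFunctor
  η :=
    { app := fun A => ⟨id, fun x y => T.η.app (A.hom x y)⟩
      naturality := fun A B f =>
        Hom.ext rfl (heq_of_eq (by funext x y; exact T.η.naturality (f.map x y))) }
  μ :=
    { app := fun A => ⟨id, fun x y => T.μ.app (A.hom x y)⟩
      naturality := fun A B f =>
        Hom.ext rfl (heq_of_eq (by funext x y; exact T.μ.naturality (f.map x y))) }
  assoc A := Hom.ext rfl (heq_of_eq (by funext x y; exact T.assoc (A.hom x y)))
  left_unit A := Hom.ext rfl (heq_of_eq (by funext x y; exact T.left_unit (A.hom x y)))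
  right_unit A := Hom.ext rfl (heq_of_eq (by funext x y; exact T.right_unit (A.hom x y)))

end VGraph

/-! ### Decomposition of a string of length `N` into consecutive blocks -/

/-- The total length of the first `t` blocks, for blocks of lengths `k 0, …, k (m - 1)`. -/
def blockStart {m : ℕ} (k : Fin m → ℕ) (t : ℕ) : ℕ :=
  ∑ i : Fin m, if (i : ℕ) < t then k i else 0

theorem blockStart_zero {m : ℕ} (k : Fin m → ℕ) : blockStart k 0 = 0 := by
  simp [blockStart]

theorem blockStart_last {m : ℕ} (k : Fin m → ℕ) : blockStart k m = ∑ i, k i := by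
  simp [blockStart]

theorem blockStart_succ {m : ℕ} (k : Fin m → ℕ) (i : Fin m) :
    blockStart k (i + 1) = blockStart k i + k i := by
  have h : ∀ j : Fin m, (if (j : ℕ) < (i : ℕ) + 1 then k j else 0) =
      (if (j : ℕ) < (i : ℕ) then k j else 0) + (if j = i then k j else 0) := by
    intro j
    rcases lt_trichotomy (j : ℕ) (i : ℕ) with h | h | h
    · have : j ≠ i := fun e => by simp [e] at h
      simp [h, this, Nat.lt_succ_of_lt h]
    · have : j = i := Fin.ext h
      subst this
      simp
    · have h1 : j ≠ i := fun e => by simp [e] at h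
      have h2 : ¬ (j : ℕ) < (i : ℕ) + 1 := by omega
      have h3 : ¬ (j : ℕ) < (i : ℕ) := by omega
      simp [h1, h2, h3]
  unfold blockStart
  rw [Finset.sum_congr rfl (fun j _ => h j), Finset.sum_add_distrib]
  simp

theorem blockStart_le {m : ℕ} (k : Fin m → ℕ) (t : ℕ) : blockStart k t ≤ ∑ i, k i := by
  unfold blockStart
  refine Finset.sum_le_sum fun i _ => ?_
  split_ifs <;> simp

/-- The endpoint in `{0, …, N}` at which the `t`-th block starts (and the previous one ends). -/
def blockPt {m N : ℕ} {k : Fin m → ℕ} (h : ∑ i, k i = N) (t : Fin (m + 1)) : Fin (N + 1) :=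
  ⟨blockStart k t, by have := blockStart_le k t; omega⟩

/-- The `j`-th endpoint in `{0, …, N}` of the `i`-th block. -/
def blockInner {m N : ℕ} {k : Fin m → ℕ} (h : ∑ i, k i = N) (i : Fin m) (j : Fin (k i + 1)) :
    Fin (N + 1) :=
  ⟨blockStart k i + j, by
    have := blockStart_le k (i + 1)
    have := blockStart_succ k i
    have := j.isLt
    omega⟩

/-- The position in the string of the `j`-th element of the `i`-th block. -/
def blockIdx {m N : ℕ} {k : Fin m → ℕ} (h : ∑ i, k i = N) (i : Fin m) (j : Fin (k i)) : Fin N :=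
  ⟨blockStart k i + j, by
    have := blockStart_le k (i + 1)
    have := blockStart_succ k i
    have := j.isLt
    omega⟩

theorem blockPt_zero {m N : ℕ} {k : Fin m → ℕ} (h : ∑ i, k i = N) : blockPt h 0 = 0 :=
  Fin.ext (blockStart_zero k)

theorem blockPt_last {m N : ℕ} {k : Fin m → ℕ} (h : ∑ i, k i = N) :
    blockPt h (Fin.last m) = Fin.last N :=
  Fin.ext ((blockStart_last k).trans h)

theorem blockInner_zero {m N : ℕ} {k : Fin m → ℕ} (h : ∑ i, k i = N) (i : Fin m) :
    blockInner h i 0 = blockPt h i.castSucc :=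
  Fin.ext rfl

theorem blockInner_last {m N : ℕ} {k : Fin m → ℕ} (h : ∑ i, k i = N) (i : Fin m) :
    blockInner h i (Fin.last (k i)) = blockPt h i.succ :=
  Fin.ext (blockStart_succ k i).symm

/-! ### Classical (non-symmetric) operads in a category with finite products -/

/-- The data of an operad: objects `P(k)`, a unit `1 ⟶ P(1)`, and compositions
`P(m) × P(k₁) × ⋯ × P(kₘ) ⟶ P(N)` where `N = k₁ + ⋯ + kₘ`. -/
structure OperadData (V : Type (u + 1)) [Category.{u} V] [HasFiniteProducts V] where
  obj : ℕ → V
  unit : ⊤_ V ⟶ obj 1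
  comp : ∀ {m N : ℕ} {k : Fin m → ℕ} (_ : ∑ i, k i = N),
    (obj m ⨯ ∏ᶜ fun i => obj (k i)) ⟶ obj N

section

variable {V : Type (u + 1)} [Category.{u} V] [HasFiniteProducts V]

/-- The unit as a generalized element. -/
noncomputable def OperadData.one (P : OperadData V) (X : V) : X ⟶ P.obj 1 :=
  terminal.from X ≫ P.unit

/-- Composition of generalized elements. -/
noncomputable def OperadData.mul (P : OperadData V) {X : V} {m N : ℕ} {k : Fin m → ℕ}
    (h : ∑ i, k i = N) (p : X ⟶ P.obj m) (q : ∀ i, X ⟶ P.obj (k i)) : X ⟶ P.obj N :=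
  prod.lift p (Pi.lift q) ≫ P.comp h

end

/-- An operad in `V`. The unit and associativity axioms are stated on generalized elements of shape
`X`, for all objects `X` of `V`; by the Yoneda lemma this is the commutativity of the usual
diagrams. -/
structure Operad (V : Type (u + 1)) [Category.{u} V] [HasFiniteProducts V] extends
    OperadData V where
  one_mul : ∀ {X : V} {N : ℕ} (h : ∑ _i : Fin 1, N = N) (q : X ⟶ obj N),
    toOperadData.mul (k := fun _ => N) h (toOperadData.one X) (fun _ => q) = q
  mul_one : ∀ {X : V} {m : ℕ} (h : ∑ _i : Fin m, 1 = m) (p : X ⟶ obj m),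
    toOperadData.mul (k := fun _ => 1) h p (fun _ => toOperadData.one X) = p
  assoc : ∀ {X : V} {m K N : ℕ} {k : Fin m → ℕ} {l : Fin K → ℕ} {n : Fin m → ℕ}
    (hk : ∑ i, k i = K) (hl : ∑ s, l s = N)
    (hn : ∀ i, ∑ j, l (blockIdx hk i j) = n i) (hN : ∑ i, n i = N)
    (p : X ⟶ obj m) (q : ∀ i, X ⟶ obj (k i)) (r : ∀ s, X ⟶ obj (l s)),
    toOperadData.mul hl (toOperadData.mul hk p q) r =
      toOperadData.mul hN p
        (fun i => toOperadData.mul (hn i) (q i) (fun j => r (blockIdx hk i j)))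

section

variable {V : Type (u + 1)} [Category.{u} V] [HasFiniteProducts V]
variable {W : Type (u + 1)} [Category.{u} W] [HasFiniteProducts W]

theorem OperadData.comp_mul (P : OperadData V) {X Y : V} (x : Y ⟶ X) {m N : ℕ} {k : Fin m → ℕ}
    (h : ∑ i, k i = N) (p : X ⟶ P.obj m) (q : ∀ i, X ⟶ P.obj (k i)) :
    x ≫ P.mul h p q = P.mul h (x ≫ p) (fun i => x ≫ q i) := by
  unfold OperadData.mul
  rw [← Category.assoc, prod.comp_lift]
  congr 2
  apply Pi.hom_ext
  intro i
  simp

theorem OperadData.comp_one (P : OperadData V) {X Y : V} (x : Y ⟶ X) :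
    x ≫ P.one X = P.one Y := by
  unfold OperadData.one
  rw [← Category.assoc]
  congr 1
  exact Subsingleton.elim _ _

/-- The image `FP` of an operad under a functor preserving finite products: `(FP)(k) = F(P(k))`. -/
noncomputable def OperadData.map (P : OperadData V) (F : V ⥤ W) [PreservesFiniteProducts F] :
    OperadData W where
  obj k := F.obj (P.obj k)
  unit := (PreservesTerminal.iso F).inv ≫ F.map P.unit
  comp {m _ k} h :=
    prod.map (𝟙 (F.obj (P.obj m))) (PreservesProduct.iso F (fun i => P.obj (k i))).inv ≫
      (PreservesLimitPair.iso F (P.obj m) (∏ᶜ fun i => P.obj (k i))).inv ≫ F.map (P.comp h)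

theorem lift_comp_map_comp (F : V ⥤ W) [PreservesFiniteProducts F] {X A C : V} {Y : W} {m : ℕ}
    {B : Fin m → V} (x : Y ⟶ F.obj X) (g : (A ⨯ ∏ᶜ B) ⟶ C) (p : X ⟶ A) (q : ∀ i, X ⟶ B i) :
    prod.lift (x ≫ F.map p) (Pi.lift fun i => x ≫ F.map (q i)) ≫
      prod.map (𝟙 (F.obj A)) (PreservesProduct.iso F B).inv ≫
        (PreservesLimitPair.iso F A (∏ᶜ B)).inv ≫ F.map g =
      x ≫ F.map (prod.lift p (Pi.lift q) ≫ g) := by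
  rw [F.map_comp]
  simp only [← Category.assoc]
  congr 1
  rw [← cancel_mono (PreservesLimitPair.iso F A (∏ᶜ B)).hom]
  rw [Category.assoc, Iso.inv_hom_id, Category.comp_id]
  rw [PreservesLimitPair.iso_hom, Category.assoc, prodComparison, prod.comp_lift, prod.comp_lift,
    ← F.map_comp, ← F.map_comp, prod.lift_fst, prod.lift_snd, prod.lift_map, Category.comp_id]
  congr 1
  rw [Iso.comp_inv_eq, PreservesProduct.iso_hom]
  apply Pi.hom_ext
  intro i
  rw [limit.lift_π, Category.assoc, Category.assoc, piComparison_comp_π, ← F.map_comp,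
    limit.lift_π]
  rfl

theorem OperadData.map_mul (P : OperadData V) (F : V ⥤ W) [PreservesFiniteProducts F]
    {X : V} {Y : W} (x : Y ⟶ F.obj X) {m N : ℕ} {k : Fin m → ℕ}
    (h : ∑ i, k i = N) (p : X ⟶ P.obj m) (q : ∀ i, X ⟶ P.obj (k i)) :
    (P.map F).mul h (x ≫ F.map p) (fun i => x ≫ F.map (q i)) = x ≫ F.map (P.mul h p q) :=
  lift_comp_map_comp F x (P.comp h) p q

theorem OperadData.map_one (P : OperadData V) (F : V ⥤ W) [PreservesFiniteProducts F]
    {X : V} {Y : W} (x : Y ⟶ F.obj X) :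
    (P.map F).one Y = x ≫ F.map (P.one X) := by
  unfold OperadData.one
  rw [F.map_comp, ← Category.assoc]
  change _ ≫ _ ≫ F.map P.unit = _
  rw [← Category.assoc]
  congr 1
  rw [← cancel_mono (PreservesTerminal.iso F).hom]
  exact Subsingleton.elim _ _

theorem exists_lift (F : V ⥤ W) [PreservesFiniteProducts F] {n : ℕ} (A : V) (B : Fin n → V)
    {Y : W} (p : Y ⟶ F.obj A) (q : ∀ i, Y ⟶ F.obj (B i)) :
    ∃ (X : V) (x : Y ⟶ F.obj X) (p' : X ⟶ A) (q' : ∀ i, X ⟶ B i),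
      x ≫ F.map p' = p ∧ ∀ i, x ≫ F.map (q' i) = q i := by
  refine ⟨A ⨯ ∏ᶜ B, prod.lift p (Pi.lift q ≫ (PreservesProduct.iso F B).inv) ≫
    (PreservesLimitPair.iso F A (∏ᶜ B)).inv, prod.fst, fun i => prod.snd ≫ Pi.π B i, ?_, ?_⟩
  · rw [Category.assoc, PreservesLimitPair.iso_inv_fst]
    exact prod.lift_fst _ _
  · intro i
    rw [F.map_comp, Category.assoc, PreservesLimitPair.iso_inv_snd_assoc]
    rw [← Category.assoc]
    refine (congrArg (· ≫ F.map (Pi.π B i)) (prod.lift_snd _ _)).trans ?_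
    have e : (PreservesProduct.iso F B).inv ≫ F.map (Pi.π B i) = Pi.π _ i := by
      rw [Iso.inv_comp_eq, PreservesProduct.iso_hom, piComparison_comp_π]
    rw [Category.assoc, e, limit.lift_π]
    rfl

/-- The image `FP` of an operad `P` under a functor `F` preserving finite products. -/
noncomputable def Operad.map (P : Operad V) (F : V ⥤ W) [PreservesFiniteProducts F] :
    Operad W where
  toOperadData := P.toOperadData.map F
  one_mul {Y N} h q := by
    have e := P.toOperadData.map_mul F q h (P.one _) (fun _ => 𝟙 _)
    rw [P.one_mul] at e
    have e' : q ≫ F.map (𝟙 _) = q :=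
      (congrArg (q ≫ ·) (F.map_id _)).trans (Category.comp_id q)
    rw [P.toOperadData.map_one F q]
    exact (congrArg (fun z => (P.toOperadData.map F).mul h _ (fun _ => z)) e').symm.trans
      (e.trans e')
  mul_one {Y m} h p := by
    have e := P.toOperadData.map_mul F p h (𝟙 _) (fun _ => P.one _)
    rw [P.mul_one] at e
    have e' : p ≫ F.map (𝟙 _) = p :=
      (congrArg (p ≫ ·) (F.map_id _)).trans (Category.comp_id p)
    rw [P.toOperadData.map_one F p]
    exact (congrArg (fun z => (P.toOperadData.map F).mul h z _) e').symm.trans (e.trans e')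
  assoc {Y m K N k l n} hk hl hn hN p q r := by
    obtain ⟨X₁, x₁, p₁, q₁, hp₁, hq₁⟩ := exists_lift F _ _ p q
    obtain ⟨X, x, y, r', hy, hr⟩ := exists_lift F X₁ _ x₁ r
    have hp : p = x ≫ F.map (y ≫ p₁) := by rw [F.map_comp, ← Category.assoc, hy, hp₁]
    have hq : q = fun i => x ≫ F.map (y ≫ q₁ i) := by
      funext i
      rw [F.map_comp, ← Category.assoc, hy, hq₁]
    obtain rfl : (fun s => x ≫ F.map (r' s)) = r := funext hr
    rw [hp, hq]
    have e1 := P.toOperadData.map_mul F x hk (y ≫ p₁) (fun i => y ≫ q₁ i)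
    have e2 := P.toOperadData.map_mul F x hl
      (P.mul hk (y ≫ p₁) (fun i => y ≫ q₁ i)) r'
    have e3 := fun i => P.toOperadData.map_mul F x (hn i) (y ≫ q₁ i)
      (fun j => r' (blockIdx hk i j))
    have e4 := P.toOperadData.map_mul F x hN (y ≫ p₁)
      (fun i => P.mul (hn i) (y ≫ q₁ i) (fun j => r' (blockIdx hk i j)))
    refine (congrArg (fun z => (P.toOperadData.map F).mul hl z _) e1).trans (e2.trans ?_)
    rw [P.assoc hk hl hn hN]
    refine e4.symm.trans ?_
    congr 1
    funext i
    exact (e3 i).symm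

end

/-! ### `(V, P)`-categories -/

section

variable {V : Type (u + 1)} [Category.{u} V] [HasFiniteProducts V]

/-- The data of a `(V, P)`-category: a `V`-graph with composition morphisms
`P(k) × A(a₀, a₁) × ⋯ × A(aₖ₋₁, aₖ) ⟶ A(a₀, aₖ)` for all `k ≥ 0` and `a₀, …, aₖ`. -/
structure PCatData (P : Operad V) extends VGraph V where
  comp : ∀ {k : ℕ} (a : Fin (k + 1) → obj),
    (P.obj k ⨯ ∏ᶜ fun i : Fin k => hom (a i.castSucc) (a i.succ)) ⟶ hom (a 0) (a (Fin.last k))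

/-- Composition of generalized elements in a `(V, P)`-category. -/
noncomputable def PCatData.op {P : Operad V} (A : PCatData P) {X : V} {k : ℕ}
    (a : Fin (k + 1) → A.obj) (p : X ⟶ P.obj k)
    (f : ∀ i : Fin k, X ⟶ A.hom (a i.castSucc) (a i.succ)) :
    X ⟶ A.hom (a 0) (a (Fin.last k)) :=
  prod.lift p (Pi.lift f) ≫ A.comp a

/-- A `(V, P)`-category: the composition is compatible with the unit and the composition of the
operad `P`. As for operads, the axioms are stated on generalized elements. -/
structure PCat (P : Operad V) extends PCatData P where
  one_op : ∀ {X : V} (a : Fin 2 → obj) (f : ∀ i : Fin 1, X ⟶ hom (a i.castSucc) (a i.succ)),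
    toPCatData.op a (P.one X) f = f 0
  mul_op : ∀ {X : V} {m N : ℕ} {k : Fin m → ℕ} (h : ∑ i, k i = N) (a : Fin (N + 1) → obj)
    (p : X ⟶ P.obj m) (q : ∀ i, X ⟶ P.obj (k i))
    (f : ∀ s : Fin N, X ⟶ hom (a s.castSucc) (a s.succ)),
    toPCatData.op a (P.mul h p q) f =
      toPCatData.op (fun t => a (blockPt h t)) p
        (fun i => toPCatData.op (fun j => a (blockInner h i j)) (q i)
            (fun j => f (blockIdx h i j)) ≫
          toVGraph.castHom (congrArg a (blockInner_zero h i)) (congrArg a (blockInner_last h i))) ≫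
      toVGraph.castHom (congrArg a (blockPt_zero h)) (congrArg a (blockPt_last h))

namespace PCat

variable {P : Operad V}

/-- A morphism of `(V, P)`-categories: a morphism of `V`-graphs commuting with the composition. -/
@[ext]
structure Hom (A B : PCat P) where
  toHom : A.toVGraph ⟶ B.toVGraph
  map_comp : ∀ {k : ℕ} (a : Fin (k + 1) → A.obj),
    A.comp a ≫ toHom.map _ _ =
      prod.map (𝟙 (P.obj k)) (Limits.Pi.map fun i : Fin k => toHom.map (a i.castSucc) (a i.succ)) ≫
        B.comp (fun i => toHom.obj (a i))

instance : Category (PCat P) where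
  Hom := Hom
  id A := ⟨𝟙 A.toVGraph, fun {k} a => by
    change A.comp a ≫ 𝟙 _ = prod.map (𝟙 _) (Limits.Pi.map fun i : Fin k => 𝟙 _) ≫ A.comp a
    have : (Limits.Pi.map fun i : Fin k => 𝟙 (A.hom (a i.castSucc) (a i.succ))) = 𝟙 _ := by
      apply Pi.hom_ext
      intro i
      simp
    rw [this]
    simp⟩
  comp {A B C} F G := ⟨F.toHom ≫ G.toHom, fun {k} a => by
    change A.comp a ≫ F.toHom.map _ _ ≫ G.toHom.map _ _ =
      prod.map (𝟙 _) (Limits.Pi.map fun i : Fin k => F.toHom.map _ _ ≫ G.toHom.map _ _) ≫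
        C.comp (fun i => G.toHom.obj (F.toHom.obj (a i)))
    have e := G.map_comp (fun i => F.toHom.obj (a i))
    rw [← Category.assoc, F.map_comp a, Category.assoc]
    refine (congrArg _ e).trans ?_
    rw [← Category.assoc]
    congr 1
    apply Limits.prod.hom_ext
    · simp
    · apply Pi.hom_ext
      intro i
      simp⟩
  id_comp F := Hom.ext (Category.id_comp F.toHom)
  comp_id F := Hom.ext (Category.comp_id F.toHom)
  assoc F G H := Hom.ext (Category.assoc F.toHom G.toHom H.toHom)

/-- The forgetful functor from `(V, P)`-categories to `V`-graphs. -/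
def forget (P : Operad V) : PCat P ⥤ VGraph V where
  obj A := A.toVGraph
  map F := F.toHom

theorem lift_comp_piLift_π {X Q : V} {k n : ℕ} {H : Fin k → Fin n → V} {D : Fin n → V}
    (p : X ⟶ Q) (f : ∀ i, X ⟶ ∏ᶜ H i) (c : ∀ j, (Q ⨯ ∏ᶜ fun i => H i j) ⟶ D j) (j : Fin n) :
    prod.lift p (Pi.lift f) ≫ (Pi.lift fun j =>
      prod.map (𝟙 Q) (Limits.Pi.map fun i => Pi.π (H i) j) ≫ c j) ≫ Pi.π D j =
    prod.lift p (Pi.lift fun i => f i ≫ Pi.π (H i) j) ≫ c j := by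
  rw [limit.lift_π]
  change _ ≫ prod.map _ _ ≫ _ = _
  rw [← Category.assoc, prod.lift_map, Category.comp_id]
  congr 2
  apply Pi.hom_ext
  intro i
  simp

theorem map_comp_piLift_π {Q : V} {k n : ℕ} {G : Fin k → V} {H : Fin k → Fin n → V}
    {D : Fin n → V} (g : ∀ i j, G i ⟶ H i j) (c : ∀ j, (Q ⨯ ∏ᶜ fun i => H i j) ⟶ D j)
    (j : Fin n) :
    prod.map (𝟙 Q) (Limits.Pi.map fun i => Pi.lift (g i)) ≫ (Pi.lift fun j =>
      prod.map (𝟙 Q) (Limits.Pi.map fun i => Pi.π (H i) j) ≫ c j) ≫ Pi.π D j =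
    prod.map (𝟙 Q) (Limits.Pi.map fun i => g i j) ≫ c j := by
  rw [limit.lift_π]
  change _ ≫ prod.map _ _ ≫ _ = _
  rw [← Category.assoc, prod.map_map, Category.comp_id]
  congr 2
  apply Pi.hom_ext
  intro i
  simp

/-- The data of the product of a finite family of `(V, P)`-categories. -/
noncomputable def piData {n : ℕ} (A : Fin n → PCat P) : PCatData P where
  obj := ∀ j, (A j).obj
  hom x y := ∏ᶜ fun j => (A j).hom (x j) (y j)
  comp {k} a := Pi.lift fun j =>
    prod.map (𝟙 (P.obj k)) (Limits.Pi.map fun i : Fin k =>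
      Pi.π (fun j => (A j).hom (a i.castSucc j) (a i.succ j)) j) ≫ (A j).comp fun t => a t j

theorem piData_op {n : ℕ} (A : Fin n → PCat P) {X : V} {k : ℕ}
    (a : Fin (k + 1) → (piData A).obj) (p : X ⟶ P.obj k)
    (f : ∀ i : Fin k, X ⟶ (piData A).hom (a i.castSucc) (a i.succ)) (j : Fin n) :
    (piData A).op a p f ≫ Pi.π (fun j => (A j).hom (a 0 j) (a (Fin.last k) j)) j =
      (A j).op (fun t => a t j) p
        (fun i => f i ≫ Pi.π (fun j => (A j).hom (a i.castSucc j) (a i.succ j)) j) := by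
  exact (Category.assoc _ _ _).trans (lift_comp_piLift_π p f _ j)

theorem piData_castHom {n : ℕ} (A : Fin n → PCat P) {x y x' y' : (piData A).obj}
    (hx : x = x') (hy : y = y') (j : Fin n) :
    (piData A).castHom hx hy ≫ Pi.π (fun j => (A j).hom (x' j) (y' j)) j =
      Pi.π (fun j => (A j).hom (x j) (y j)) j ≫
        (A j).castHom (congrFun hx j) (congrFun hy j) := by
  subst hx hy
  exact (Category.id_comp _).trans (Category.comp_id _).symm

/-- The product of a finite family of `(V, P)`-categories. -/
noncomputable def pi {n : ℕ} (A : Fin n → PCat P) : PCat P where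
  toPCatData := piData A
  one_op {X} a f := by
    apply Pi.hom_ext
    intro j
    exact (piData_op A a (P.one X) f j).trans ((A j).one_op (fun t => a t j) _)
  mul_op {X m N k} h a p q f := by
    apply Pi.hom_ext
    intro j
    refine (piData_op A a _ f j).trans (((A j).mul_op h (fun t => a t j) p q _).trans ?_)
    refine Eq.symm ?_
    refine (Category.assoc _ _ _).trans ?_
    refine (congrArg (_ ≫ ·) (piData_castHom A _ _ j)).trans ?_
    refine (Category.assoc _ _ _).symm.trans ?_
    refine congrArg (· ≫ _) ?_
    refine (piData_op A _ _ _ j).trans ?_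
    refine congrArg ((A j).op _ p) ?_
    funext i
    refine (Category.assoc _ _ _).trans ?_
    refine (congrArg (_ ≫ ·) (piData_castHom A _ _ j)).trans ?_
    refine (Category.assoc _ _ _).symm.trans ?_
    refine congrArg (· ≫ _) ?_
    exact piData_op A _ _ _ j

/-- The projections of the product. -/
noncomputable def piProj {n : ℕ} (A : Fin n → PCat P) (j : Fin n) : pi A ⟶ A j where
  toHom := ⟨fun x => x j, fun x y => Pi.π (fun j => (A j).hom (x j) (y j)) j⟩
  map_comp _ := limit.lift_π _ _

/-- The morphism into the product induced by a family of morphisms. -/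
noncomputable def piLift {n : ℕ} (A : Fin n → PCat P) {B : PCat P} (F : ∀ j, B ⟶ A j) :
    B ⟶ pi A where
  toHom := ⟨fun x j => (F j).toHom.obj x, fun x y => Pi.lift fun j => (F j).toHom.map x y⟩
  map_comp {k} a := by
    apply Pi.hom_ext
    intro j
    refine (Category.assoc _ _ _).trans ?_
    refine (congrArg (B.comp a ≫ ·) (limit.lift_π _ _)).trans ?_
    refine ((F j).map_comp a).trans ?_
    refine Eq.symm ((Category.assoc _ _ _).trans ?_)
    exact map_comp_piLift_π
      (fun i j => (F j).toHom.map (a i.castSucc) (a i.succ)) _ j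

instance : HasFiniteProducts (PCat P) where
  out n :=
    { has_limit := fun K => by
        have key : ∀ A : Fin n → PCat P, HasLimit (Discrete.functor A) := fun A =>
          ⟨⟨⟨Fan.mk (pi A) (piProj A),
            Fan.IsLimit.mk _ (fun s => piLift A s.proj)
              (fun s j => Hom.ext (VGraph.Hom.ext rfl (heq_of_eq (by
                funext x y
                exact Pi.lift_π (fun j => (s.proj j).toHom.map x y) j))))
              (fun s m h => by
                have e : s.proj = fun j => m ≫ piProj A j := funext fun j => (h j).symm
                rw [e]
                refine Hom.ext (VGraph.Hom.ext rfl (heq_of_eq ?_))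
                funext x y
                apply Pi.hom_ext
                intro j
                exact (Pi.lift_π
                  (fun j => m.toHom.map x y ≫ (piProj A j).toHom.map _ _) j).symm)⟩⟩⟩
        have := key (K.obj ∘ Discrete.mk)
        exact hasLimit_of_iso Discrete.natIsoFunctor.symm }

end PCat

/-! ### The monad for free `(V, P)`-categories -/

/-- The free `(V, P)`-category functor: a left adjoint of the forgetful functor from
`(V, P)`-categories to `V`-graphs (unique up to unique isomorphism). -/
structure FreePCat (P : Operad V) where
  free : VGraph V ⥤ PCat P
  adj : free ⊣ PCat.forget P

namespace FreePCat

variable {P : Operad V} (F : FreePCat P)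

/-- The monad `fc_(V, P)` for free `(V, P)`-categories. -/
def fc : CategoryTheory.Monad (VGraph V) := F.adj.toMonad

/-- The inclusion of the `V`-graph `A` into the free `(V, P)`-category on `A`. -/
def incl (A : VGraph V) : A ⟶ (F.free.obj A).toVGraph := F.adj.unit.app A

/-- The formal composites along `a₀, …, aₖ`: the morphism
`P(k) × A(a₀, a₁) × ⋯ × A(aₖ₋₁, aₖ) ⟶ (fc A)(a₀, aₖ)`. -/
noncomputable def formal (A : VGraph V) {k : ℕ} (a : Fin (k + 1) → A.obj) :
    (P.obj k ⨯ ∏ᶜ fun i : Fin k => A.hom (a i.castSucc) (a i.succ)) ⟶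
      (F.free.obj A).hom ((F.incl A).obj (a 0)) ((F.incl A).obj (a (Fin.last k))) :=
  (F.free.obj A).op (fun t => (F.incl A).obj (a t)) prod.fst
    (fun i => (prod.snd ≫ Pi.π _ i) ≫ (F.incl A).map (a i.castSucc) (a i.succ))

/-- The explicit description of `fc A`: it has the same objects as `A`, and `(fc A)(x, y)` is the
coproduct of the objects `P(k) × A(a₀, a₁) × ⋯ × A(aₖ₋₁, aₖ)` over all `k ≥ 0` and all
`x = a₀, a₁, …, aₖ = y`. -/
def IsCoproductOfWalks : Prop :=
  ∀ A : VGraph V, Function.Bijective (F.incl A).obj ∧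
    ∀ x y : A.obj, Nonempty (IsColimit (Cofan.mk
      (f := fun w : A.Walk x y =>
        P.obj w.1 ⨯ ∏ᶜ fun i : Fin w.1 => A.hom (w.2.1 i.castSucc) (w.2.1 i.succ))
      ((F.free.obj A).hom ((F.incl A).obj x) ((F.incl A).obj y))
      (fun w => F.formal A w.2.1 ≫ (F.free.obj A).castHom
        (congrArg (F.incl A).obj w.2.2.1) (congrArg (F.incl A).obj w.2.2.2))))

end FreePCat

end

/-! ### Distributive laws -/

section

variable {C : Type (u + 1)} [Category.{u} C]

/-- A distributive law `T ∘ S ⇒ S ∘ T` of monads on `C`. -/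
structure DistribLaw (S T : CategoryTheory.Monad C) where
  law : S.toFunctor ⋙ T.toFunctor ⟶ T.toFunctor ⋙ S.toFunctor
  unit_left : ∀ A, T.map (S.η.app A) ≫ law.app A = S.η.app (T.obj A)
  unit_right : ∀ A, T.η.app (S.obj A) ≫ law.app A = S.map (T.η.app A)
  mul_left : ∀ A, T.map (S.μ.app A) ≫ law.app A =
    law.app (S.obj A) ≫ S.map (law.app A) ≫ S.μ.app (T.obj A)
  mul_right : ∀ A, T.μ.app (S.obj A) ≫ law.app A =
    T.map (law.app A) ≫ law.app (T.obj A) ≫ S.map (T.μ.app A)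

theorem DistribLaw.law_naturality {S T : CategoryTheory.Monad C} (l : DistribLaw S T) {A B : C} (f : A ⟶ B) :
    T.map (S.map f) ≫ l.law.app B = l.law.app A ≫ S.map (T.map f) :=
  l.law.naturality f

theorem DistribLaw.composite_left_unit {S T : CategoryTheory.Monad C} (l : DistribLaw S T) (A : C) :
    (T.η.app (S.obj (T.obj A)) ≫ S.η.app (T.obj (S.obj (T.obj A)))) ≫
      S.map (l.law.app (T.obj A)) ≫ S.μ.app (T.obj (T.obj A)) ≫ S.map (T.μ.app A) =
      𝟙 (S.obj (T.obj A)) := by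
  have h1 : l.law.app (T.obj A) ≫ S.η.app (S.obj (T.obj (T.obj A))) =
      S.η.app (T.obj (S.obj (T.obj A))) ≫ S.map (l.law.app (T.obj A)) :=
    Monad.unit_naturality C S (l.law.app (T.obj A))
  have h2 := S.left_unit (T.obj (T.obj A))
  rw [Category.assoc, ← reassoc_of% h1, reassoc_of% h2, reassoc_of% (l.unit_right (T.obj A)),
    ← S.map_comp, T.left_unit]
  exact S.map_id _

theorem DistribLaw.composite_right_unit {S T : CategoryTheory.Monad C} (l : DistribLaw S T) (A : C) :
    S.map (T.map (T.η.app A ≫ S.η.app (T.obj A))) ≫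
      S.map (l.law.app (T.obj A)) ≫ S.μ.app (T.obj (T.obj A)) ≫ S.map (T.μ.app A) =
      𝟙 (S.obj (T.obj A)) := by
  have h2 := S.right_unit (T.obj (T.obj A))
  rw [T.map_comp, S.map_comp, Category.assoc, ← S.map_comp_assoc (T.map (S.η.app (T.obj A))),
    l.unit_left, reassoc_of% h2, ← S.map_comp, T.right_unit, S.map_id]
  rfl

theorem DistribLaw.composite_assoc {S T : CategoryTheory.Monad C} (l : DistribLaw S T) (A : C) :
    S.map (T.map (S.map (l.law.app (T.obj A)) ≫ S.μ.app (T.obj (T.obj A)) ≫ S.map (T.μ.app A))) ≫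
      S.map (l.law.app (T.obj A)) ≫ S.μ.app (T.obj (T.obj A)) ≫ S.map (T.μ.app A) =
    (S.map (l.law.app (T.obj (S.obj (T.obj A)))) ≫ S.μ.app (T.obj (T.obj (S.obj (T.obj A)))) ≫
        S.map (T.μ.app (S.obj (T.obj A)))) ≫
      S.map (l.law.app (T.obj A)) ≫ S.μ.app (T.obj (T.obj A)) ≫ S.map (T.μ.app A) := by
  have h1 : T.map (S.map (l.law.app (T.obj A)) ≫ S.μ.app (T.obj (T.obj A)) ≫ S.map (T.μ.app A)) ≫
      l.law.app (T.obj A) = l.law.app (T.obj (S.obj (T.obj A))) ≫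
        S.map (T.map (l.law.app (T.obj A)) ≫ l.law.app (T.obj (T.obj A))) ≫
          S.μ.app (T.obj (T.obj (T.obj A))) ≫ S.map (T.map (T.μ.app A)) := by
    simp only [T.map_comp, Category.assoc]
    rw [l.law_naturality, reassoc_of% (l.mul_left (T.obj (T.obj A))),
      reassoc_of% (l.law_naturality (l.law.app (T.obj A))), S.map_comp, Category.assoc]
  have h2 : S.map (T.μ.app (S.obj (T.obj A))) ≫ S.map (l.law.app (T.obj A)) =
      S.map (T.map (l.law.app (T.obj A)) ≫ l.law.app (T.obj (T.obj A))) ≫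
        S.map (S.map (T.μ.app (T.obj A))) := by
    rw [← S.map_comp, l.mul_right, ← S.map_comp, Category.assoc]
  have h3 := Monad.mu_naturality C S (T.map (T.μ.app A))
  have h4 := Monad.mu_naturality C S (T.μ.app (T.obj A))
  have h5 := Monad.mu_naturality C S (T.map (l.law.app (T.obj A)) ≫ l.law.app (T.obj (T.obj A)))
  have h6 := S.assoc (T.obj (T.obj (T.obj A)))
  have h7 : S.map (T.map (T.μ.app A)) ≫ S.map (T.μ.app A) =
      S.map (T.μ.app (T.obj A)) ≫ S.map (T.μ.app A) := by
    rw [← S.map_comp, T.assoc, S.map_comp]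
  rw [← S.map_comp_assoc, h1]
  simp only [Category.assoc]
  rw [reassoc_of% h2, reassoc_of% h4, ← reassoc_of% h5]
  rw [S.map_comp, S.map_comp (S.map _), S.map_comp (S.μ.app (T.obj (T.obj (T.obj A))))]
  simp only [Category.assoc]
  rw [reassoc_of% h3, reassoc_of% h6, h7]

/-- The composite monad `S ∘ T` induced by a distributive law `T ∘ S ⇒ S ∘ T`. -/
def DistribLaw.composite {S T : CategoryTheory.Monad C} (l : DistribLaw S T) : CategoryTheory.Monad C where
  toFunctor := T.toFunctor ⋙ S.toFunctor
  η :=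
    { app := fun A => T.η.app A ≫ S.η.app (T.obj A)
      naturality := fun A B f => by
        have h1 := Monad.unit_naturality C T f
        have h2 := Monad.unit_naturality C S (T.map f)
        simp only [Functor.id_map, Functor.comp_map, Category.assoc]
        rw [← Category.assoc, h1, Category.assoc, h2] }
  μ :=
    { app := fun A =>
        S.map (l.law.app (T.obj A)) ≫ S.μ.app (T.obj (T.obj A)) ≫ S.map (T.μ.app A)
      naturality := fun A B f => by
        have h1 := l.law_naturality (T.map f)
        have h2 := Monad.mu_naturality C S (T.map (T.map f))
        have h3 := Monad.mu_naturality C T f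
        simp only [Functor.comp_map, Category.assoc]
        rw [← Category.assoc, ← S.map_comp, h1, S.map_comp, Category.assoc]
        congr 1
        rw [reassoc_of% h2, ← S.map_comp, ← S.map_comp, h3] }
  assoc A := l.composite_assoc A
  left_unit A := l.composite_left_unit A
  right_unit A := l.composite_right_unit A

/-- An isomorphism between the monads `M` on `C` and `N` on `D` along a functor `Φ : C ⥤ D`. When
`Φ` is an equivalence, this says that `N` is, up to isomorphism, the monad `M` transported
along `Φ`. -/
structure MonadIsoAlong {D : Type (u + 1)} [Category.{u} D] (Φ : C ⥤ D) (M : CategoryTheory.Monad C)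
    (N : CategoryTheory.Monad D) where
  iso : M.toFunctor ⋙ Φ ≅ Φ ⋙ N.toFunctor
  unit : ∀ A, Φ.map (M.η.app A) ≫ iso.hom.app A = N.η.app (Φ.obj A)
  mul : ∀ A, Φ.map (M.μ.app A) ≫ iso.hom.app A =
    iso.hom.app (M.obj A) ≫ N.map (iso.hom.app A) ≫ N.μ.app (Φ.obj A)

end

/-- The canonical distributive law `T_* ∘ fc_(V, P) ⇒ fc_(V, P) ∘ T_*`, for a monad `T` on `V` and an
operad `P` in `V` whose objects carry actions `α k : T(P(k)) ⟶ P(k)`: on formal composites it is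
given by the morphism
`T(P(k) × A(a₀, a₁) × ⋯ × A(aₖ₋₁, aₖ)) ⟶ P(k) × T(A(a₀, a₁)) × ⋯ × T(A(aₖ₋₁, aₖ))` induced by the
projections and `α k`. -/
def IsCanonicalLaw {V : Type (u + 1)} [Category.{u} V] [HasFiniteProducts V] {P : Operad V}
    (F : FreePCat P) (T : CategoryTheory.Monad V) (α : ∀ k, T.obj (P.obj k) ⟶ P.obj k)
    (l : DistribLaw F.fc (VGraph.mapMonad T)) : Prop :=
  ∀ (A : VGraph V) (k : ℕ) (a : Fin (k + 1) → A.obj),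
    let B : VGraph V := (VGraph.mapMonad T).obj A
    let ι : B ⟶ (F.free.obj B).toVGraph := F.incl B
    let lA : (VGraph.mapMonad T).obj (F.free.obj A).toVGraph ⟶ (F.free.obj B).toVGraph :=
      l.law.app A
    (⟨_, _, T.map (F.formal A a) ≫ lA.map _ _⟩ : VGraph.Arr
      (T.obj (P.obj k ⨯ ∏ᶜ fun i : Fin k => A.hom (a i.castSucc) (a i.succ)))
      (F.free.obj B).toVGraph) =
    ⟨_, _, (F.free.obj B).op (fun t => ι.obj (a t)) (T.map prod.fst ≫ α k)
      (fun i => T.map (prod.snd ≫ Pi.π _ i) ≫ ι.map (a i.castSucc) (a i.succ))⟩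

/-! ### Globular sets -/

/-- A globular set. -/
structure GSet where
  cells : ℕ → Type u
  src : ∀ {k : ℕ}, cells (k + 1) → cells k
  tgt : ∀ {k : ℕ}, cells (k + 1) → cells k
  src_src : ∀ {k : ℕ} (x : cells (k + 2)), src (src x) = src (tgt x)
  tgt_src : ∀ {k : ℕ} (x : cells (k + 2)), tgt (src x) = tgt (tgt x)

namespace GSet

/-- A morphism of globular sets. -/
@[ext]
structure Hom (A B : GSet.{u}) where
  map : ∀ {k : ℕ}, A.cells k → B.cells k
  map_src : ∀ {k : ℕ} (x : A.cells (k + 1)), map (A.src x) = B.src (map x)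
  map_tgt : ∀ {k : ℕ} (x : A.cells (k + 1)), map (A.tgt x) = B.tgt (map x)

instance : Category GSet.{u} where
  Hom := Hom
  id A := ⟨fun x => x, fun _ => rfl, fun _ => rfl⟩
  comp f g := ⟨fun x => g.map (f.map x), fun x => by rw [f.map_src, g.map_src],
    fun x => by rw [f.map_tgt, g.map_tgt]⟩

end GSet

/-- The property of having no cells in dimensions greater than `n`. -/
def IsNDim (n : ℕ) : ObjectProperty GSet.{u} := fun A => ∀ k, n < k → IsEmpty (A.cells k)

/-- The category of `n`-globular sets: globular sets `A` with `A_k` empty for all `k > n`. -/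
abbrev NGSet (n : ℕ) : Type (u + 1) := (IsNDim.{u} n).FullSubcategory

namespace NGSet

/-- The product of a finite family of `n`-globular sets. (For the empty family, the restriction to
dimensions at most `n` matters.) -/
def pi {n m : ℕ} (A : Fin m → NGSet.{u} n) : NGSet.{u} n where
  obj :=
    { cells := fun k => {_x : ∀ j, (A j).obj.cells k // k ≤ n}
      src := fun x => ⟨fun j => (A j).obj.src (x.1 j), Nat.le_of_succ_le x.2⟩
      tgt := fun x => ⟨fun j => (A j).obj.tgt (x.1 j), Nat.le_of_succ_le x.2⟩
      src_src := fun x => Subtype.ext (funext fun j => (A j).obj.src_src (x.1 j))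
      tgt_src := fun x => Subtype.ext (funext fun j => (A j).obj.tgt_src (x.1 j)) }
  property := fun _ hk => ⟨fun x => absurd x.2 (Nat.not_le_of_lt hk)⟩

instance (n : ℕ) : HasFiniteProducts (NGSet.{u} n) where
  out m :=
    { has_limit := fun K => by
        have hle : ∀ (B : NGSet.{u} n) {k : ℕ} (_ : B.obj.cells k), k ≤ n := fun B k x => by
          by_contra hk
          exact (B.property k (Nat.lt_of_not_le hk)).false x
        have key : ∀ A : Fin m → NGSet.{u} n, HasLimit (Discrete.functor A) := fun A =>
          ⟨⟨⟨Fan.mk (pi A)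
              (fun j => ⟨⟨fun x => x.1 j, fun _ => rfl, fun _ => rfl⟩⟩),
            Fan.IsLimit.mk _
              (fun s => ⟨⟨fun x => ⟨fun j => (s.proj j).hom.map x, hle _ x⟩,
                fun x => Subtype.ext (funext fun j => (s.proj j).hom.map_src x),
                fun x => Subtype.ext (funext fun j => (s.proj j).hom.map_tgt x)⟩⟩)
              (fun s j => rfl)
              (fun s f h => by
                apply ObjectProperty.hom_ext
                apply GSet.Hom.ext
                funext k x
                apply Subtype.ext
                funext j
                exact congrArg (fun g => GSet.Hom.map (InducedCategory.Hom.hom g) x) (h j))⟩⟩⟩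
        have := key (K.obj ∘ Discrete.mk)
        exact hasLimit_of_iso Discrete.natIsoFunctor.symm }

/-- Sets, regarded as `0`-globular sets. -/
def ofType : Type u ⥤ NGSet.{u} 0 where
  obj S :=
    { obj :=
        { cells := fun k => match k with
            | 0 => S
            | _ + 1 => PEmpty
          src := fun x => x.elim
          tgt := fun x => x.elim
          src_src := fun x => x.elim
          tgt_src := fun x => x.elim }
      property := fun k hk => match k, hk with
        | _ + 1, _ => ⟨fun x => x.elim⟩ }
  map f := ⟨⟨fun {k} => match k with
      | 0 => fun x => f x
      | _ + 1 => fun x => x, fun x => x.elim, fun x => x.elim⟩⟩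
  map_id S := by
    apply ObjectProperty.hom_ext
    apply GSet.Hom.ext
    funext k x
    cases k <;> rfl
  map_comp f g := by
    apply ObjectProperty.hom_ext
    apply GSet.Hom.ext
    funext k x
    cases k <;> rfl

/-- The globular set of a graph enriched in globular sets: its `0`-cells are the objects, and its
`(k + 1)`-cells are the `k`-cells of the hom-objects. -/
def graphCells (A : VGraph GSet.{u}) : GSet.{u} where
  cells k := match k with
    | 0 => A.obj
    | k + 1 => Σ x y : A.obj, (A.hom x y).cells k
  src {k} := match k with
    | 0 => fun c => c.1
    | _ + 1 => fun c => ⟨c.1, c.2.1, (A.hom c.1 c.2.1).src c.2.2⟩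
  tgt {k} := match k with
    | 0 => fun c => c.2.1
    | _ + 1 => fun c => ⟨c.1, c.2.1, (A.hom c.1 c.2.1).tgt c.2.2⟩
  src_src {k} := match k with
    | 0 => fun _ => rfl
    | _ + 1 => fun c => by
      simp only [(A.hom c.1 c.2.1).src_src]
  tgt_src {k} := match k with
    | 0 => fun _ => rfl
    | _ + 1 => fun c => by
      simp only [(A.hom c.1 c.2.1).tgt_src]

/-- The action of `graphCells` on morphisms. -/
def graphCellsMap {A B : VGraph GSet.{u}} (f : VGraph.Hom A B) :
    GSet.Hom (graphCells A) (graphCells B) where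
  map {k} := match k with
    | 0 => f.obj
    | _ + 1 => fun c => ⟨f.obj c.1, f.obj c.2.1, (f.map c.1 c.2.1).map c.2.2⟩
  map_src {k} := match k with
    | 0 => fun _ => rfl
    | _ + 1 => fun c => congrArg (fun z : (B.hom (f.obj c.1) (f.obj c.2.1)).cells _ =>
        (⟨f.obj c.1, f.obj c.2.1, z⟩ : Σ x y : B.obj, (B.hom x y).cells _))
          ((f.map c.1 c.2.1).map_src c.2.2)
  map_tgt {k} := match k with
    | 0 => fun _ => rfl
    | _ + 1 => fun c => congrArg (fun z : (B.hom (f.obj c.1) (f.obj c.2.1)).cells _ =>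
        (⟨f.obj c.1, f.obj c.2.1, z⟩ : Σ x y : B.obj, (B.hom x y).cells _))
          ((f.map c.1 c.2.1).map_tgt c.2.2)

/-- The canonical equivalence from graphs enriched in `n`-globular sets to `(n + 1)`-globular
sets. -/
def ofGraph (n : ℕ) : VGraph (NGSet.{u} n) ⥤ NGSet.{u} (n + 1) where
  obj A :=
    { obj := graphCells ⟨A.obj, fun x y => (A.hom x y).obj⟩
      property := fun k hk => match k, hk with
        | k + 1, hk =>
          ⟨fun c => ((A.hom c.1 c.2.1).property k (Nat.lt_of_succ_lt_succ hk)).false c.2.2⟩ }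
  map {A B} f := ⟨graphCellsMap (A := ⟨A.obj, fun x y => (A.hom x y).obj⟩)
    (B := ⟨B.obj, fun x y => (B.hom x y).obj⟩) ⟨f.obj, fun x y => (f.map x y).hom⟩⟩
  map_id A := by
    apply ObjectProperty.hom_ext
    apply GSet.Hom.ext
    funext k x
    cases k <;> rfl
  map_comp f g := by
    apply ObjectProperty.hom_ext
    apply GSet.Hom.ext
    funext k x
    cases k <;> rfl

end NGSet

/-! ### Iterative operadic theories of `n`-categories -/

/-- A category with finite products and a notion of contractibility for its objects. -/
structure Base where
  C : Type (u + 1)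
  [cat : Category.{u} C]
  [prods : HasFiniteProducts C]
  Contractible : C → Prop

attribute [instance] Base.cat Base.prods

namespace Base

/-- The category of sets; a set is contractible if it has exactly one element. -/
def set : Base.{u} where
  C := Type u
  Contractible S := Nonempty (Unique S)

/-- The category of `(V, P)`-categories; a `(V, P)`-category is contractible if it has an object and
all its hom-objects are contractible. -/
def next (B : Base.{u}) (P : Operad B.C) : Base.{u} where
  C := PCat P
  Contractible A := Nonempty A.obj ∧ ∀ x y : A.obj, B.Contractible (A.hom x y)

/-- The identity functor between equal categories. -/
def idOfEq {B B' : Base.{u}} (h : B = B') : B.C ⥤ B'.C :=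
  h ▸ 𝟭 B.C

end Base

/-- An iterative operadic theory of `n`-categories. -/
structure IterativeTheory where
  V : ℕ → Base.{u}
  P : ∀ n, Operad (V n).C
  contractible : ∀ n k, (V n).Contractible ((P n).obj k)
  V_zero : V 0 = Base.set
  V_succ : ∀ n, V (n + 1) = Base.next (V n) (P n)

/-- The forgetful functor from the category `V_n` to `n`-globular sets. -/
def IterativeTheory.U (τ : IterativeTheory.{u}) : ∀ n, (τ.V n).C ⥤ NGSet.{u} n
  | 0 => Base.idOfEq τ.V_zero ⋙ NGSet.ofType
  | n + 1 => Base.idOfEq (τ.V_succ n) ⋙ PCat.forget (τ.P n) ⋙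
      VGraph.mapFunctor (τ.U n) ⋙ NGSet.ofGraph n

end IterOp

namespace IterOp

/-! ### Combinatorics of blocks -/

theorem blockStart_mono {m : ℕ} (k : Fin m → ℕ) {s t : ℕ} (h : s ≤ t) :
    blockStart k s ≤ blockStart k t := by
  unfold blockStart
  refine Finset.sum_le_sum fun i _ => ?_
  split_ifs <;> omega

theorem exists_block {m : ℕ} (k : Fin m → ℕ) (s t : ℕ) (ht : t ≤ m) (hs : s < blockStart k t) :
    ∃ (i : Fin m) (j : Fin (k i)), s = blockStart k i + j := by
  induction t with
  | zero => simp [blockStart_zero] at hs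
  | succ t ih =>
    by_cases h : s < blockStart k t
    · exact ih (by omega) h
    · have e := blockStart_succ k ⟨t, ht⟩
      simp only at e
      exact ⟨⟨t, ht⟩, ⟨s - blockStart k t, by omega⟩, by simp only; omega⟩

theorem block_unique {m : ℕ} (k : Fin m → ℕ) {i i' : Fin m} {j : Fin (k i)} {j' : Fin (k i')}
    (h : blockStart k i + j = blockStart k i' + j') :
    (⟨i, j⟩ : Σ i, Fin (k i)) = ⟨i', j'⟩ := by
  have hi : i = i' := by
    by_contra hne
    rcases lt_or_gt_of_ne hne with hlt | hlt
    · have h1 := blockStart_mono k (s := i + 1) (t := i') hlt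
      have h2 := blockStart_succ k i
      have := j.isLt
      omega
    · have h1 := blockStart_mono k (s := i' + 1) (t := i) hlt
      have h2 := blockStart_succ k i'
      have := j'.isLt
      omega
  subst hi
  have : j = j' := Fin.ext (by omega)
  rw [this]

theorem exists_blockIdx {m N : ℕ} {k : Fin m → ℕ} (h : ∑ i, k i = N) (s : Fin N) :
    ∃ i j, s = blockIdx h i j := by
  have hs : (s : ℕ) < blockStart k m := by rw [blockStart_last, h]; exact s.isLt
  obtain ⟨i, j, e⟩ := exists_block k s m le_rfl hs
  exact ⟨i, j, Fin.ext e⟩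

theorem blockIdx_injective {m N : ℕ} {k : Fin m → ℕ} (h : ∑ i, k i = N) {i i' : Fin m}
    {j : Fin (k i)} {j' : Fin (k i')} (e : blockIdx h i j = blockIdx h i' j') :
    (⟨i, j⟩ : Σ i, Fin (k i)) = ⟨i', j'⟩ :=
  block_unique k (congrArg Fin.val e)

theorem exists_blockInner {m N : ℕ} {k : Fin m → ℕ} (h : ∑ i, k i = N) (s : Fin (N + 1)) :
    (∃ t, s = blockPt h t) ∨ ∃ i j, s = blockInner h i j := by
  by_cases hs : (s : ℕ) < N
  · obtain ⟨i, j, e⟩ := exists_blockIdx h ⟨s, hs⟩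
    exact Or.inr ⟨i, j.castSucc, Fin.ext (Fin.ext_iff.mp e :)⟩
  · left
    refine ⟨Fin.last m, ?_⟩
    rw [blockPt_last]
    exact Fin.ext (by simp only [Fin.val_last]; omega)

theorem blockStart_blockIdx {m N : ℕ} {k : Fin m → ℕ} (h : ∑ i, k i = N) (l : Fin N → ℕ)
    (i : Fin m) (t : ℕ) (ht : t ≤ k i) :
    blockStart l (blockStart k i + t) =
      blockStart l (blockStart k i) + blockStart (fun j => l (blockIdx h i j)) t := by
  induction t with
  | zero => simp [blockStart_zero]
  | succ t ih =>
    have e1 := blockStart_succ (fun j => l (blockIdx h i j)) ⟨t, ht⟩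
    have e2 := blockStart_succ l (blockIdx h i ⟨t, ht⟩)
    have e3 := ih (by omega)
    simp only at e1
    simp only [blockIdx] at e2
    rw [← Nat.add_assoc, e2, e3, e1, Nat.add_assoc]
    rfl

theorem blockStart_blockStart {m N : ℕ} {k : Fin m → ℕ} (h : ∑ i, k i = N) (l : Fin N → ℕ)
    {n : Fin m → ℕ} (hn : ∀ i, ∑ j, l (blockIdx h i j) = n i) (t : ℕ) (ht : t ≤ m) :
    blockStart n t = blockStart l (blockStart k t) := by
  induction t with
  | zero => simp [blockStart_zero]
  | succ t ih =>
    have e1 := blockStart_succ n ⟨t, ht⟩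
    have e2 := blockStart_succ k ⟨t, ht⟩
    have e3 := blockStart_blockIdx h l ⟨t, ht⟩ _ le_rfl
    rw [blockStart_last, hn] at e3
    simp only at e1 e2 e3
    rw [e1, e2, e3, ih (by omega)]

theorem sum_blocks {m N M : ℕ} {k : Fin m → ℕ} (h : ∑ i, k i = N) {l : Fin N → ℕ}
    (hl : ∑ s, l s = M) {n : Fin m → ℕ} (hn : ∀ i, ∑ j, l (blockIdx h i j) = n i) :
    ∑ i, n i = M := by
  rw [← blockStart_last, blockStart_blockStart h l hn m le_rfl, blockStart_last, h,
    blockStart_last, hl]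

theorem blockPt_blockPt {m N M : ℕ} {k : Fin m → ℕ} (h : ∑ i, k i = N) {l : Fin N → ℕ}
    (hl : ∑ s, l s = M) {n : Fin m → ℕ} (hn : ∀ i, ∑ j, l (blockIdx h i j) = n i)
    (hN : ∑ i, n i = M) (t : Fin (m + 1)) : blockPt hN t = blockPt hl (blockPt h t) :=
  Fin.ext (blockStart_blockStart h l hn t (Nat.le_of_lt_succ t.isLt))

theorem blockInner_blockPt {m N M : ℕ} {k : Fin m → ℕ} (h : ∑ i, k i = N) {l : Fin N → ℕ}
    (hl : ∑ s, l s = M) {n : Fin m → ℕ} (hn : ∀ i, ∑ j, l (blockIdx h i j) = n i)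
    (hN : ∑ i, n i = M) (i : Fin m) (t : Fin (k i + 1)) :
    blockInner hN i (blockPt (hn i) t) = blockPt hl (blockInner h i t) := by
  apply Fin.ext
  change blockStart n i + blockStart _ t = blockStart l (blockStart k i + t)
  rw [blockStart_blockIdx h l i t (Nat.le_of_lt_succ t.isLt),
    blockStart_blockStart h l hn i i.isLt.le]

theorem blockInner_blockInner {m N M : ℕ} {k : Fin m → ℕ} (h : ∑ i, k i = N) {l : Fin N → ℕ}
    (hl : ∑ s, l s = M) {n : Fin m → ℕ} (hn : ∀ i, ∑ j, l (blockIdx h i j) = n i)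
    (hN : ∑ i, n i = M) (i : Fin m) (j : Fin (k i)) (t : Fin (l (blockIdx h i j) + 1)) :
    blockInner hN i (blockInner (hn i) j t) = blockInner hl (blockIdx h i j) t := by
  have := congrArg Fin.val (blockInner_blockPt h hl hn hN i j.castSucc)
  apply Fin.ext
  change blockStart n i + (blockStart _ j + t) = blockStart l (blockStart k i + j) + t
  change blockStart n i + blockStart _ j = blockStart l (blockStart k i + j) at this
  omega

theorem blockIdx_blockIdx {m N M : ℕ} {k : Fin m → ℕ} (h : ∑ i, k i = N) {l : Fin N → ℕ}
    (hl : ∑ s, l s = M) {n : Fin m → ℕ} (hn : ∀ i, ∑ j, l (blockIdx h i j) = n i)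
    (hN : ∑ i, n i = M) (i : Fin m) (j : Fin (k i)) (t : Fin (l (blockIdx h i j))) :
    blockIdx hN i (blockIdx (hn i) j t) = blockIdx hl (blockIdx h i j) t :=
  Fin.ext (Fin.ext_iff.mp (blockInner_blockInner h hl hn hN i j t.castSucc) :)

/-- `b` is the concatenation of the paths `w i` of lengths `k i` from `α i` to `α (i + 1)`. -/
structure IsGlue {O : Type u} {m N : ℕ} {k : Fin m → ℕ} (h : ∑ i, k i = N)
    (α : Fin (m + 1) → O) (w : ∀ i, Fin (k i + 1) → O) (b : Fin (N + 1) → O) : Prop where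
  pt : ∀ t, b (blockPt h t) = α t
  inner : ∀ i j, b (blockInner h i j) = w i j

theorem IsGlue.unique {O : Type u} {m N : ℕ} {k : Fin m → ℕ} {h : ∑ i, k i = N}
    {α : Fin (m + 1) → O} {w : ∀ i, Fin (k i + 1) → O} {b b' : Fin (N + 1) → O}
    (hb : IsGlue h α w b) (hb' : IsGlue h α w b') : b = b' := by
  funext s
  rcases exists_blockInner h s with ⟨t, rfl⟩ | ⟨i, j, rfl⟩
  · rw [hb.pt, hb'.pt]
  · rw [hb.inner, hb'.inner]

theorem eq_of_blockStart_eq {O : Type u} {m : ℕ} {k : Fin m → ℕ}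
    {α : Fin (m + 1) → O} {w : ∀ i, Fin (k i + 1) → O} (h0 : ∀ i, w i 0 = α i.castSucc)
    (h1 : ∀ i, w i (Fin.last _) = α i.succ) {s : ℕ} (hs : s ≤ m) (d : ℕ) (hd : s + d ≤ m)
    (e : blockStart k s = blockStart k (s + d)) :
    α ⟨s, by omega⟩ = α ⟨s + d, by omega⟩ := by
  induction d with
  | zero => rfl
  | succ d ih =>
    have e1 := blockStart_mono k (s := s) (t := s + d) (by omega)
    have e2 := blockStart_succ k ⟨s + d, hd⟩
    simp only at e2
    rw [← Nat.add_assoc] at e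
    have hk : k ⟨s + d, hd⟩ = 0 := by omega
    rw [ih (by omega) (by omega)]
    refine (h0 ⟨s + d, hd⟩).symm.trans (Eq.trans ?_ (h1 ⟨s + d, hd⟩))
    congr 1
    exact Fin.ext (by simp [hk])

theorem exists_isGlue {O : Type u} {m N : ℕ} {k : Fin m → ℕ} (h : ∑ i, k i = N)
    (α : Fin (m + 1) → O) (w : ∀ i, Fin (k i + 1) → O) (h0 : ∀ i, w i 0 = α i.castSucc)
    (h1 : ∀ i, w i (Fin.last _) = α i.succ) : ∃ b, IsGlue h α w b := by
  have hpp : ∀ t t', blockPt h t = blockPt h t' → α t = α t' := by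
    have key : ∀ t t' : Fin (m + 1), t ≤ t' → blockPt h t = blockPt h t' → α t = α t' := by
      intro t t' hle e
      obtain ⟨d, hd⟩ := Nat.exists_eq_add_of_le (show (t : ℕ) ≤ t' from hle)
      have e' := congrArg Fin.val e
      change blockStart k t = blockStart k t' at e'
      rw [hd] at e'
      have := eq_of_blockStart_eq h0 h1 (s := t) (by omega) d (by omega) e'
      refine this.trans ?_
      congr 1
      exact Fin.ext hd.symm
    intro t t' e
    rcases le_total t t' with hle | hle
    · exact key t t' hle e
    · exact (key t' t hle e.symm).symm
  have hip : ∀ i j t, blockInner h i j = blockPt h t → w i j = α t := by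
    intro i j t e
    have hv := congrArg Fin.val e
    change blockStart k i + j = blockStart k t at hv
    have hj := j.isLt
    have hs := blockStart_succ k i
    by_cases hj0 : j = 0
    · subst hj0
      rw [h0]
      exact hpp _ _ ((blockInner_zero h i).symm.trans e)
    by_cases hjl : j = Fin.last _
    · subst hjl
      rw [h1]
      exact hpp _ _ ((blockInner_last h i).symm.trans e)
    exfalso
    have hj0' : (j : ℕ) ≠ 0 := fun e => hj0 (Fin.ext e)
    have hjl' : (j : ℕ) ≠ k i := fun e => hjl (Fin.ext e)
    by_cases hlt : (t : ℕ) ≤ i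
    · have := blockStart_mono k hlt
      omega
    · have := blockStart_mono k (s := i + 1) (t := t) (by omega)
      omega
  have hii : ∀ i j i' j', blockInner h i j = blockInner h i' j' → w i j = w i' j' := by
    intro i j i' j' e
    by_cases hj : (j : ℕ) < k i
    · by_cases hj' : (j' : ℕ) < k i'
      · have := block_unique k (j := ⟨j, hj⟩) (j' := ⟨j', hj'⟩) (congrArg Fin.val e)
        obtain ⟨rfl, hjj⟩ := Sigma.mk.inj this
        rw [Fin.ext (Fin.mk.inj (eq_of_heq hjj) :)]
      · have : j' = Fin.last _ := Fin.ext (by simp only [Fin.val_last]; omega)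
        subst this
        rw [h1]
        exact hip _ _ _ (e.trans (blockInner_last h i'))
    · have : j = Fin.last _ := Fin.ext (by simp only [Fin.val_last]; omega)
      subst this
      rw [h1]
      exact (hip _ _ _ (e.symm.trans (blockInner_last h i))).symm
  have key : ∀ s, ∃ o, (∀ t, s = blockPt h t → o = α t) ∧
      ∀ i j, s = blockInner h i j → o = w i j := by
    intro s
    rcases exists_blockInner h s with ⟨t, rfl⟩ | ⟨i, j, rfl⟩
    · exact ⟨α t, fun t' e => hpp _ _ e, fun i j e => (hip _ _ _ e.symm).symm⟩
    · exact ⟨w i j, fun t e => hip _ _ _ e, fun i' j' e => hii _ _ _ _ e⟩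
  choose b hb using key
  exact ⟨b, fun t => (hb _).1 t rfl, fun i j => (hb _).2 i j rfl⟩

/-! ### Arrows of `V`-graphs -/

namespace VGraph

variable {V : Type (u + 1)} [Category.{u} V]

/-- A generalized element of a hom-object as an arrow. -/
abbrev of (A : VGraph V) {X : V} {x y : A.obj} (f : X ⟶ A.hom x y) : Arr X A := ⟨x, y, f⟩

theorem of_injective {A : VGraph V} {X : V} {x y : A.obj} {f g : X ⟶ A.hom x y}
    (h : A.of f = A.of g) : f = g := by
  injection h

theorem castHom_rfl (A : VGraph V) (x y : A.obj) : A.castHom (rfl : x = x) (rfl : y = y) = 𝟙 _ :=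
  rfl

theorem of_castHom {A : VGraph V} {X : V} {x y x' y' : A.obj} (f : X ⟶ A.hom x y)
    (hx : x = x') (hy : y = y') : A.of (f ≫ A.castHom hx hy) = A.of f := by
  subst hx hy
  rw [castHom_rfl, Category.comp_id]

theorem exists_of_eq {A : VGraph V} {X : V} (e : Arr X A) {x y : A.obj} (hx : e.src = x)
    (hy : e.tgt = y) : ∃ f : X ⟶ A.hom x y, A.of f = e := by
  subst hx hy
  exact ⟨e.arr, rfl⟩

namespace Arr

variable {A B C : VGraph V} {X Y Z : V}

/-- Precomposition of an arrow with a morphism. -/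
def pre (d : Y ⟶ X) (e : Arr X A) : Arr Y A := ⟨e.src, e.tgt, d ≫ e.arr⟩

/-- The image of an arrow under a morphism of `V`-graphs. -/
def map (F : A ⟶ B) (e : Arr X A) : Arr X B :=
  ⟨F.obj e.src, F.obj e.tgt, e.arr ≫ F.map e.src e.tgt⟩

theorem map_id (e : Arr X A) : e.map (𝟙 A) = e :=
  congrArg (Arr.mk e.src e.tgt) (Category.comp_id _)

theorem map_comp (F : A ⟶ B) (G : B ⟶ C) (e : Arr X A) : e.map (F ≫ G) = (e.map F).map G :=
  congrArg (Arr.mk _ _) (Category.assoc _ _ _).symm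

theorem map_pre (F : A ⟶ B) (d : Y ⟶ X) (e : Arr X A) : (e.pre d).map F = (e.map F).pre d :=
  congrArg (Arr.mk _ _) (Category.assoc _ _ _)

theorem pre_of (d : Y ⟶ X) {x y : A.obj} (f : X ⟶ A.hom x y) :
    (A.of f).pre d = A.of (d ≫ f) := rfl

end Arr

theorem hom_ext_arr {A B : VGraph V} {F G : A ⟶ B} (hobj : ∀ x, F.obj x = G.obj x)
    (h : ∀ x y, B.of (F.map x y) = B.of (G.map x y)) : F = G := by
  obtain ⟨Fo, Fm⟩ := F
  obtain ⟨Go, Gm⟩ := G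
  obtain rfl : Fo = Go := funext hobj
  congr 1
  funext x y
  exact of_injective (h x y)

theorem exists_glue_arr {A : VGraph V} {X : V} {m N : ℕ} {k : Fin m → ℕ} (h : ∑ i, k i = N)
    (b : Fin (N + 1) → A.obj) (f : ∀ i, Fin (k i) → Arr X A)
    (hs : ∀ i j, (f i j).src = b (blockIdx h i j).castSucc)
    (ht : ∀ i j, (f i j).tgt = b (blockIdx h i j).succ) :
    ∃ g : ∀ s : Fin N, X ⟶ A.hom (b s.castSucc) (b s.succ),
      ∀ i j, A.of (g (blockIdx h i j)) = f i j := by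
  have key : ∀ s : Fin N, ∃ g : X ⟶ A.hom (b s.castSucc) (b s.succ),
      ∀ i j, s = blockIdx h i j → A.of g = f i j := by
    intro s
    obtain ⟨i, j, rfl⟩ := exists_blockIdx h s
    obtain ⟨g, hg⟩ := exists_of_eq (f i j) (hs i j) (ht i j)
    refine ⟨g, fun i' j' e => ?_⟩
    cases blockIdx_injective h e
    exact hg
  choose g hg using key
  exact ⟨g, fun i j => hg _ i j rfl⟩

end VGraph

/-! ### Generalized elements of products -/

section

variable {V : Type (u + 1)} [Category.{u} V] [HasFiniteProducts V]

/-- A generalized element of `Q × ∏ B` given by its components. -/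
noncomputable abbrev gen {X Q : V} {k : ℕ} {B : Fin k → V} (p : X ⟶ Q) (f : ∀ i, X ⟶ B i) :
    X ⟶ Q ⨯ ∏ᶜ B :=
  prod.lift p (Pi.lift f)

theorem gen_fst {X Q : V} {k : ℕ} {B : Fin k → V} (p : X ⟶ Q) (f : ∀ i, X ⟶ B i) :
    gen p f ≫ prod.fst = p :=
  prod.lift_fst _ _

theorem gen_snd {X Q : V} {k : ℕ} {B : Fin k → V} (p : X ⟶ Q) (f : ∀ i, X ⟶ B i) (i : Fin k) :
    gen p f ≫ prod.snd ≫ Pi.π B i = f i := by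
  rw [prod.lift_snd_assoc, limit.lift_π]
  rfl

theorem gen_hom_ext {X Q : V} {k : ℕ} {B : Fin k → V} {φ ψ : X ⟶ Q ⨯ ∏ᶜ B}
    (h0 : φ ≫ prod.fst = ψ ≫ prod.fst)
    (h1 : ∀ i, φ ≫ prod.snd ≫ Pi.π B i = ψ ≫ prod.snd ≫ Pi.π B i) : φ = ψ := by
  refine Limits.prod.hom_ext h0 (Pi.hom_ext _ _ fun i => ?_)
  rw [Category.assoc, Category.assoc, h1]

theorem comp_gen {X Y Q : V} {k : ℕ} {B : Fin k → V} (d : Y ⟶ X) (p : X ⟶ Q)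
    (f : ∀ i, X ⟶ B i) : d ≫ gen p f = gen (d ≫ p) (fun i => d ≫ f i) := by
  refine gen_hom_ext ?_ fun i => ?_
  · rw [Category.assoc, gen_fst, gen_fst]
  · rw [Category.assoc, gen_snd, gen_snd]

theorem gen_eta {X Q : V} {k : ℕ} {B : Fin k → V} (φ : X ⟶ Q ⨯ ∏ᶜ B) :
    gen (φ ≫ prod.fst) (fun i => φ ≫ prod.snd ≫ Pi.π B i) = φ :=
  gen_hom_ext (gen_fst _ _) fun i => gen_snd _ _ i

theorem gen_id {Q : V} {k : ℕ} {B : Fin k → V} :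
    gen prod.fst (fun i => prod.snd ≫ Pi.π B i) = 𝟙 (Q ⨯ ∏ᶜ B) :=
  gen_hom_ext ((gen_fst _ _).trans (Category.id_comp _).symm)
    fun i => (gen_snd _ _ i).trans (Category.id_comp _).symm

theorem gen_map {X Q : V} {k : ℕ} {B C : Fin k → V} (p : X ⟶ Q) (f : ∀ i, X ⟶ B i)
    (g : ∀ i, B i ⟶ C i) :
    gen p f ≫ prod.map (𝟙 Q) (Limits.Pi.map g) = gen p (fun i => f i ≫ g i) := by
  refine gen_hom_ext ?_ fun i => ?_
  · rw [Category.assoc, prod.map_fst, gen_fst, Category.comp_id, gen_fst]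
  · rw [gen_snd, Category.assoc, prod.map_snd_assoc, Pi.map_π, ← gen_snd p f i, Category.assoc,
      Category.assoc]

end

section

variable {V : Type (u + 1)} [Category.{u} V] [HasFiniteProducts V]

theorem OperadData.mul_congr (P : OperadData V) {X : V} {m N : ℕ} {k : Fin m → ℕ}
    (h : ∑ i, k i = N) {p p' : X ⟶ P.obj m} {q q' : ∀ i, X ⟶ P.obj (k i)} (hp : p = p')
    (hq : ∀ i, q i = q' i) : P.mul h p q = P.mul h p' q' := by
  obtain rfl : q = q' := funext hq
  rw [hp]

variable {P : Operad V}

theorem PCatData.comp_op (A : PCatData P) {X Y : V} (d : Y ⟶ X) {k : ℕ}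
    (a : Fin (k + 1) → A.obj) (p : X ⟶ P.obj k)
    (f : ∀ i : Fin k, X ⟶ A.hom (a i.castSucc) (a i.succ)) :
    d ≫ A.op a p f = A.op a (d ≫ p) (fun i => d ≫ f i) :=
  (Category.assoc _ _ _).symm.trans (congrArg (· ≫ A.comp a) (comp_gen d p f))

theorem PCatData.comp_eq_op (A : PCatData P) {k : ℕ} (a : Fin (k + 1) → A.obj) :
    A.comp a = A.op a prod.fst (fun i => prod.snd ≫ Pi.π _ i) :=
  (Category.id_comp _).symm.trans (congrArg (· ≫ A.comp a) gen_id.symm)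

theorem PCatData.op_congr (A : PCatData P) {X : V} {k : ℕ} {a a' : Fin (k + 1) → A.obj}
    {p p' : X ⟶ P.obj k} {f : ∀ i : Fin k, X ⟶ A.hom (a i.castSucc) (a i.succ)}
    {f' : ∀ i : Fin k, X ⟶ A.hom (a' i.castSucc) (a' i.succ)} (ha : ∀ i, a i = a' i)
    (hp : p = p') (hf : ∀ i, A.of (f i) = A.of (f' i)) :
    A.of (A.op a p f) = A.of (A.op a' p' f') := by
  obtain rfl : a = a' := funext ha
  obtain rfl : f = f' := funext fun i => VGraph.of_injective (hf i)
  rw [hp]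

namespace PCat

/-- Associativity of the composition of a `(V, P)`-category, for composable strings given as
concatenations. -/
theorem op_glue (B : PCat P) {X : V} {m N : ℕ} {k : Fin m → ℕ} (h : ∑ i, k i = N)
    (b : Fin (N + 1) → B.obj) (p : X ⟶ P.obj m) (q : ∀ i, X ⟶ P.obj (k i))
    (g : ∀ s : Fin N, X ⟶ B.hom (b s.castSucc) (b s.succ))
    (α : Fin (m + 1) → B.obj) (e : ∀ i : Fin m, X ⟶ B.hom (α i.castSucc) (α i.succ))
    (hα : ∀ t, b (blockPt h t) = α t)
    (he : ∀ i, B.of (e i) = B.of (B.op (fun j => b (blockInner h i j)) (q i)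
      (fun j => g (blockIdx h i j)))) :
    B.of (B.op α p e) = B.of (B.op b (P.mul h p q) g) := by
  rw [B.mul_op h b p q g]
  refine Eq.trans ?_ (VGraph.of_castHom _ _ _).symm
  refine B.op_congr (fun t => (hα t).symm) rfl fun i => ?_
  exact (he i).trans (VGraph.of_castHom _ _ _).symm

theorem map_op {A B : PCat P} (F : A ⟶ B) {X : V} {k : ℕ} (a : Fin (k + 1) → A.obj)
    (p : X ⟶ P.obj k) (f : ∀ i : Fin k, X ⟶ A.hom (a i.castSucc) (a i.succ)) :
    A.op a p f ≫ F.toHom.map _ _ =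
      B.op (fun i => F.toHom.obj (a i)) p (fun i => f i ≫ F.toHom.map _ _) := by
  unfold PCatData.op
  rw [Category.assoc, F.map_comp, ← Category.assoc]
  exact congrArg (· ≫ B.comp fun i => F.toHom.obj (a i)) (gen_map p f _)

/-- A morphism of `V`-graphs that commutes with the composition of generalized elements. -/
def homMk {A B : PCat P} (F : A.toVGraph ⟶ B.toVGraph)
    (h : ∀ {k : ℕ} (a : Fin (k + 1) → A.obj) {X : V} (p : X ⟶ P.obj k)
      (f : ∀ i : Fin k, X ⟶ A.hom (a i.castSucc) (a i.succ)), A.op a p f ≫ F.map _ _ =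
        B.op (fun i => F.obj (a i)) p (fun i => f i ≫ F.map _ _)) : A ⟶ B where
  toHom := F
  map_comp {k} a := by
    refine (congrArg (· ≫ F.map _ _) (A.comp_eq_op a)).trans ((h a _ _).trans ?_)
    refine congrArg (· ≫ B.comp fun i => F.obj (a i)) ?_
    refine (gen_map prod.fst (fun i => prod.snd ≫ Pi.π _ i)
      fun i : Fin k => F.map (a i.castSucc) (a i.succ)).symm.trans ?_
    rw [gen_id, Category.id_comp]

theorem hom_ext {A B : PCat P} {F G : A ⟶ B} (h : F.toHom = G.toHom) : F = G := Hom.ext h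

end PCat

end

/-! ### Distributivity of products over coproducts -/

/-- Finite products distribute over small coproducts. -/
class FinDistributive (V : Type (u + 1)) [Category.{u} V] [HasFiniteProducts V]
    [HasCoproducts.{u} V] : Prop where
  isColimit : ∀ {m : ℕ} (X : V) {H : Fin m → Type u} (Y : ∀ i, H i → V),
    Nonempty (IsColimit (Cofan.mk (X ⨯ ∏ᶜ fun i => ∐ Y i)
      (fun h : (∀ i, H i) => prod.map (𝟙 X) (Limits.Pi.map fun i => Sigma.ι (Y i) (h i)))))

/-! ### Free `(V, P)`-categories -/

section

variable {V : Type (u + 1)} [Category.{u} V] [HasFiniteProducts V] [HasCoproducts.{u} V]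

variable {P : Operad V} {A : VGraph V}

variable (P) in
omit [HasCoproducts.{u} V] in
/-- The summand of the free `(V, P)`-category that corresponds to a walk. -/
noncomputable abbrev summand {x y : A.obj} (w : A.Walk x y) : V :=
  P.obj w.1 ⨯ ∏ᶜ fun i : Fin w.1 => A.hom (w.2.1 i.castSucc) (w.2.1 i.succ)

variable (P A) in
/-- The underlying graph of the free `(V, P)`-category. -/
noncomputable def freeGraph : VGraph V where
  obj := A.obj
  hom x y := ∐ fun w : A.Walk x y => summand P w

/-- The inclusion of a summand. -/
noncomputable def formι {x y : A.obj} (w : A.Walk x y) :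
    summand P w ⟶ (freeGraph P A).hom x y :=
  Sigma.ι (fun w : A.Walk x y => summand P w) w

variable (P) in
/-- The hom-objects of the free `(V, P)`-category are coproducts. -/
noncomputable def freeIsColimit (x y : A.obj) : IsColimit (Cofan.mk (f := fun w : A.Walk x y =>
    summand P w) ((freeGraph P A).hom x y) (fun w => formι w)) :=
  coproductIsCoproduct _

/-- Formal composites. -/
noncomputable def form {X : V} {x y : A.obj} (w : A.Walk x y) (p : X ⟶ P.obj w.1)
    (f : ∀ i : Fin w.1, X ⟶ A.hom (w.2.1 i.castSucc) (w.2.1 i.succ)) :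
    X ⟶ (freeGraph P A).hom x y :=
  gen p f ≫ formι w

theorem comp_form {X Y : V} (d : Y ⟶ X) {x y : A.obj} (w : A.Walk x y) (p : X ⟶ P.obj w.1)
    (f : ∀ i : Fin w.1, X ⟶ A.hom (w.2.1 i.castSucc) (w.2.1 i.succ)) :
    d ≫ form w p f = form w (d ≫ p) (fun i => d ≫ f i) :=
  (Category.assoc _ _ _).symm.trans (congrArg (· ≫ formι w) (comp_gen d p f))

theorem form_id {x y : A.obj} (w : A.Walk x y) :
    form (P := P) w prod.fst (fun i => prod.snd ≫ Pi.π _ i) = formι w :=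
  (congrArg (· ≫ formι w) gen_id).trans (Category.id_comp _)

theorem form_congr {X : V} {x y x' y' : A.obj} {k : ℕ} {a a' : Fin (k + 1) → A.obj}
    (h : a 0 = x ∧ a (Fin.last k) = y) (h' : a' 0 = x' ∧ a' (Fin.last k) = y')
    {p p' : X ⟶ P.obj k} {f : ∀ i : Fin k, X ⟶ A.hom (a i.castSucc) (a i.succ)}
    {f' : ∀ i : Fin k, X ⟶ A.hom (a' i.castSucc) (a' i.succ)} (ha : ∀ i, a i = a' i)
    (hp : p = p') (hf : ∀ i, A.of (f i) = A.of (f' i)) :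
    (freeGraph P A).of (form (A := A) (P := P) ⟨k, a, h⟩ p f) =
      (freeGraph P A).of (form (A := A) (P := P) ⟨k, a', h'⟩ p' f') := by
  obtain rfl : a = a' := funext ha
  obtain rfl : f = f' := funext fun i => VGraph.of_injective (hf i)
  obtain ⟨rfl, rfl⟩ := h
  obtain ⟨rfl, rfl⟩ := h'
  rw [hp]

theorem freeGraph_hom_ext {x y : A.obj} {Z : V} {φ ψ : (freeGraph P A).hom x y ⟶ Z}
    (h : ∀ (w : A.Walk x y) {X : V} (p : X ⟶ P.obj w.1)
      (f : ∀ i : Fin w.1, X ⟶ A.hom (w.2.1 i.castSucc) (w.2.1 i.succ)),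
      form w p f ≫ φ = form w p f ≫ ψ) : φ = ψ := by
  refine Cofan.IsColimit.hom_ext (freeIsColimit P x y) _ _ fun w => ?_
  have := h w prod.fst (fun i => prod.snd ≫ Pi.π _ i)
  rwa [form_id] at this

/-- `c` is the formal composite of the formal composites `(w i, q i, f i)` along `α`. -/
def IsFormComp {X : V} {m : ℕ} (α : Fin (m + 1) → A.obj)
    (w : ∀ i : Fin m, A.Walk (α i.castSucc) (α i.succ)) (p : X ⟶ P.obj m)
    (q : ∀ i, X ⟶ P.obj (w i).1)
    (f : ∀ i (j : Fin (w i).1), X ⟶ A.hom ((w i).2.1 j.castSucc) ((w i).2.1 j.succ))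
    (c : X ⟶ (freeGraph P A).hom (α 0) (α (Fin.last m))) : Prop :=
  ∀ (N : ℕ) (h : ∑ i, (w i).1 = N) (b : Fin (N + 1) → A.obj)
    (g : ∀ s : Fin N, X ⟶ A.hom (b s.castSucc) (b s.succ)),
    IsGlue h α (fun i => (w i).2.1) b →
    (∀ i j, A.of (g (blockIdx h i j)) = A.of (f i j)) →
    (freeGraph P A).of c = (freeGraph P A).of (form (A := A) ⟨N, b, rfl, rfl⟩ (P.mul h p q) g)

omit [HasFiniteProducts V] [HasCoproducts.{u} V] in
theorem exists_walk_glue {X : V} {m N : ℕ} (α : Fin (m + 1) → A.obj)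
    (w : ∀ i : Fin m, A.Walk (α i.castSucc) (α i.succ)) (h : ∑ i, (w i).1 = N)
    (f : ∀ i (j : Fin (w i).1), X ⟶ A.hom ((w i).2.1 j.castSucc) ((w i).2.1 j.succ)) :
    ∃ (b : Fin (N + 1) → A.obj) (g : ∀ s : Fin N, X ⟶ A.hom (b s.castSucc) (b s.succ)),
      IsGlue h α (fun i => (w i).2.1) b ∧ ∀ i j, A.of (g (blockIdx h i j)) = A.of (f i j) := by
  obtain ⟨b, hb⟩ := exists_isGlue h α (fun i => (w i).2.1) (fun i => (w i).2.2.1)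
    (fun i => (w i).2.2.2)
  obtain ⟨g, hg⟩ := VGraph.exists_glue_arr h b (fun i j => A.of (f i j))
    (fun i j => (hb.inner i j.castSucc).symm) (fun i j => (hb.inner i j.succ).symm)
  exact ⟨b, g, hb, hg⟩

theorem isFormComp_of_glue {X : V} {m N : ℕ} {α : Fin (m + 1) → A.obj}
    {w : ∀ i : Fin m, A.Walk (α i.castSucc) (α i.succ)} {p : X ⟶ P.obj m}
    {q : ∀ i, X ⟶ P.obj (w i).1}
    {f : ∀ i (j : Fin (w i).1), X ⟶ A.hom ((w i).2.1 j.castSucc) ((w i).2.1 j.succ)}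
    {c : X ⟶ (freeGraph P A).hom (α 0) (α (Fin.last m))} (h : ∑ i, (w i).1 = N)
    {b : Fin (N + 1) → A.obj} {g : ∀ s : Fin N, X ⟶ A.hom (b s.castSucc) (b s.succ)}
    (hb : IsGlue h α (fun i => (w i).2.1) b)
    (hg : ∀ i j, A.of (g (blockIdx h i j)) = A.of (f i j))
    (hc : (freeGraph P A).of c =
      (freeGraph P A).of (form (A := A) ⟨N, b, rfl, rfl⟩ (P.mul h p q) g)) :
    IsFormComp α w p q f c := by
  intro N' h' b' g' hb' hg'
  obtain rfl : N = N' := h.symm.trans h'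
  obtain rfl := hb.unique hb'
  refine hc.trans (form_congr _ _ (fun _ => rfl) rfl fun s => ?_)
  obtain ⟨i, j, rfl⟩ := exists_blockIdx h s
  exact (hg i j).trans (hg' i j).symm

theorem exists_isFormComp {X : V} {m : ℕ} (α : Fin (m + 1) → A.obj)
    (w : ∀ i : Fin m, A.Walk (α i.castSucc) (α i.succ)) (p : X ⟶ P.obj m)
    (q : ∀ i, X ⟶ P.obj (w i).1)
    (f : ∀ i (j : Fin (w i).1), X ⟶ A.hom ((w i).2.1 j.castSucc) ((w i).2.1 j.succ)) :
    ∃ c, IsFormComp α w p q f c := by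
  obtain ⟨b, g, hb, hg⟩ := exists_walk_glue α w rfl f
  have h0 : b 0 = α 0 := by rw [← hb.pt, blockPt_zero]
  have h1 : b (Fin.last _) = α (Fin.last m) := by rw [← hb.pt, blockPt_last]
  refine ⟨form ⟨_, b, h0, h1⟩ (P.mul rfl p q) g, isFormComp_of_glue rfl hb hg ?_⟩
  exact form_congr _ _ (fun _ => rfl) rfl (fun _ => rfl)

theorem IsFormComp.pre {X Y : V} {m : ℕ} {α : Fin (m + 1) → A.obj}
    {w : ∀ i : Fin m, A.Walk (α i.castSucc) (α i.succ)} {p : X ⟶ P.obj m}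
    {q : ∀ i, X ⟶ P.obj (w i).1}
    {f : ∀ i (j : Fin (w i).1), X ⟶ A.hom ((w i).2.1 j.castSucc) ((w i).2.1 j.succ)}
    {c : X ⟶ (freeGraph P A).hom (α 0) (α (Fin.last m))} (hc : IsFormComp α w p q f c)
    (d : Y ⟶ X) :
    IsFormComp α w (d ≫ p) (fun i => d ≫ q i) (fun i j => d ≫ f i j) (d ≫ c) := by
  obtain ⟨b, g, hb, hg⟩ := exists_walk_glue α w rfl f
  refine isFormComp_of_glue rfl hb (g := fun s => d ≫ g s)
    (fun i j => congrArg (VGraph.Arr.pre d) (hg i j)) ?_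
  refine (congrArg (VGraph.Arr.pre d) (hc _ rfl b g hb hg)).trans ?_
  refine congrArg (VGraph.Arr.mk _ _) ((comp_form _ _ _ _).trans ?_)
  rw [OperadData.comp_mul]

/-- Composition in the free `(V, P)`-category, on a summand. -/
noncomputable def formComp {X : V} {m : ℕ} (α : Fin (m + 1) → A.obj)
    (w : ∀ i : Fin m, A.Walk (α i.castSucc) (α i.succ)) (p : X ⟶ P.obj m)
    (q : ∀ i, X ⟶ P.obj (w i).1)
    (f : ∀ i (j : Fin (w i).1), X ⟶ A.hom ((w i).2.1 j.castSucc) ((w i).2.1 j.succ)) :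
    X ⟶ (freeGraph P A).hom (α 0) (α (Fin.last m)) :=
  (exists_isFormComp α w p q f).choose

variable [FinDistributive V]

variable (P A) in
/-- Distributivity for the hom-objects of the free `(V, P)`-category. -/
noncomputable def freeDistrib (X : V) {m : ℕ} (x y : Fin m → A.obj) :
    IsColimit (Cofan.mk (f := fun w : ∀ i, A.Walk (x i) (y i) => X ⨯ ∏ᶜ fun i => summand P (w i))
      (X ⨯ ∏ᶜ fun i => (freeGraph P A).hom (x i) (y i))
      (fun w => prod.map (𝟙 X) (Limits.Pi.map fun i => formι (w i)))) :=
  (FinDistributive.isColimit X (fun (i : Fin m) (w : A.Walk (x i) (y i)) => summand P w)).some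

/-- Composition in the free `(V, P)`-category, on a summand. -/
noncomputable def summandComp {m : ℕ} (α : Fin (m + 1) → A.obj)
    (w : ∀ i : Fin m, A.Walk (α i.castSucc) (α i.succ)) :
    (P.obj m ⨯ ∏ᶜ fun i => summand P (w i)) ⟶ (freeGraph P A).hom (α 0) (α (Fin.last m)) :=
  formComp α w prod.fst (fun i => prod.snd ≫ Pi.π _ i ≫ prod.fst)
    (fun i j => prod.snd ≫ Pi.π _ i ≫ prod.snd ≫ Pi.π _ j)

variable (P A) in
/-- The data of the free `(V, P)`-category. -/
noncomputable def freeData : PCatData P :=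
  { freeGraph P A with
    comp := fun {m} α => Cofan.IsColimit.desc
      (freeDistrib P A (P.obj m) (fun i : Fin m => α i.castSucc) (fun i => α i.succ))
      (fun w => summandComp (P := P) (A := A) α w) }

theorem gen_form_comp {X : V} {m : ℕ} (α : Fin (m + 1) → A.obj)
    (w : ∀ i : Fin m, A.Walk (α i.castSucc) (α i.succ)) (p : X ⟶ P.obj m)
    (g : ∀ i, X ⟶ summand P (w i)) :
    (freeData P A).op α p (fun i => g i ≫ formι (w i)) =
      gen p g ≫ summandComp α w := by
  have e := Cofan.IsColimit.fac
    (freeDistrib P A (P.obj m) (fun i : Fin m => α i.castSucc) (fun i => α i.succ))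
    (fun w => summandComp (P := P) (A := A) α w) w
  refine Eq.trans ?_ (congrArg (gen p g ≫ ·) e)
  refine Eq.trans ?_ (Category.assoc _ _ _)
  exact congrArg (· ≫ (freeData P A).comp α) (gen_map p g fun i => formι (w i)).symm

theorem isFormComp_op {X : V} {m : ℕ} (α : Fin (m + 1) → A.obj)
    (w : ∀ i : Fin m, A.Walk (α i.castSucc) (α i.succ)) (p : X ⟶ P.obj m)
    (q : ∀ i, X ⟶ P.obj (w i).1)
    (f : ∀ i (j : Fin (w i).1), X ⟶ A.hom ((w i).2.1 j.castSucc) ((w i).2.1 j.succ)) :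
    IsFormComp α w p q f ((freeData P A).op α p (fun i => form (w i) (q i) (f i))) := by
  have e : (freeData P A).op α p (fun i => form (w i) (q i) (f i)) = _ :=
    gen_form_comp α w p (fun i => gen (q i) (f i))
  rw [e]
  have key := IsFormComp.pre (exists_isFormComp α w (X := P.obj m ⨯ ∏ᶜ fun i => summand P (w i))
      (prod.fst : _ ⟶ P.obj m) (fun i => prod.snd ≫ Pi.π _ i ≫ prod.fst)
      (fun i j => prod.snd ≫ Pi.π _ i ≫ prod.snd ≫ Pi.π _ j)).choose_spec
      (gen p (fun i => gen (q i) (f i)))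
  have e1 : ∀ i, gen p (fun i => gen (q i) (f i)) ≫
      prod.snd ≫ Pi.π (fun i => summand P (w i)) i ≫ prod.fst = q i := fun i => by
    rw [← Category.assoc prod.snd, ← Category.assoc, gen_snd, gen_fst]
  have e2 : ∀ i j, gen p (fun i => gen (q i) (f i)) ≫
      prod.snd ≫ Pi.π (fun i => summand P (w i)) i ≫ prod.snd ≫ Pi.π _ j = f i j := fun i j => by
    rw [← Category.assoc prod.snd, ← Category.assoc, gen_snd, gen_snd]
  rw [gen_fst, funext e1, funext fun i => funext (e2 i)] at key
  exact key

theorem of_op_form {X : V} {m N : ℕ} (α : Fin (m + 1) → A.obj)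
    (w : ∀ i : Fin m, A.Walk (α i.castSucc) (α i.succ)) (p : X ⟶ P.obj m)
    (q : ∀ i, X ⟶ P.obj (w i).1)
    (f : ∀ i (j : Fin (w i).1), X ⟶ A.hom ((w i).2.1 j.castSucc) ((w i).2.1 j.succ))
    (h : ∑ i, (w i).1 = N) (b : Fin (N + 1) → A.obj)
    (g : ∀ s : Fin N, X ⟶ A.hom (b s.castSucc) (b s.succ))
    (hb : IsGlue h α (fun i => (w i).2.1) b)
    (hg : ∀ i j, A.of (g (blockIdx h i j)) = A.of (f i j)) :
    (freeGraph P A).of ((freeData P A).op α p (fun i => form (w i) (q i) (f i))) =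
      (freeGraph P A).of (form (A := A) ⟨N, b, rfl, rfl⟩ (P.mul h p q) g) :=
  isFormComp_op α w p q f N h b g hb hg

/-- To check an identity between natural transformations of generalized elements of hom-objects of
the free `(V, P)`-category, it suffices to consider formal composites. -/
theorem free_cover {X Z : V} {m : ℕ} {x y : Fin m → A.obj}
    (Φ Ψ : ∀ {Y : V} (_ : Y ⟶ X) (_ : ∀ s, Y ⟶ (freeGraph P A).hom (x s) (y s)), Y ⟶ Z)
    (hΦ : ∀ {Y Y' : V} (d : Y' ⟶ Y) e f, d ≫ Φ e f = Φ (d ≫ e) (fun s => d ≫ f s))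
    (hΨ : ∀ {Y Y' : V} (d : Y' ⟶ Y) e f, d ≫ Ψ e f = Ψ (d ≫ e) (fun s => d ≫ f s))
    (h : ∀ {Y : V} (e : Y ⟶ X) (w : ∀ s, A.Walk (x s) (y s)) (q : ∀ s, Y ⟶ P.obj (w s).1)
      (f : ∀ s (j : Fin (w s).1), Y ⟶ A.hom ((w s).2.1 j.castSucc) ((w s).2.1 j.succ)),
      Φ e (fun s => form (w s) (q s) (f s)) = Ψ e (fun s => form (w s) (q s) (f s)))
    {Y : V} (e : Y ⟶ X) (f : ∀ s, Y ⟶ (freeGraph P A).hom (x s) (y s)) : Φ e f = Ψ e f := by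
  have key : Φ (prod.fst : (X ⨯ ∏ᶜ fun i => (freeGraph P A).hom (x i) (y i)) ⟶ X)
      (fun i => prod.snd ≫ Pi.π _ i) = Ψ prod.fst (fun i => prod.snd ≫ Pi.π _ i) := by
    refine Cofan.IsColimit.hom_ext (freeDistrib P A X x y) _ _ fun w => ?_
    change prod.map (𝟙 X) (Limits.Pi.map fun i => formι (w i)) ≫ _ =
      prod.map (𝟙 X) (Limits.Pi.map fun i => formι (w i)) ≫ _
    have e0 : prod.map (𝟙 X) (Limits.Pi.map fun i => formι (P := P) (w i)) =
        gen prod.fst fun i => form (w i) ((prod.snd ≫ Pi.π _ i) ≫ prod.fst)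
          (fun j => (prod.snd ≫ Pi.π _ i) ≫ prod.snd ≫ Pi.π _ j) := by
      refine gen_hom_ext ?_ fun i => ?_
      · rw [gen_fst, prod.map_fst, Category.comp_id]
      · rw [gen_snd, prod.map_snd_assoc, Pi.map_π, ← Category.assoc]
        exact congrArg (· ≫ formι (w i)) (gen_eta _).symm
    rw [e0, hΦ, hΨ, gen_fst]
    simp only [gen_snd]
    exact h _ _ _ _
  have := congrArg (gen e f ≫ ·) key
  simp only [hΦ, hΨ, gen_fst, gen_snd] at this
  exact this

/-- A string with one element. -/
def oneStep {A : VGraph V} {X : V} {x y : A.obj} (f : X ⟶ A.hom x y) :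
    ∀ i : Fin 1, X ⟶ A.hom ((![x, y] : Fin 2 → A.obj) i.castSucc) ((![x, y] : Fin 2 → A.obj) i.succ)
  | 0 => f

/-- The inclusion of generators into the free `(V, P)`-category. -/
noncomputable def formOne {X : V} {x y : A.obj} (f : X ⟶ A.hom x y) :
    X ⟶ (freeGraph P A).hom x y :=
  form (A := A) (P := P) ⟨1, ![x, y], rfl, rfl⟩ (P.one X) (oneStep f)

omit [FinDistributive V] in
theorem comp_formOne {X Y : V} (d : Y ⟶ X) {x y : A.obj} (f : X ⟶ A.hom x y) :
    d ≫ formOne (P := P) f = formOne (d ≫ f) := by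
  refine (comp_form _ _ _ _).trans ?_
  refine VGraph.of_injective (A := freeGraph P A) ?_
  refine form_congr (k := 1) _ _ (fun i => rfl) (OperadData.comp_one _ _) (fun i => ?_)
  match i with
  | 0 => rfl

theorem blockStart_ones {k : ℕ} (t : ℕ) (ht : t ≤ k) : blockStart (fun _ : Fin k => 1) t = t := by
  induction t with
  | zero => exact blockStart_zero _
  | succ t ih =>
    have := blockStart_succ (fun _ : Fin k => 1) ⟨t, ht⟩
    simp only at this
    rw [this, ih (by omega)]

theorem form_eq_op {X : V} {k : ℕ} (a : Fin (k + 1) → A.obj) (p : X ⟶ P.obj k)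
    (f : ∀ i : Fin k, X ⟶ A.hom (a i.castSucc) (a i.succ)) :
    form ⟨k, a, rfl, rfl⟩ p f = (freeData P A).op a p (fun i => formOne (f i)) := by
  apply VGraph.of_injective (A := freeGraph P A)
  have h : ∑ i : Fin k, 1 = k := by simp
  have h0 : ∀ t, blockPt h t = t := fun t =>
    Fin.ext (blockStart_ones _ (Nat.le_of_lt_succ t.isLt))
  symm
  refine (of_op_form a (fun i => ⟨1, ![a i.castSucc, a i.succ], rfl, rfl⟩) p (fun _ => P.one X)
    (fun i => oneStep (f i)) h a f ⟨fun t => congrArg a (h0 t), ?_⟩ ?_).trans ?_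
  · intro i (j : Fin 2)
    match j with
    | 0 => exact (congrArg a ((blockInner_zero h i).trans (h0 _)))
    | 1 => exact (congrArg a ((blockInner_last h i).trans (h0 _)))
  · intro i (j : Fin 1)
    match j with
    | 0 =>
      have : blockIdx h i 0 = i := Fin.ext (Fin.ext_iff.mp (h0 i.castSucc) :)
      change A.of (f (blockIdx h i 0)) = A.of (f i)
      rw [this]
  · exact congrArg (fun p => (freeGraph P A).of (form ⟨k, a, rfl, rfl⟩ p f)) (P.mul_one h p)

omit [HasCoproducts.{u} V] [FinDistributive V] in
theorem Operad.one_mul' (P : Operad V) {X : V} {k : Fin 1 → ℕ} (h : ∑ i, k i = k 0)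
    (q : ∀ i, X ⟶ P.obj (k i)) : P.mul h (P.one X) q = q 0 := by
  obtain ⟨N, rfl⟩ : ∃ N, k = fun _ => N := ⟨k 0, funext fun i => by rw [Subsingleton.elim i 0]⟩
  obtain ⟨q', rfl⟩ : ∃ q', q = fun _ => q' :=
    ⟨q 0, funext fun i => by rw [Subsingleton.elim i 0]⟩
  exact P.one_mul h q'

theorem freeData_one_op {X : V} (a : Fin 2 → A.obj)
    (f : ∀ i : Fin 1, X ⟶ (freeGraph P A).hom (a i.castSucc) (a i.succ)) :
    (freeData P A).op a (P.one X) f = f 0 := by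
  refine free_cover (P := P) (A := A) (Z := (freeGraph P A).hom (a 0) (a (Fin.last 1))) (X := X)
    (x := fun i : Fin 1 => a i.castSucc) (y := fun i => a i.succ)
    (fun {Y} _ f => (freeData P A).op a (P.one Y) f) (fun _ f => f 0)
    (fun d e f => ?_) (fun d e f => rfl) (fun {Y} e w q f => ?_) (𝟙 X) f
  · exact ((freeData P A).comp_op d a (P.one _) f).trans
      (congrArg (fun p => (freeData P A).op a p _) (OperadData.comp_one _ _))
  · apply VGraph.of_injective (A := freeGraph P A)
    have hN : ∑ i, (w i).1 = (w 0).1 := by simp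
    have h0 : ∀ j, blockInner hN 0 j = j := fun j => Fin.ext (by
      change blockStart _ 0 + (j : ℕ) = j
      rw [blockStart_zero, Nat.zero_add])
    have h1 : ∀ j, blockIdx hN 0 j = j := fun j => Fin.ext (by
      change blockStart _ 0 + (j : ℕ) = j
      rw [blockStart_zero, Nat.zero_add])
    refine (of_op_form a w (P.one Y) q f hN (w 0).2.1 (f 0) ⟨?_, ?_⟩ ?_).trans ?_
    · intro t
      match t with
      | 0 => exact (congrArg (w 0).2.1 (blockPt_zero hN)).trans (w 0).2.2.1
      | 1 => exact (congrArg (w 0).2.1 (blockPt_last hN)).trans (w 0).2.2.2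
    · intro i j
      match i with
      | 0 => exact congrArg (w 0).2.1 (h0 j)
    · intro i j
      match i with
      | 0 =>
        exact congrArg (fun j => A.of (f 0 j)) (h1 j)
    · refine form_congr (k := (w 0).1) _ _ (fun i => rfl) ?_ (fun i => rfl)
      exact P.one_mul' (k := fun i => (w i).1) hN q

theorem freeData_mul_op {X : V} {m N : ℕ} {k : Fin m → ℕ} (h : ∑ i, k i = N)
    (a : Fin (N + 1) → A.obj) (p : X ⟶ P.obj m) (q : ∀ i, X ⟶ P.obj (k i))
    (f : ∀ s : Fin N, X ⟶ (freeGraph P A).hom (a s.castSucc) (a s.succ)) :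
    (freeData P A).op a (P.mul h p q) f =
      (freeData P A).op (fun t => a (blockPt h t)) p
        (fun i => (freeData P A).op (fun j => a (blockInner h i j)) (q i)
            (fun j => f (blockIdx h i j)) ≫
          (freeGraph P A).castHom (congrArg a (blockInner_zero h i))
            (congrArg a (blockInner_last h i))) ≫
      (freeGraph P A).castHom (congrArg a (blockPt_zero h)) (congrArg a (blockPt_last h)) := by
  have key := free_cover (P := P) (A := A)
    (Z := (freeGraph P A).hom (a 0) (a (Fin.last N))) (X := X)
    (x := fun i : Fin N => a i.castSucc) (y := fun i => a i.succ)
    (fun {Y} d f => (freeData P A).op a (P.mul h (d ≫ p) (fun i => d ≫ q i)) f)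
    (fun d f => (freeData P A).op (fun t => a (blockPt h t)) (d ≫ p)
        (fun i => (freeData P A).op (fun j => a (blockInner h i j)) (d ≫ q i)
            (fun j => f (blockIdx h i j)) ≫
          (freeGraph P A).castHom (congrArg a (blockInner_zero h i))
            (congrArg a (blockInner_last h i))) ≫
      (freeGraph P A).castHom (congrArg a (blockPt_zero h)) (congrArg a (blockPt_last h)))
    (fun d e f => ?_) (fun d e f => ?_) (fun {Y} e w r f => ?_) (𝟙 X) f
  · simp only [Category.id_comp] at key
    exact key
  · refine ((freeData P A).comp_op d a _ f).trans ?_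
    rw [OperadData.comp_mul]
    simp only [Category.assoc]
    rfl
  · refine (Category.assoc _ _ _).symm.trans (congrArg (· ≫ (freeGraph P A).castHom _ _) ?_)
    refine ((freeData P A).comp_op d _ _ _).trans ?_
    refine congrArg₂ (fun p f => (freeData P A).op _ p f) (Category.assoc _ _ _).symm
      (funext fun i => ?_)
    refine (Category.assoc _ _ _).symm.trans (congrArg (· ≫ (freeGraph P A).castHom _ _) ?_)
    refine ((freeData P A).comp_op d _ _ _).trans ?_
    exact congrArg (fun p => (freeData P A).op _ p _) (Category.assoc _ _ _).symm
  · obtain ⟨b, g, hb, hg⟩ := exists_walk_glue a w rfl f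
    have hN := sum_blocks h (l := fun s => (w s).1) rfl (n := fun i => ∑ j, (w (blockIdx h i j)).1)
      (fun i => rfl)
    have e1 : ∀ i t, b (blockInner hN i (blockPt rfl t)) = a (blockInner h i t) := fun i t =>
      (congrArg b (blockInner_blockPt h rfl (fun _ => rfl) hN i t)).trans (hb.pt _)
    have e2 : ∀ i j t, b (blockInner hN i (blockInner rfl j t)) = (w (blockIdx h i j)).2.1 t :=
      fun i j t => (congrArg b (blockInner_blockInner h rfl (fun _ => rfl) hN i j t)).trans (hb.inner _ _)
    have e3 : ∀ t, b (blockPt hN t) = a (blockPt h t) := fun t =>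
      (congrArg b (blockPt_blockPt h rfl (fun _ => rfl) hN t)).trans (hb.pt _)
    apply VGraph.of_injective (A := freeGraph P A)
    refine (of_op_form a w _ r f rfl b g hb hg).trans ?_
    refine Eq.trans ?_ (VGraph.of_castHom _ _ _).symm
    refine Eq.trans ?_ ((freeData P A).op_congr (fun t => rfl) rfl (f := fun i => form
      ⟨∑ j, (w (blockIdx h i j)).1, fun t => b (blockInner hN i t),
        (congrArg b (blockInner_zero hN i)).trans (e3 _),
        (congrArg b (blockInner_last hN i)).trans (e3 _)⟩ (P.mul rfl (e ≫ q i) fun j => r (blockIdx h i j))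
      (fun t => g (blockIdx hN i t))) fun i => ?_)
    · refine Eq.trans ?_ (of_op_form (fun t => a (blockPt h t)) _ _ _ _ hN b g
        ⟨e3, fun i j => rfl⟩ (fun i j => rfl)).symm
      refine congrArg (fun p => (freeGraph P A).of (form ⟨_, b, rfl, rfl⟩ p g)) ?_
      exact P.assoc h rfl (fun i => rfl) hN _ _ _
    · refine Eq.trans ?_ (VGraph.of_castHom _ _ _).symm
      refine Eq.trans ?_ (of_op_form (fun t => a (blockInner h i t)) (fun j => w (blockIdx h i j))
        (e ≫ q i) (fun j => r (blockIdx h i j)) (fun j => f (blockIdx h i j)) rfl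
        (fun t => b (blockInner hN i t)) (fun t => g (blockIdx hN i t))
        ⟨e1 i, e2 i⟩ (fun j t => ?_)).symm
      · exact form_congr (k := ∑ j, (w (blockIdx h i j)).1) _ _ (fun _ => rfl) rfl (fun _ => rfl)
      · change A.of (g (blockIdx hN i (blockIdx rfl j t))) = _
        exact (congrArg (fun s => A.of (g s)) (blockIdx_blockIdx h (l := fun s => (w s).1) rfl
          (fun _ => rfl) hN i j t)).trans (hg _ _)

variable (P A) in
/-- The free `(V, P)`-category on a `V`-graph. -/
noncomputable def freePCat : PCat P where
  toPCatData := freeData P A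
  one_op a f := freeData_one_op (P := P) (A := A) a f
  mul_op h a p q f := freeData_mul_op (P := P) (A := A) h a p q f

variable (P A) in
/-- The inclusion of generators into the free `(V, P)`-category. -/
noncomputable def freeIncl : A ⟶ (freePCat P A).toVGraph where
  obj := id
  map x y := formOne (𝟙 (A.hom x y))

theorem freeIncl_map {X : V} {x y : A.obj} (f : X ⟶ A.hom x y) :
    f ≫ (freeIncl P A).map x y = formOne f :=
  (comp_formOne _ _).trans (congrArg formOne (Category.comp_id f))

theorem form_eq_op_incl {X : V} {k : ℕ} (a : Fin (k + 1) → A.obj) (p : X ⟶ P.obj k)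
    (f : ∀ i : Fin k, X ⟶ A.hom (a i.castSucc) (a i.succ)) :
    form ⟨k, a, rfl, rfl⟩ p f = (freePCat P A).op a p
      (fun i => f i ≫ (freeIncl P A).map (a i.castSucc) (a i.succ)) := by
  refine (form_eq_op a p f).trans ?_
  exact congrArg (fun f => (freeData P A).op a p f) (funext fun i => (freeIncl_map (f i)).symm)

/-- The extension of a morphism of `V`-graphs to the free `(V, P)`-category, on hom-objects. -/
noncomputable def freeExtMap {B : PCat P} (G : A ⟶ B.toVGraph) (x y : A.obj) :
    (freeGraph P A).hom x y ⟶ B.hom (G.obj x) (G.obj y) :=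
  Cofan.IsColimit.desc (freeIsColimit P x y) (fun w =>
    B.op (fun t => G.obj (w.2.1 t)) prod.fst
      (fun i => (prod.snd ≫ Pi.π _ i) ≫ G.map _ _) ≫
        B.castHom (congrArg G.obj w.2.2.1) (congrArg G.obj w.2.2.2))

/-- The extension of a morphism of `V`-graphs to the free `(V, P)`-category, as a morphism of
`V`-graphs. -/
noncomputable def freeExtGraph {B : PCat P} (G : A ⟶ B.toVGraph) :
    (freePCat P A).toVGraph ⟶ B.toVGraph where
  obj := G.obj
  map x y := freeExtMap G x y

theorem form_freeExtGraph {B : PCat P} (G : A ⟶ B.toVGraph) {X : V} {x y : A.obj}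
    (w : A.Walk x y) (p : X ⟶ P.obj w.1)
    (f : ∀ i : Fin w.1, X ⟶ A.hom (w.2.1 i.castSucc) (w.2.1 i.succ)) :
    form w p f ≫ (freeExtGraph G).map x y =
      B.op (fun t => G.obj (w.2.1 t)) p (fun i => f i ≫ G.map _ _) ≫
        B.castHom (congrArg G.obj w.2.2.1) (congrArg G.obj w.2.2.2) := by
  refine (Category.assoc _ _ _).trans ?_
  have e : formι w ≫ freeExtMap G x y = _ := Cofan.IsColimit.fac (freeIsColimit P x y) _ w
  refine (congrArg (gen p f ≫ ·) e).trans ?_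
  refine (Category.assoc _ _ _).symm.trans (congrArg (· ≫ B.castHom _ _) ?_)
  refine (B.comp_op _ _ _ _).trans ?_
  refine congrArg₂ (fun p f => B.op _ p f) (gen_fst _ _) (funext fun i => ?_)
  refine (Category.assoc _ _ _).symm.trans (congrArg (· ≫ G.map _ _) ?_)
  exact gen_snd _ _ _

theorem of_form_freeExtGraph {B : PCat P} (G : A ⟶ B.toVGraph) {X : V} {x y : A.obj}
    (w : A.Walk x y) (p : X ⟶ P.obj w.1)
    (f : ∀ i : Fin w.1, X ⟶ A.hom (w.2.1 i.castSucc) (w.2.1 i.succ)) :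
    B.of (form w p f ≫ (freeExtGraph G).map x y) =
      B.of (B.op (fun t => G.obj (w.2.1 t)) p (fun i => f i ≫ G.map _ _)) := by
  rw [form_freeExtGraph]
  exact VGraph.of_castHom _ _ _

/-- The extension of a morphism of `V`-graphs to the free `(V, P)`-category. -/
noncomputable def freeExt {B : PCat P} (G : A ⟶ B.toVGraph) : freePCat P A ⟶ B :=
  PCat.homMk (freeExtGraph G) (by
    intro m α X p f
    have key := free_cover (P := P) (A := A) (Z := B.hom (G.obj (α 0)) (G.obj (α (Fin.last m))))
      (X := X) (x := fun i : Fin m => α i.castSucc) (y := fun i => α i.succ)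
      (fun d f => (freePCat P A).op α (d ≫ p) f ≫ (freeExtGraph G).map _ _)
      (fun d f => B.op (fun i => G.obj (α i)) (d ≫ p) (fun i => f i ≫ (freeExtGraph G).map _ _))
      (fun d e f => ?_) (fun d e f => ?_) (fun {Y} e w r f => ?_) (𝟙 X) f
    · simp only [Category.id_comp] at key
      exact key
    · refine (Category.assoc _ _ _).symm.trans (congrArg (· ≫ (freeExtGraph G).map _ _) ?_)
      refine ((freePCat P A).comp_op d α _ f).trans ?_
      exact congrArg (fun p => (freePCat P A).op _ p _) (Category.assoc _ _ _).symm
    · refine (B.comp_op d _ _ _).trans ?_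
      exact congrArg₂ (fun p f => B.op _ p f) (Category.assoc _ _ _).symm
        (funext fun i => (Category.assoc _ _ _).symm)
    · obtain ⟨b, g, hb, hg⟩ := exists_walk_glue (A := A) α w rfl f
      apply VGraph.of_injective
      refine (congrArg (VGraph.Arr.map (freeExtGraph G))
        (of_op_form (A := A) α w (e ≫ p) r f rfl b g hb hg)).trans ?_
      refine (of_form_freeExtGraph G _ _ _).trans ?_
      refine (B.op_glue rfl (fun t => G.obj (b t)) _ _ _ _ _ (fun t => congrArg G.obj (hb.pt t))
        fun i => ?_).symm
      refine (of_form_freeExtGraph G _ _ _).trans ?_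
      exact B.op_congr (fun t => congrArg G.obj (hb.inner i t).symm) rfl
        (fun j => congrArg (VGraph.Arr.map G) (hg i j).symm))

theorem freeIncl_freeExt {B : PCat P} (G : A ⟶ B.toVGraph) :
    freeIncl P A ≫ (freeExt G).toHom = G := by
  refine VGraph.hom_ext_arr (fun _ => rfl) fun x y => ?_
  refine (of_form_freeExtGraph G _ _ _).trans ?_
  refine Eq.trans ?_ (congrArg B.of (B.one_op (fun t => G.obj (![x, y] t))
    (fun i => oneStep (𝟙 (A.hom x y)) i ≫ G.map _ _)))  |>.trans ?_
  · rfl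
  · exact congrArg B.of (Category.id_comp _)

omit [FinDistributive V] in
theorem freeGraph_hom_ext_arr {B : VGraph V} {F G : freeGraph P A ⟶ B}
    (hobj : ∀ x, F.obj x = G.obj x)
    (h : ∀ {k : ℕ} (a : Fin (k + 1) → A.obj) {X : V} (p : X ⟶ P.obj k)
      (f : ∀ i : Fin k, X ⟶ A.hom (a i.castSucc) (a i.succ)),
      ((freeGraph P A).of (form ⟨k, a, rfl, rfl⟩ p f)).map F =
        ((freeGraph P A).of (form ⟨k, a, rfl, rfl⟩ p f)).map G) : F = G := by
  obtain ⟨Fo, Fm⟩ := F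
  obtain ⟨Go, Gm⟩ := G
  obtain rfl : Fo = Go := funext hobj
  congr 1
  funext x y
  refine freeGraph_hom_ext (P := P) (A := A) fun w X p f => ?_
  obtain ⟨k, a, rfl, rfl⟩ := w
  exact VGraph.of_injective (h a p f)

theorem freePCat_hom_ext {B : PCat P} {F G : freePCat P A ⟶ B}
    (h : freeIncl P A ≫ F.toHom = freeIncl P A ≫ G.toHom) : F = G := by
  refine PCat.hom_ext (freeGraph_hom_ext_arr (P := P) (A := A)
    (fun x => congrArg (fun H : A ⟶ B.toVGraph => H.obj x) h) fun {k} a {X} p f => ?_)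
  rw [form_eq_op_incl]
  refine (congrArg B.of (PCat.map_op F a p _)).trans (Eq.trans ?_
    (congrArg B.of (PCat.map_op G a p _)).symm)
  refine B.op_congr (fun t => congrArg (fun H : A ⟶ B.toVGraph => H.obj (a t)) h) rfl fun i => ?_
  have := congrArg (fun H : A ⟶ B.toVGraph => (A.of (f i)).map H) h
  simp only [VGraph.Arr.map_comp] at this
  exact this

end

section

variable {V : Type (u + 1)} [Category.{u} V] [HasFiniteProducts V] [HasCoproducts.{u} V]
variable {P : Operad V} {A : VGraph V} [FinDistributive V]

variable (P) in
/-- The free `(V, P)`-category functor. -/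
noncomputable def freeFunctor : VGraph V ⥤ PCat P where
  obj A := freePCat P A
  map {A B} f := freeExt (f ≫ freeIncl P B)
  map_id A := freePCat_hom_ext ((freeIncl_freeExt _).trans
    ((Category.id_comp (freeIncl P A)).trans (Category.comp_id (freeIncl P A)).symm))
  map_comp {A B C} f g := freePCat_hom_ext (by
    refine (freeIncl_freeExt _).trans ?_
    refine Eq.trans ?_ (Category.assoc (freeIncl P A) (freeExt (f ≫ freeIncl P B)).toHom
      (freeExt (g ≫ freeIncl P C)).toHom)
    rw [freeIncl_freeExt, Category.assoc, Category.assoc, freeIncl_freeExt])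

theorem freeIncl_comp_map {A B : VGraph V} (f : A ⟶ B) :
    freeIncl P A ≫ ((freeFunctor P).map f).toHom = f ≫ freeIncl P B :=
  freeIncl_freeExt _

variable (P) in
/-- Free `(V, P)`-categories exist. -/
noncomputable def freeAdj : freeFunctor P ⊣ PCat.forget P :=
  Adjunction.mkOfUnitCounit
    { unit :=
        { app := fun A => freeIncl P A
          naturality := fun A B f => (freeIncl_comp_map f).symm }
      counit :=
        { app := fun B => freeExt (𝟙 B.toVGraph)
          naturality := fun B C F => freePCat_hom_ext (by
            refine (Category.assoc _ _ _).symm.trans ?_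
            refine (congrArg (· ≫ _) (freeIncl_comp_map _)).trans ?_
            refine (Category.assoc _ _ _).trans ?_
            refine (congrArg (_ ≫ ·) (freeIncl_freeExt _)).trans ?_
            refine (Category.comp_id _).trans ?_
            refine Eq.trans ?_ (Category.assoc _ _ _)
            refine Eq.trans ?_ (congrArg (· ≫ F.toHom) (freeIncl_freeExt _).symm)
            exact (Category.id_comp _).symm) }
      left_triangle := by
        ext A
        change freeExt (freeIncl P A ≫ freeIncl P (freePCat P A).toVGraph) ≫ 𝟙 (freePCat P _) ≫
          freeExt (𝟙 (freePCat P A).toVGraph) = 𝟙 (freePCat P A)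
        rw [Category.id_comp]
        refine freePCat_hom_ext ?_
        refine (Category.assoc _ _ _).symm.trans ?_
        refine (congrArg (· ≫ _) (freeIncl_freeExt _)).trans ?_
        refine (Category.assoc _ _ _).trans ?_
        exact congrArg (freeIncl P A ≫ ·) (freeIncl_freeExt (𝟙 (freePCat P A).toVGraph))
      right_triangle := by
        ext B
        exact (congrArg (_ ≫ ·) (Category.id_comp _)).trans (freeIncl_freeExt _) }

variable (P) in
/-- The free `(V, P)`-category functor with its adjunction. -/
noncomputable def freePCatStr : FreePCat P := ⟨freeFunctor P, freeAdj P⟩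

theorem freePCatStr_formal {k : ℕ} (a : Fin (k + 1) → A.obj) :
    (freePCatStr P).formal A a = formι (P := P) (A := A) ⟨k, a, rfl, rfl⟩ :=
  (form_eq_op_incl a _ _).symm.trans (form_id _)

theorem freePCatStr_isCoproductOfWalks : (freePCatStr P).IsCoproductOfWalks := by
  refine fun A => ⟨Function.bijective_id, fun x y => ⟨?_⟩⟩
  refine IsColimit.ofIsoColimit (freeIsColimit P x y) (Cofan.ext (Iso.refl _) fun w => ?_)
  refine (Category.comp_id _).trans ?_
  obtain ⟨k, a, rfl, rfl⟩ := w
  exact (freePCatStr_formal a).symm.trans (Category.comp_id _).symm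

end

/-! ### The image of a `(V, P)`-category under a functor -/

theorem PCatData.op_congr' {V : Type (u + 1)} [Category.{u} V] [HasFiniteProducts V] {P : Operad V}
    (A : PCatData P) {X : V} {k : ℕ} {a : Fin (k + 1) → A.obj} {p p' : X ⟶ P.obj k}
    {f f' : ∀ i : Fin k, X ⟶ A.hom (a i.castSucc) (a i.succ)} (hp : p = p')
    (hf : ∀ i, f i = f' i) : A.op a p f = A.op a p' f' := by
  obtain rfl : f = f' := funext hf
  rw [hp]

section

variable {V : Type (u + 1)} [Category.{u} V] [HasFiniteProducts V]
variable {W : Type (u + 1)} [Category.{u} W] [HasFiniteProducts W]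
variable {P : Operad V} (F : V ⥤ W) [PreservesFiniteProducts F]

omit [HasFiniteProducts V] [HasFiniteProducts W] [PreservesFiniteProducts F] in
theorem comp_map_castHom (A : VGraph V) {x y x' y' : A.obj} (hx : x = x') (hy : y = y')
    {X : V} {Y : W} (d : Y ⟶ F.obj X) (f : X ⟶ A.hom x y) :
    d ≫ F.map (f ≫ A.castHom hx hy) =
      (d ≫ F.map f) ≫ ((VGraph.mapFunctor F).obj A).castHom hx hy := by
  subst hx hy
  refine Eq.trans ?_ (Category.comp_id _).symm
  exact congrArg (fun f => d ≫ F.map f) (Category.comp_id _)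

/-- The data of the image of a `(V, P)`-category under a functor that preserves finite products. -/
noncomputable def PCatData.mapData (A : PCatData P) : PCatData (P.map F) :=
  { (VGraph.mapFunctor F).obj A.toVGraph with
    comp := fun {k} a => prod.map (𝟙 (F.obj (P.obj k)))
        (PreservesProduct.iso F (fun i : Fin k => A.hom (a i.castSucc) (a i.succ))).inv ≫
      (PreservesLimitPair.iso F (P.obj k)
        (∏ᶜ fun i : Fin k => A.hom (a i.castSucc) (a i.succ))).inv ≫ F.map (A.comp a) }

theorem PCatData.mapData_op (A : PCatData P) {X : V} {Y : W} (x : Y ⟶ F.obj X) {k : ℕ}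
    (a : Fin (k + 1) → A.obj) (p : X ⟶ P.obj k)
    (f : ∀ i : Fin k, X ⟶ A.hom (a i.castSucc) (a i.succ)) :
    (A.mapData F).op a (x ≫ F.map p) (fun i => x ≫ F.map (f i)) = x ≫ F.map (A.op a p f) :=
  lift_comp_map_comp F x (A.comp a) p f

/-- The image of a `(V, P)`-category under a functor that preserves finite products. -/
noncomputable def PCat.mapObj (A : PCat P) : PCat (P.map F) where
  toPCatData := A.toPCatData.mapData F
  one_op {Y} a f := by
    obtain ⟨X, x, p', f', hp, hf⟩ := exists_lift F (⊤_ V) (fun i : Fin 1 =>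
      A.hom (a i.castSucc) (a i.succ)) (terminal.from Y ≫ (PreservesTerminal.iso F).inv) f
    obtain rfl : (fun i => x ≫ F.map (f' i)) = f := funext hf
    refine (congrArg (fun p => (A.mapData F).op a p _) (P.toOperadData.map_one F x)).trans ?_
    refine (A.mapData_op F x a _ f').trans ?_
    exact congrArg (fun f => x ≫ F.map f) (A.one_op a f')
  mul_op {Y m N k} h a p q f := by
    obtain ⟨X₁, x₁, p₁, q₁, hp₁, hq₁⟩ := exists_lift F _ _ p q
    obtain ⟨X, x, y, f', hy, hf⟩ := exists_lift F X₁
      (fun i : Fin N => A.hom (a i.castSucc) (a i.succ)) x₁ f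
    have hp : p = x ≫ F.map (y ≫ p₁) := by rw [F.map_comp, ← Category.assoc, hy, hp₁]
    have hq : q = fun i => x ≫ F.map (y ≫ q₁ i) := by
      funext i
      rw [F.map_comp, ← Category.assoc, hy, hq₁]
    obtain rfl : (fun s => x ≫ F.map (f' s)) = f := funext hf
    rw [hp, hq]
    refine (congrArg (fun p => (A.mapData F).op a p _)
      (P.toOperadData.map_mul F x h (y ≫ p₁) (fun i => y ≫ q₁ i))).trans ?_
    refine (A.mapData_op F x a _ f').trans ?_
    refine (congrArg (fun f => x ≫ F.map f) (A.mul_op h a _ _ f')).trans ?_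
    refine (comp_map_castHom F A.toVGraph _ _ x _).trans ?_
    refine congrArg (· ≫ ((VGraph.mapFunctor F).obj A.toVGraph).castHom _ _) ?_
    refine (A.mapData_op F x _ _ _).symm.trans ?_
    refine congrArg (fun f => (A.mapData F).op _ _ f) (funext fun i => ?_)
    refine (comp_map_castHom F A.toVGraph _ _ x _).trans ?_
    refine congrArg (· ≫ ((VGraph.mapFunctor F).obj A.toVGraph).castHom _ _) ?_
    exact (A.mapData_op F x _ _ _).symm

theorem PCat.mapObj_op (A : PCat P) {X : V} {Y : W} (x : Y ⟶ F.obj X) {k : ℕ}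
    (a : Fin (k + 1) → A.obj) (p : X ⟶ P.obj k)
    (f : ∀ i : Fin k, X ⟶ A.hom (a i.castSucc) (a i.succ)) :
    (A.mapObj F).op a (x ≫ F.map p) (fun i => x ≫ F.map (f i)) = x ≫ F.map (A.op a p f) :=
  A.mapData_op F x a p f

theorem PCat.mapObj_op_map (A : PCat P) {X : V} {k : ℕ}
    (a : Fin (k + 1) → A.obj) (p : X ⟶ P.obj k)
    (f : ∀ i : Fin k, X ⟶ A.hom (a i.castSucc) (a i.succ)) :
    (A.mapObj F).op a (F.map p) (fun i => F.map (f i)) = F.map (A.op a p f) :=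
  ((A.mapObj F).op_congr' (Category.id_comp _).symm fun _ => (Category.id_comp _).symm).trans
    ((A.mapObj_op F (𝟙 _) a p f).trans (Category.id_comp _))

/-- The image of a morphism of `(V, P)`-categories under a functor that preserves finite
products. -/
noncomputable def PCat.mapHom {A B : PCat P} (G : A ⟶ B) : A.mapObj F ⟶ B.mapObj F :=
  PCat.homMk ((VGraph.mapFunctor F).map G.toHom) (by
    intro k a X p f
    obtain ⟨Y, x, p', f', rfl, hf⟩ := exists_lift F _ _ p f
    obtain rfl : (fun i => x ≫ F.map (f' i)) = f := funext hf
    refine (congrArg (· ≫ F.map (G.toHom.map _ _)) (A.mapObj_op F x a p' f')).trans ?_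
    refine (Category.assoc _ _ _).trans ?_
    refine (congrArg (x ≫ ·) (F.map_comp _ _).symm).trans ?_
    refine (congrArg (fun f => x ≫ F.map f) (PCat.map_op G a p' f')).trans ?_
    refine (B.mapObj_op F x _ p' _).symm.trans ?_
    refine congrArg (fun f => (B.mapObj F).op _ _ f) (funext fun i => ?_)
    exact (congrArg (x ≫ ·) (F.map_comp _ _)).trans (Category.assoc _ _ _).symm)

end

/-! ### Transposition and algebra actions -/

section

variable {V : Type (u + 1)} [Category.{u} V]
variable {W : Type (u + 1)} [Category.{u} W]
variable {U : V ⥤ W} {L : W ⥤ V} (adj : L ⊣ U)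

/-- The transpose of a morphism. -/
def tr {X : W} {Y : V} (f : X ⟶ U.obj Y) : L.obj X ⟶ Y := L.map f ≫ adj.counit.app Y

/-- The extension of a generalized element `X ⟶ U(Y)` along the unit `X ⟶ U(L(X))`. -/
def act {X : W} {Y : V} (f : X ⟶ U.obj Y) : U.obj (L.obj X) ⟶ U.obj Y := U.map (tr adj f)

theorem unit_act {X : W} {Y : V} (f : X ⟶ U.obj Y) : adj.unit.app X ≫ act adj f = f := by
  unfold act tr
  simp

theorem tr_unit_map {X : W} {Y : V} (g : L.obj X ⟶ Y) : tr adj (adj.unit.app X ≫ U.map g) = g := by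
  unfold tr
  simp

theorem act_eq {X : W} {Y : V} (f : X ⟶ U.obj Y) :
    act adj f = U.map (L.map f) ≫ U.map (adj.counit.app Y) :=
  U.map_comp _ _

theorem act_comp_map {X : W} {Y Z : V} (f : X ⟶ U.obj Y) (g : Y ⟶ Z) :
    act adj (f ≫ U.map g) = act adj f ≫ U.map g := by
  unfold act tr
  simp

theorem act_comp {X X' : W} {Y : V} (d : X' ⟶ X) (f : X ⟶ U.obj Y) :
    act adj (d ≫ f) = U.map (L.map d) ≫ act adj f := by
  unfold act tr
  simp

theorem act_act {X : W} {Y : V} (f : X ⟶ U.obj Y) :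
    act adj (act adj f) = U.map (adj.counit.app (L.obj X)) ≫ act adj f := by
  rw [act_eq]
  unfold act
  rw [← U.map_comp, ← U.map_comp]
  exact congrArg U.map (adj.counit_naturality _)

variable [HasFiniteProducts V] [HasFiniteProducts W] [PreservesFiniteProducts U]
variable {P : Operad V}

theorem tr_mul {X : W} {m N : ℕ} {k : Fin m → ℕ} (h : ∑ i, k i = N)
    (p : X ⟶ U.obj (P.obj m)) (q : ∀ i, X ⟶ U.obj (P.obj (k i))) :
    tr adj ((P.map U).mul h p q) = P.mul h (tr adj p) (fun i => tr adj (q i)) := by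
  refine Eq.trans (congrArg (tr adj) ?_) (tr_unit_map adj (P.mul h _ _))
  refine Eq.trans ?_ (P.toOperadData.map_mul U (adj.unit.app X) h (tr adj p)
    (fun i => tr adj (q i)))
  exact (P.map U).mul_congr h (unit_act adj p).symm fun i => (unit_act adj (q i)).symm

theorem act_mul {X : W} {m N : ℕ} {k : Fin m → ℕ} (h : ∑ i, k i = N)
    (p : X ⟶ U.obj (P.obj m)) (q : ∀ i, X ⟶ U.obj (P.obj (k i))) :
    act adj ((P.map U).mul h p q) =
      (P.map U).mul h (act adj p) (fun i => act adj (q i)) := by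
  refine (congrArg U.map (tr_mul adj h p q)).trans ?_
  have := P.toOperadData.map_mul U (𝟙 (U.obj (L.obj X))) h (tr adj p) (fun i => tr adj (q i))
  refine (this.trans (Category.id_comp _)).symm.trans ?_
  exact (P.map U).mul_congr h (Category.id_comp _) fun i => Category.id_comp _

theorem act_one (X : W) :
    act adj ((P.map U).one X) = (P.map U).one (U.obj (L.obj X)) := by
  have e := P.toOperadData.map_one U (adj.unit.app X)
  have e' := P.toOperadData.map_one U (𝟙 (U.obj (L.obj X)))
  rw [Category.id_comp] at e'
  refine Eq.trans ?_ e'.symm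
  unfold act
  refine congrArg U.map ?_
  exact (congrArg (tr adj) e).trans (tr_unit_map adj _)

theorem act_op (A : PCat P) {X : W} {k : ℕ} (a : Fin (k + 1) → A.obj)
    (p : X ⟶ U.obj (P.obj k))
    (f : ∀ i : Fin k, X ⟶ U.obj (A.hom (a i.castSucc) (a i.succ))) :
    act adj (Y := A.hom _ _) ((A.mapObj U).op a p f) =
      (A.mapObj U).op a (act adj p) (fun i => act adj (f i)) := by
  have := ((A.mapObj U).op_congr' (unit_act adj p).symm fun i => (unit_act adj (f i)).symm).trans
    (A.mapObj_op U (adj.unit.app X) a (tr adj p) (fun i => tr adj (f i)))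
  refine (congrArg (act adj (Y := A.hom _ _)) this).trans ?_
  refine Eq.trans ?_ (A.mapObj_op_map U a (tr adj p) (fun i => tr adj (f i))).symm
  exact congrArg U.map (tr_unit_map adj _)

end

/-! ### The canonical distributive law -/

section

variable {W : Type (u + 1)} [Category.{u} W] {W' : Type (u + 1)} [Category.{u} W']

/-- The image of an arrow under a functor. -/
def VGraph.Arr.mapF (K : W ⥤ W') {A : VGraph W} {X : W} (e : VGraph.Arr X A) :
    VGraph.Arr (K.obj X) ((VGraph.mapFunctor K).obj A) :=
  ⟨e.src, e.tgt, K.map e.arr⟩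

theorem VGraph.Arr.mapF_map (K : W ⥤ W') {A B : VGraph W} (F : A ⟶ B) {X : W}
    (e : VGraph.Arr X A) : (e.mapF K).map ((VGraph.mapFunctor K).map F) = (e.map F).mapF K :=
  congrArg (VGraph.Arr.mk _ _) (K.map_comp _ _).symm

variable [HasFiniteProducts W] [HasCoproducts.{u} W] {P : Operad W} {A : VGraph W}

theorem of_form_freeMap [FinDistributive W] {B : VGraph W} (G : A ⟶ B) {k : ℕ}
    (a : Fin (k + 1) → A.obj) {X : W} (p : X ⟶ P.obj k)
    (f : ∀ i : Fin k, X ⟶ A.hom (a i.castSucc) (a i.succ)) :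
    ((freeGraph P A).of (form ⟨k, a, rfl, rfl⟩ p f)).map ((freeFunctor P).map G).toHom =
      (freeGraph P B).of (form (A := B) ⟨k, fun t => G.obj (a t), rfl, rfl⟩ p
        (fun i => f i ≫ G.map _ _)) := by
  refine (of_form_freeExtGraph (B := freePCat P B) (G ≫ freeIncl P B) (A := A) ⟨k, a, rfl, rfl⟩
    p f).trans ?_
  refine congrArg (freeGraph P B).of (Eq.trans ?_ (form_eq_op_incl (A := B)
    (fun t => G.obj (a t)) p _).symm)
  exact (freePCat P B).op_congr' rfl fun i => (Category.assoc _ _ _).symm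

theorem of_form_counit [FinDistributive W] (B : PCat P) {k : ℕ}
    (a : Fin (k + 1) → B.obj) {X : W} (p : X ⟶ P.obj k)
    (f : ∀ i : Fin k, X ⟶ B.hom (a i.castSucc) (a i.succ)) :
    ((freeGraph P B.toVGraph).of (form (A := B.toVGraph) ⟨k, a, rfl, rfl⟩ p f)).map
      (freeExt (𝟙 B.toVGraph)).toHom = B.of (B.op a p f) := by
  refine (of_form_freeExtGraph (𝟙 B.toVGraph) (A := B.toVGraph) ⟨k, a, rfl, rfl⟩ p f).trans ?_
  exact congrArg B.of (B.op_congr' rfl fun i => Category.comp_id _)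

variable (K : W ⥤ W') [∀ J : Type u, PreservesColimitsOfShape (Discrete J) K]

variable (P) in
/-- A functor that preserves coproducts preserves the hom-objects of free `(V, P)`-categories. -/
noncomputable def mapFreeIsColimit (x y : A.obj) :
    IsColimit (Cofan.mk (f := fun w : A.Walk x y => K.obj (summand P w))
      (K.obj ((freeGraph P A).hom x y)) (fun w => K.map (formι w))) :=
  isColimitCofanMkObjOfIsColimit K _ _ (freeIsColimit P x y)

omit [∀ J : Type u, PreservesColimitsOfShape (Discrete J) K] in
theorem map_form (x y : A.obj) (w : A.Walk x y) {X : W} (p : X ⟶ P.obj w.1)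
    (f : ∀ i : Fin w.1, X ⟶ A.hom (w.2.1 i.castSucc) (w.2.1 i.succ)) :
    K.map (form w p f) = K.map (gen p f) ≫ K.map (formι w) :=
  K.map_comp _ _

theorem mapFree_hom_ext {x y : A.obj} {Z : W'} {φ ψ : K.obj ((freeGraph P A).hom x y) ⟶ Z}
    (h : ∀ (w : A.Walk x y) {X : W} (p : X ⟶ P.obj w.1)
      (f : ∀ i : Fin w.1, X ⟶ A.hom (w.2.1 i.castSucc) (w.2.1 i.succ)),
      K.map (form w p f) ≫ φ = K.map (form w p f) ≫ ψ) : φ = ψ := by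
  refine Cofan.IsColimit.hom_ext (mapFreeIsColimit P K x y) _ _ fun w => ?_
  have := h w prod.fst (fun i => prod.snd ≫ Pi.π _ i)
  rwa [form_id] at this

theorem mapFree_hom_ext_arr {B : VGraph W'}
    {F G : (VGraph.mapFunctor K).obj (freeGraph P A) ⟶ B}
    (hobj : ∀ x, F.obj x = G.obj x)
    (h : ∀ {k : ℕ} (a : Fin (k + 1) → A.obj) {X : W} (p : X ⟶ P.obj k)
      (f : ∀ i : Fin k, X ⟶ A.hom (a i.castSucc) (a i.succ)),
      (((freeGraph P A).of (form ⟨k, a, rfl, rfl⟩ p f)).mapF K).map F =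
        (((freeGraph P A).of (form ⟨k, a, rfl, rfl⟩ p f)).mapF K).map G) : F = G := by
  obtain ⟨Fo, Fm⟩ := F
  obtain ⟨Go, Gm⟩ := G
  obtain rfl : Fo = Go := funext hobj
  congr 1
  funext x y
  refine mapFree_hom_ext (P := P) (A := A) K fun w X p f => ?_
  obtain ⟨k, a, rfl, rfl⟩ := w
  exact VGraph.of_injective (h a p f)

omit [HasCoproducts.{u} W] in
theorem prodMap_eq_gen {X : W} {m : ℕ} {B C : Fin m → W} (g : ∀ i, B i ⟶ C i) :
    prod.map (𝟙 X) (Limits.Pi.map g) = gen prod.fst (fun i => (prod.snd ≫ Pi.π _ i) ≫ g i) := by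
  refine Eq.trans ?_ (gen_map _ _ _)
  rw [gen_id, Category.id_comp]

theorem mapDistrib_hom_ext [FinDistributive W] {m : ℕ} {x y : Fin m → A.obj} {X : W} {Z : W'}
    {φ ψ : K.obj (X ⨯ ∏ᶜ fun i => (freeGraph P A).hom (x i) (y i)) ⟶ Z}
    (h : ∀ (w : ∀ i, A.Walk (x i) (y i)) {Y : W} (p : Y ⟶ X) (q : ∀ i, Y ⟶ P.obj (w i).1)
      (f : ∀ i (j : Fin (w i).1), Y ⟶ A.hom ((w i).2.1 j.castSucc) ((w i).2.1 j.succ)),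
      K.map (gen p fun i => form (w i) (q i) (f i)) ≫ φ =
        K.map (gen p fun i => form (w i) (q i) (f i)) ≫ ψ) : φ = ψ := by
  refine Cofan.IsColimit.hom_ext (isColimitCofanMkObjOfIsColimit K _ _
    (freeDistrib P A X x y)) _ _ fun w => ?_
  have := h w prod.fst (fun i => (prod.snd ≫ Pi.π (fun i => summand P (w i)) i) ≫ prod.fst)
    (fun i j => (prod.snd ≫ Pi.π (fun i => summand P (w i)) i) ≫ prod.snd ≫ Pi.π _ j)
  have e : (fun i => form (w i)
      ((prod.snd ≫ Pi.π (fun i => summand P (w i)) i) ≫ (prod.fst : _ ⟶ P.obj (w i).1))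
      (fun j => (prod.snd ≫ Pi.π (fun i => summand P (w i)) i) ≫ prod.snd ≫ Pi.π _ j)) =
      fun i => ((prod.snd : (X ⨯ _) ⟶ _) ≫ Pi.π (fun i => summand P (w i)) i) ≫ formι (w i) :=
    funext fun i => congrArg (· ≫ formι (w i)) (gen_eta _)
  rw [e, ← prodMap_eq_gen] at this
  exact this

/-- To compare morphisms out of `K_*(fc(fc A))`, it suffices to consider formal composites of formal
composites. -/
theorem mapFreeFree_hom_ext_arr [FinDistributive W] {B : VGraph W'}
    {F G : (VGraph.mapFunctor K).obj (freeGraph P (freeGraph P A)) ⟶ B}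
    (hobj : ∀ x, F.obj x = G.obj x)
    (h : ∀ {k : ℕ} (a : Fin (k + 1) → A.obj) {X : W} (p : X ⟶ P.obj k)
      (w : ∀ i : Fin k, A.Walk (a i.castSucc) (a i.succ)) (q : ∀ i, X ⟶ P.obj (w i).1)
      (f : ∀ i (j : Fin (w i).1), X ⟶ A.hom ((w i).2.1 j.castSucc) ((w i).2.1 j.succ)),
      (((freeGraph P (freeGraph P A)).of (form (A := freeGraph P A) ⟨k, a, rfl, rfl⟩ p
          fun i => form (w i) (q i) (f i))).mapF K).map F =
        (((freeGraph P (freeGraph P A)).of (form (A := freeGraph P A) ⟨k, a, rfl, rfl⟩ p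
          fun i => form (w i) (q i) (f i))).mapF K).map G) : F = G := by
  obtain ⟨Fo, Fm⟩ := F
  obtain ⟨Go, Gm⟩ := G
  obtain rfl : Fo = Go := funext hobj
  congr 1
  funext x y
  refine Cofan.IsColimit.hom_ext (mapFreeIsColimit P K (A := freeGraph P A) x y) _ _ fun w => ?_
  obtain ⟨k, (a : Fin (k + 1) → A.obj), rfl, rfl⟩ := w
  refine mapDistrib_hom_ext (P := P) (A := A) K (x := fun i : Fin k => a i.castSucc)
    (y := fun i => a i.succ) fun w {Y} p q f => ?_
  have := VGraph.of_injective (h a p w q f)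
  have e := map_form K (P := P) (A := freeGraph P A) (a 0) (a (Fin.last k)) ⟨k, a, rfl, rfl⟩ p
    (fun i => form (w i) (q i) (f i))
  refine Eq.trans ?_ ((congrArg (· ≫ Fm _ _) e.symm).trans
    (this.trans ((congrArg (· ≫ Gm _ _) e).trans ?_)))
  · exact (Category.assoc _ _ _).symm
  · exact Category.assoc _ _ _

end

section

variable {V : Type (u + 1)} [Category.{u} V] [HasFiniteProducts V]
variable {W : Type (u + 1)} [Category.{u} W] [HasFiniteProducts W] [HasCoproducts.{u} W]
  [FinDistributive W]
variable {U : V ⥤ W} [PreservesFiniteProducts U] {L : W ⥤ V} (adj : L ⊣ U)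
  [∀ J : Type u, PreservesColimitsOfShape (Discrete J) (L ⋙ U)]
variable (P : Operad V)

/-- The canonical distributive law on hom-objects. -/
noncomputable def lawMap (A : VGraph W) (x y : A.obj) :
    U.obj (L.obj ((freeGraph (P.map U) A).hom x y)) ⟶
      (freeGraph (P.map U) ((VGraph.mapFunctor (L ⋙ U)).obj A)).hom x y :=
  Cofan.IsColimit.desc (mapFreeIsColimit (P.map U) (L ⋙ U) x y) fun w =>
    form (A := (VGraph.mapFunctor (L ⋙ U)).obj A) w (act adj (Y := P.obj w.1) prod.fst)
      (fun i => U.map (L.map (prod.snd ≫ Pi.π _ i)))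

omit [FinDistributive W] in
theorem form_lawMap {A : VGraph W} {x y : A.obj} (w : A.Walk x y) {X : W}
    (p : X ⟶ U.obj (P.obj w.1))
    (f : ∀ i : Fin w.1, X ⟶ A.hom (w.2.1 i.castSucc) (w.2.1 i.succ)) :
    U.map (L.map (form (P := P.map U) w p f)) ≫ lawMap adj P A x y =
      form (A := (VGraph.mapFunctor (L ⋙ U)).obj A) (P := P.map U) w (act adj p)
        (fun i => U.map (L.map (f i))) := by
  have e : U.map (L.map (formι w)) ≫ lawMap adj P A x y = _ :=
    Cofan.IsColimit.fac (mapFreeIsColimit (P.map U) (L ⋙ U) x y) _ w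
  refine (congrArg (· ≫ lawMap adj P A x y) (map_form (L ⋙ U) x y w p f)).trans ?_
  refine (Category.assoc _ _ _).trans ?_
  refine (congrArg ((L ⋙ U).map (gen p f) ≫ ·) e).trans ?_
  refine (comp_form _ _ _ _).trans ?_
  congr 1
  · exact (act_comp adj _ _).symm.trans (congrArg (act adj) (gen_fst _ _))
  · funext i
    exact ((L ⋙ U).map_comp _ _).symm.trans (congrArg (L ⋙ U).map (gen_snd _ _ _))

/-- The canonical distributive law on a `V`-graph. -/
noncomputable def lawApp (A : VGraph W) :
    (VGraph.mapFunctor (L ⋙ U)).obj (freeGraph (P.map U) A) ⟶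
      freeGraph (P.map U) ((VGraph.mapFunctor (L ⋙ U)).obj A) where
  obj := id
  map x y := lawMap adj P A x y

omit [FinDistributive W] in
theorem of_form_lawApp {A : VGraph W} {k : ℕ} (a : Fin (k + 1) → A.obj) {X : W}
    (p : X ⟶ U.obj (P.obj k)) (f : ∀ i : Fin k, X ⟶ A.hom (a i.castSucc) (a i.succ)) :
    (((freeGraph (P.map U) A).of (form ⟨k, a, rfl, rfl⟩ p f)).mapF (L ⋙ U)).map (lawApp adj P A) =
      (freeGraph (P.map U) ((VGraph.mapFunctor (L ⋙ U)).obj A)).of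
        (form (A := (VGraph.mapFunctor (L ⋙ U)).obj A) (P := P.map U) ⟨k, a, rfl, rfl⟩ (act adj p)
        (fun i => U.map (L.map (f i)))) :=
  congrArg (VGraph.Arr.mk _ _) (form_lawMap adj P (A := A) ⟨k, a, rfl, rfl⟩ p f)

omit [FinDistributive W] in
theorem formOne_lawMap {A : VGraph W} {x y : A.obj} {X : W} (f : X ⟶ A.hom x y) :
    U.map (L.map (formOne (P := P.map U) f)) ≫ lawMap adj P A x y =
      formOne (A := (VGraph.mapFunctor (L ⋙ U)).obj A) (P := P.map U) (U.map (L.map f)) := by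
  refine (form_lawMap adj P _ _ _).trans ?_
  refine VGraph.of_injective (form_congr (k := 1) _ _ (fun _ => rfl) (act_one adj X) fun i => ?_)
  match i with
  | 0 => rfl

theorem lawApp_naturality {A B : VGraph W} (f : A ⟶ B) :
    (VGraph.mapFunctor (L ⋙ U)).map ((freeFunctor (P.map U)).map f).toHom ≫ lawApp adj P B =
      lawApp adj P A ≫
        ((freeFunctor (P.map U)).map ((VGraph.mapFunctor (L ⋙ U)).map f)).toHom := by
  refine mapFree_hom_ext_arr (P := P.map U) (A := A) (L ⋙ U) (fun _ => rfl)
    fun {k} a {X} p g => ?_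
  refine (VGraph.Arr.map_comp _ _ _).trans ?_
  refine (congrArg (VGraph.Arr.map (lawApp adj P B)) (VGraph.Arr.mapF_map (L ⋙ U) _ _)).trans ?_
  refine (congrArg (fun e => VGraph.Arr.map (lawApp adj P B) (VGraph.Arr.mapF (L ⋙ U) e))
    (of_form_freeMap f a p g)).trans ?_
  refine (of_form_lawApp adj P (fun t => f.obj (a t)) p _).trans ?_
  refine Eq.trans ?_ (VGraph.Arr.map_comp _ _ _).symm
  refine Eq.trans ?_ (congrArg (VGraph.Arr.map _) (of_form_lawApp adj P a p g)).symm
  refine Eq.trans ?_ (of_form_freeMap (P := P.map U) ((VGraph.mapFunctor (L ⋙ U)).map f) a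
    (act adj p) (fun i => U.map (L.map (g i)))).symm
  refine form_congr _ _ (fun _ => rfl) rfl fun i => ?_
  exact congrArg (VGraph.Arr.mk _ _) ((L ⋙ U).map_comp _ _)

theorem lawApp_unit_left (A : VGraph W) :
    (VGraph.mapFunctor (L ⋙ U)).map (freeIncl (P.map U) A) ≫ lawApp adj P A =
      freeIncl (P.map U) ((VGraph.mapFunctor (L ⋙ U)).obj A) := by
  refine VGraph.hom_ext_arr (fun _ => rfl) fun x y => congrArg (VGraph.Arr.mk _ _) ?_
  exact (formOne_lawMap adj P (𝟙 (A.hom x y))).trans (congrArg formOne ((L ⋙ U).map_id _))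

theorem lawApp_unit_right (A : VGraph W) :
    (VGraph.mapMonad adj.toMonad).η.app (freeGraph (P.map U) A) ≫ lawApp adj P A =
      ((freeFunctor (P.map U)).map ((VGraph.mapMonad adj.toMonad).η.app A)).toHom := by
  refine freeGraph_hom_ext_arr (P := P.map U) (A := A) (fun _ => rfl) fun {k} a {X} p f => ?_
  refine Eq.trans ?_ (of_form_freeMap _ a p f).symm
  refine (VGraph.Arr.map_comp _ _ _).trans ?_
  have e : VGraph.Arr.map ((VGraph.mapMonad adj.toMonad).η.app (freeGraph (P.map U) A))
      ((freeGraph (P.map U) A).of (form (A := A) ⟨k, a, rfl, rfl⟩ p f)) =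
      (((freeGraph (P.map U) A).of (form (A := A) ⟨k, a, rfl, rfl⟩ p f)).mapF (L ⋙ U)).pre
        (adj.unit.app X) :=
    congrArg (VGraph.Arr.mk _ _) (adj.unit.naturality _)
  refine (congrArg (VGraph.Arr.map (lawApp adj P A)) e).trans ?_
  refine (VGraph.Arr.map_pre _ _ _).trans ?_
  refine (congrArg (VGraph.Arr.pre (adj.unit.app X)) (of_form_lawApp adj P a p f)).trans ?_
  refine (congrArg (freeGraph (P.map U) ((VGraph.mapFunctor (L ⋙ U)).obj A)).of
    (comp_form _ _ _ _)).trans ?_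
  refine form_congr _ _ (fun _ => rfl) (unit_act adj p) fun i => ?_
  exact congrArg (VGraph.Arr.mk _ _) (adj.unit.naturality (f i)).symm

theorem lawApp_mul_left (A : VGraph W) :
    (VGraph.mapFunctor (L ⋙ U)).map (freeExt (𝟙 (freePCat (P.map U) A).toVGraph)).toHom ≫
        lawApp adj P A =
      lawApp adj P (freeGraph (P.map U) A) ≫
        ((freeFunctor (P.map U)).map (lawApp adj P A)).toHom ≫
          (freeExt (𝟙 (freePCat (P.map U) ((VGraph.mapFunctor (L ⋙ U)).obj A)).toVGraph)).toHom := by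
  refine mapFreeFree_hom_ext_arr (P := P.map U) (A := A) (L ⋙ U) (fun _ => rfl)
    fun {k} a {X} p w q f => ?_
  obtain ⟨b, g, hb, hg⟩ := exists_walk_glue (A := A) a w rfl f
  refine (VGraph.Arr.map_comp _ _ _).trans ?_
  refine (congrArg (VGraph.Arr.map (lawApp adj P A)) (VGraph.Arr.mapF_map (L ⋙ U) _ _)).trans ?_
  refine (congrArg (fun e => VGraph.Arr.map (lawApp adj P A) (VGraph.Arr.mapF (L ⋙ U) e))
    ((of_form_counit (freePCat (P.map U) A) a p _).trans
      (of_op_form (P := P.map U) a w p q f rfl b g hb hg))).trans ?_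
  refine (of_form_lawApp adj P b _ g).trans ?_
  refine Eq.trans ?_ (VGraph.Arr.map_comp _ _ _).symm
  refine Eq.trans ?_ (congrArg (VGraph.Arr.map _)
    (of_form_lawApp adj P (A := freeGraph (P.map U) A) a p _)).symm
  refine Eq.trans ?_ (VGraph.Arr.map_comp _ _ _).symm
  refine Eq.trans ?_ (congrArg (VGraph.Arr.map _) (of_form_freeMap (P := P.map U)
    (A := (VGraph.mapFunctor (L ⋙ U)).obj (freeGraph (P.map U) A)) (lawApp adj P A) a
    (act adj p) _)).symm
  refine Eq.trans ?_ (of_form_counit (freePCat (P.map U) ((VGraph.mapFunctor (L ⋙ U)).obj A))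
    a (act adj p) _).symm
  refine Eq.trans ?_ ((freePCat (P.map U) ((VGraph.mapFunctor (L ⋙ U)).obj A)).op_congr
    (fun _ => rfl) rfl (f := fun i => form (A := (VGraph.mapFunctor (L ⋙ U)).obj A) (P := P.map U)
      (w i) (act adj (q i)) (fun j => U.map (L.map (f i j)))) fun i =>
        congrArg (VGraph.Arr.mk _ _) (form_lawMap adj P (w i) (q i) (f i)).symm)
  refine Eq.trans ?_ (of_op_form (P := P.map U) (A := (VGraph.mapFunctor (L ⋙ U)).obj A) a w
    (act adj p) (fun i => act adj (q i)) (fun i j => U.map (L.map (f i j))) rfl b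
    (fun s => U.map (L.map (g s))) hb
    (fun i j => congrArg (VGraph.Arr.mapF (L ⋙ U)) (hg i j))).symm
  exact form_congr _ _ (fun _ => rfl) (act_mul adj _ _ _) (fun _ => rfl)

theorem lawApp_mul_right (A : VGraph W) :
    (VGraph.mapMonad adj.toMonad).μ.app (freeGraph (P.map U) A) ≫ lawApp adj P A =
      (VGraph.mapFunctor (L ⋙ U)).map (lawApp adj P A) ≫
        lawApp adj P ((VGraph.mapFunctor (L ⋙ U)).obj A) ≫
          ((freeFunctor (P.map U)).map ((VGraph.mapMonad adj.toMonad).μ.app A)).toHom := by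
  have hp : ∀ J : Type u, PreservesColimitsOfShape (Discrete J) ((L ⋙ U) ⋙ L ⋙ U) :=
    fun J => inferInstance
  refine mapFree_hom_ext_arr (P := P.map U) (A := A) ((L ⋙ U) ⋙ L ⋙ U) (fun _ => rfl)
    fun {k} a {X} p f => ?_
  refine (VGraph.Arr.map_comp _ _ _).trans ?_
  have e : VGraph.Arr.map ((VGraph.mapMonad adj.toMonad).μ.app (freeGraph (P.map U) A))
      (((freeGraph (P.map U) A).of (form (A := A) ⟨k, a, rfl, rfl⟩ p f)).mapF
        ((L ⋙ U) ⋙ L ⋙ U)) =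
      (((freeGraph (P.map U) A).of (form (A := A) ⟨k, a, rfl, rfl⟩ p f)).mapF (L ⋙ U)).pre
        (adj.toMonad.μ.app X) :=
    congrArg (VGraph.Arr.mk _ _) (adj.toMonad.μ.naturality _)
  refine (congrArg (VGraph.Arr.map (lawApp adj P A)) e).trans ?_
  refine (VGraph.Arr.map_pre _ _ _).trans ?_
  refine (congrArg (VGraph.Arr.pre _) (of_form_lawApp adj P a p f)).trans ?_
  refine (congrArg (freeGraph (P.map U) ((VGraph.mapFunctor (L ⋙ U)).obj A)).of
    (comp_form _ _ _ _)).trans ?_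
  refine Eq.trans ?_ (VGraph.Arr.map_comp _ _ _).symm
  refine Eq.trans ?_ (congrArg (VGraph.Arr.map _)
    ((VGraph.Arr.mapF_map (L ⋙ U) _ (((freeGraph (P.map U) A).of
      (form (A := A) ⟨k, a, rfl, rfl⟩ p f)).mapF (L ⋙ U))).trans
      (congrArg (VGraph.Arr.mapF (L ⋙ U)) (of_form_lawApp adj P a p f)))).symm
  refine Eq.trans ?_ (VGraph.Arr.map_comp _ _ _).symm
  refine Eq.trans ?_ (congrArg (VGraph.Arr.map _) (of_form_lawApp adj P
    (A := (VGraph.mapFunctor (L ⋙ U)).obj A) a (act adj p) _)).symm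
  refine Eq.trans ?_ (of_form_freeMap (P := P.map U)
    (A := (VGraph.mapFunctor (L ⋙ U)).obj ((VGraph.mapFunctor (L ⋙ U)).obj A)) _ a
    (act adj (act adj p)) _).symm
  refine form_congr _ _ (fun _ => rfl) (act_act adj p).symm fun i => ?_
  exact congrArg (VGraph.Arr.mk _ _) (adj.toMonad.μ.naturality (f i)).symm

/-- The canonical distributive law `Q_* ∘ fc ⇒ fc ∘ Q_*`. -/
noncomputable def canonicalLaw :
    DistribLaw (freePCatStr (P.map U)).fc (VGraph.mapMonad adj.toMonad) where
  law :=
    { app := fun A => lawApp adj P A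
      naturality := fun _ _ f => lawApp_naturality adj P f }
  unit_left A := lawApp_unit_left adj P A
  unit_right A := lawApp_unit_right adj P A
  mul_left A := lawApp_mul_left adj P A
  mul_right A := lawApp_mul_right adj P A

theorem canonicalLaw_isCanonical :
    IsCanonicalLaw (freePCatStr (P.map U)) adj.toMonad
      (fun k => U.map (adj.counit.app (P.obj k))) (canonicalLaw adj P) := by
  intro A k a
  refine (congrArg (fun e => VGraph.Arr.map (lawApp adj P A) (VGraph.Arr.mapF (L ⋙ U)
    ((freeGraph (P.map U) A).of e))) ((freePCatStr_formal (P := P.map U) a).trans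
      (form_id _).symm)).trans ?_
  refine (of_form_lawApp adj P a prod.fst _).trans ?_
  refine (congrArg (VGraph.Arr.mk _ _) (form_eq_op_incl (P := P.map U)
    (A := (VGraph.mapFunctor (L ⋙ U)).obj A) a _ _)).trans ?_
  exact congrArg (VGraph.Arr.mk _ _) ((freePCat (P.map U) _).op_congr' (act_eq adj _)
    fun i => rfl)

end

/-! ### Comparison of monads along a functor -/

section

variable {C D X : Type (u + 1)} [Category.{u} C] [Category.{u} D] [Category.{u} X]

/-- A criterion for the monad of an adjunction `L ⊣ G` to be a monad `M` transported along `Φ`: the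
objects `Φ(M(A))` are of the form `G(H(A))`, the resulting morphisms `Φ(A) ⟶ G(H(A))` are universal,
and the Kleisli extensions of `M` come from morphisms between the objects `H(A)`. -/
theorem monadIsoAlong_of_universal (M : CategoryTheory.Monad C) (Φ : C ⥤ D) {G : X ⥤ D} {L : D ⥤ X}
    (adj : L ⊣ G) (H : C → X) (e : ∀ A, Φ.obj (M.obj A) ≅ G.obj (H A))
    (huniv : ∀ (A : C) (Y : X) (f : Φ.obj A ⟶ G.obj Y),
      ∃! h : H A ⟶ Y, (Φ.map (M.η.app A) ≫ (e A).hom) ≫ G.map h = f)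
    (hext : ∀ (A B : C) (f : A ⟶ M.obj B), ∃ h : H A ⟶ H B,
      Φ.map (M.map f ≫ M.μ.app B) ≫ (e B).hom = (e A).hom ≫ G.map h) :
    Nonempty (MonadIsoAlong Φ M adj.toMonad) := by
  choose s hs _ using fun A => huniv A (L.obj (Φ.obj A)) (adj.unit.app (Φ.obj A))
  have hs : ∀ A, (Φ.map (M.η.app A) ≫ (e A).hom) ≫ G.map (s A) = adj.unit.app (Φ.obj A) := hs
  have hext' : ∀ (A : C) (Y : X) (h h' : H A ⟶ Y), (Φ.map (M.η.app A) ≫ (e A).hom) ≫ G.map h =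
      (Φ.map (M.η.app A) ≫ (e A).hom) ≫ G.map h' → h = h' := fun A Y h h' hh =>
    (huniv A Y _).unique hh rfl
  let t : ∀ A, L.obj (Φ.obj A) ⟶ H A := fun A =>
    (adj.homEquiv _ _).symm (Φ.map (M.η.app A) ≫ (e A).hom)
  have ht : ∀ A, adj.unit.app (Φ.obj A) ≫ G.map (t A) = Φ.map (M.η.app A) ≫ (e A).hom := fun A =>
    (adj.homEquiv_unit _ _ _).symm.trans (Equiv.apply_symm_apply _ _)
  have hst : ∀ A, s A ≫ t A = 𝟙 _ := fun A => hext' A _ _ _ (by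
    rw [G.map_comp, ← Category.assoc, hs, ht, G.map_id, Category.comp_id])
  have hts : ∀ A, t A ≫ s A = 𝟙 _ := fun A => (adj.homEquiv _ _).injective (by
    rw [adj.homEquiv_unit, adj.homEquiv_unit, G.map_comp, ← Category.assoc, ht, hs, G.map_id]
    exact (Category.comp_id _).symm)
  have hnat : ∀ {A B : C} (f : A ⟶ B), Φ.map (M.map f) ≫ (e B).hom ≫ G.map (s B) =
      ((e A).hom ≫ G.map (s A)) ≫ G.map (L.map (Φ.map f)) := by
    intro A B f
    obtain ⟨h, hh⟩ := hext A B (f ≫ M.η.app B)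
    rw [M.map_comp, Category.assoc, M.right_unit] at hh
    have hh' : Φ.map (M.map f) ≫ (e B).hom = (e A).hom ≫ G.map h :=
      (congrArg (fun g => Φ.map g ≫ (e B).hom) (Category.comp_id (M.map f)).symm).trans hh
    have key : h ≫ s B = s A ≫ L.map (Φ.map f) := by
      refine hext' A _ _ _ ?_
      rw [G.map_comp, G.map_comp, ← Category.assoc _ (G.map (s A)), hs, Category.assoc,
        ← Category.assoc (e A).hom, ← hh', ← Category.assoc, ← Category.assoc, ← Φ.map_comp]
      have e1 : M.η.app A ≫ M.map f = f ≫ M.η.app B := (M.η.naturality f).symm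
      have e2 : adj.unit.app (Φ.obj A) ≫ G.map (L.map (Φ.map f)) =
        Φ.map f ≫ adj.unit.app (Φ.obj B) := (adj.unit.naturality (Φ.map f)).symm
      rw [e1, Φ.map_comp, e2, Category.assoc, Category.assoc, ← hs, Category.assoc]
    rw [← Category.assoc, hh', Category.assoc, Category.assoc, ← G.map_comp, ← G.map_comp, key]
  let i : M.toFunctor ⋙ Φ ≅ Φ ⋙ adj.toMonad.toFunctor := NatIso.ofComponents
    (fun A => e A ≪≫ G.mapIso ⟨s A, t A, hst A, hts A⟩) (fun f => hnat f)
  have hi : ∀ A, i.hom.app A = (e A).hom ≫ G.map (s A) := fun A => rfl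
  refine ⟨⟨i, fun A => ?_, fun A => ?_⟩⟩
  · exact (Category.assoc _ _ _).symm.trans (hs A)
  · obtain ⟨h, hh⟩ := hext (M.obj A) A (𝟙 _)
    have hh' : Φ.map (M.μ.app A) ≫ (e A).hom = (e (M.obj A)).hom ≫ G.map h := by
      refine Eq.trans ?_ hh
      rw [M.map_id]
      exact congrArg (fun g => Φ.map g ≫ (e A).hom) (Category.id_comp _).symm
    have key : h ≫ s A = s (M.obj A) ≫ tr adj ((e A).hom ≫ G.map (s A)) := by
      refine hext' _ _ _ _ ?_
      rw [G.map_comp, G.map_comp, ← Category.assoc _ (G.map (s (M.obj A))), hs, Category.assoc,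
        ← Category.assoc (e (M.obj A)).hom, ← hh', ← Category.assoc, ← Category.assoc,
        ← Φ.map_comp, M.left_unit, Φ.map_id]
      exact (congrArg (· ≫ G.map (s A)) (Category.id_comp _)).trans
        (unit_act adj ((e A).hom ≫ G.map (s A))).symm
    refine (Category.assoc _ _ _).symm.trans ?_
    refine (congrArg (· ≫ G.map (s A)) hh').trans ?_
    refine (Category.assoc _ _ _).trans ?_
    refine (congrArg ((e (M.obj A)).hom ≫ ·)
      ((G.map_comp _ _).symm.trans ((congrArg G.map key).trans (G.map_comp _ _)))).trans ?_
    refine (Category.assoc _ _ _).symm.trans ?_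
    exact congrArg (((e (M.obj A)).hom ≫ G.map (s (M.obj A))) ≫ ·) (act_eq adj _)

end

/-! ### Isomorphisms -/

theorem VGraph.isIso_of_bijective {V : Type (u + 1)} [Category.{u} V] {A B : VGraph V} (F : A ⟶ B)
    (hobj : Function.Bijective F.obj) (hmap : ∀ x y, IsIso (F.map x y)) : IsIso F := by
  obtain ⟨g, hg₁, hg₂⟩ := Function.bijective_iff_has_inverse.mp hobj
  let G : B ⟶ A := ⟨g, fun x y =>
    B.castHom (hg₂ x).symm (hg₂ y).symm ≫ inv (F.map (g x) (g y))⟩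
  have hG : ∀ x y, G.map x y ≫ F.map (g x) (g y) = B.castHom (hg₂ x).symm (hg₂ y).symm :=
    fun x y => (Category.assoc _ _ _).trans
      ((congrArg (_ ≫ ·) (IsIso.inv_hom_id _)).trans (Category.comp_id _))
  refine ⟨G, VGraph.hom_ext_arr hg₁ fun x y => ?_, VGraph.hom_ext_arr hg₂ fun x y => ?_⟩
  · have key : ∀ x' y' (hx : x' = x) (hy : y' = y) (d : B.hom (F.obj x) (F.obj y) ⟶
        B.hom (F.obj x') (F.obj y')) (_ : d = B.castHom (congrArg F.obj hx.symm)
          (congrArg F.obj hy.symm)),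
        A.of (F.map x y ≫ d ≫ inv (F.map x' y')) = A.of (𝟙 (A.hom x y)) := by
      intro x' y' hx hy d hd
      subst hx hy hd
      refine congrArg A.of ?_
      exact (congrArg (_ ≫ ·) (Category.id_comp _)).trans (IsIso.hom_inv_id _)
    exact key _ _ (hg₁ x) (hg₁ y) _ rfl
  · refine (congrArg B.of (hG x y)).trans ?_
    exact (congrArg B.of (Category.id_comp _).symm).trans (VGraph.of_castHom _ _ _)

theorem PCat.isIso_of_toHom {V : Type (u + 1)} [Category.{u} V] [HasFiniteProducts V]
    {P : Operad V} {A B : PCat P} (F : A ⟶ B) [IsIso F.toHom] : IsIso F := by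
  let G := inv F.toHom
  have h1 : F.toHom ≫ G = 𝟙 _ := IsIso.hom_inv_id _
  have h2 : G ≫ F.toHom = 𝟙 _ := IsIso.inv_hom_id _
  have e1 : ∀ {X : V} (e : VGraph.Arr X A.toVGraph), (e.map F.toHom).map G = e := fun e => by
    rw [← VGraph.Arr.map_comp, h1, VGraph.Arr.map_id]
  have e2 : ∀ {X : V} (e : VGraph.Arr X B.toVGraph), (e.map G).map F.toHom = e := fun e => by
    rw [← VGraph.Arr.map_comp, h2, VGraph.Arr.map_id]
  refine ⟨PCat.homMk G fun a _ p f => VGraph.of_injective ?_, PCat.hom_ext h1, PCat.hom_ext h2⟩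
  have key : B.of (B.op a p f) =
      (A.of (A.op (fun i => G.obj (a i)) p fun i => f i ≫ G.map _ _)).map F.toHom := by
    have e := PCat.map_op F (fun i => G.obj (a i)) p fun i => f i ≫ G.map _ _
    refine Eq.trans ?_ (congrArg (fun z => B.of z) e).symm
    exact B.op_congr (fun i => congrArg VGraph.Arr.src (e2 (B.of (𝟙 (B.hom (a i) (a i))))).symm)
      rfl fun i => (e2 (B.of (f i))).symm
  exact (congrArg (VGraph.Arr.map G) key).trans (e1 _)

/-! ### The free `(V, P)`-category on a graph in the base category -/

section

variable {V : Type (u + 1)} [Category.{u} V]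
variable {W : Type (u + 1)} [Category.{u} W]
variable {U : V ⥤ W} {L : W ⥤ V} (adj : L ⊣ U)

/-- An adjunction induces an adjunction between categories of graphs. -/
def mapAdj : VGraph.mapFunctor L ⊣ VGraph.mapFunctor U :=
  Adjunction.mkOfUnitCounit
    { unit :=
        { app := fun A => ⟨id, fun x y => adj.unit.app (A.hom x y)⟩
          naturality := fun A B f =>
            VGraph.Hom.ext rfl (heq_of_eq (by funext x y; exact adj.unit.naturality (f.map x y))) }
      counit :=
        { app := fun A => ⟨id, fun x y => adj.counit.app (A.hom x y)⟩
          naturality := fun A B f =>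
            VGraph.Hom.ext rfl
              (heq_of_eq (by funext x y; exact adj.counit.naturality (f.map x y))) }
      left_triangle := by
        ext A
        refine VGraph.Hom.ext rfl (heq_of_eq ?_)
        funext x y
        exact (congrArg (_ ≫ ·) (Category.id_comp _)).trans (adj.left_triangle_components _)
      right_triangle := by
        ext A
        refine VGraph.Hom.ext rfl (heq_of_eq ?_)
        funext x y
        exact (congrArg (_ ≫ ·) (Category.id_comp _)).trans (adj.right_triangle_components _) }

variable [HasFiniteProducts V] [HasFiniteProducts W] [PreservesFiniteProducts U]

/-- The comparison of `U` of a product with the product. -/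
theorem isIso_gen_map {k : ℕ} (Q : V) (B : Fin k → V) :
    IsIso (gen (U.map (prod.fst : (Q ⨯ ∏ᶜ B) ⟶ Q)) (fun i => U.map (prod.snd ≫ Pi.π B i))) := by
  have := lift_comp_map_comp U (𝟙 _) (𝟙 (Q ⨯ ∏ᶜ B)) prod.fst (fun i => prod.snd ≫ Pi.π B i)
  simp only [Category.id_comp, U.map_id, Category.comp_id] at this
  have h2 : U.map (gen prod.fst fun i => prod.snd ≫ Pi.π B i) = 𝟙 (U.obj (Q ⨯ ∏ᶜ B)) :=
    (congrArg U.map gen_id).trans (U.map_id _)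
  rw [h2] at this
  have h3 : IsIso (prod.map (𝟙 (U.obj Q)) (PreservesProduct.iso U B).inv ≫
    (PreservesLimitPair.iso U Q (∏ᶜ B)).inv) := inferInstance
  exact IsIso.of_isIso_fac_right this

variable [HasCoproducts.{u} V] [HasCoproducts.{u} W] [FinDistributive V] [FinDistributive W]
variable (P : Operad V)

/-- The comparison of the free `(W, UP)`-category on `U_*(L_*(A))` with the image under `U` of the
free `(V, P)`-category on `L_*(A)`. -/
noncomputable def freeComparison (A : VGraph W) :
    freePCat (P.map U) ((VGraph.mapFunctor (L ⋙ U)).obj A) ⟶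
      (freePCat P ((VGraph.mapFunctor L).obj A)).mapObj U :=
  freeExt ((VGraph.mapFunctor U).map (freeIncl P ((VGraph.mapFunctor L).obj A)))

variable {P}

theorem of_form_freeComparison {A : VGraph W} {k : ℕ} (a : Fin (k + 1) → A.obj) {X : W}
    (p : X ⟶ U.obj (P.obj k)) (f : ∀ i : Fin k, X ⟶ U.obj (L.obj (A.hom (a i.castSucc) (a i.succ)))) :
    ((freeGraph (P.map U) ((VGraph.mapFunctor (L ⋙ U)).obj A)).of
      (form (A := (VGraph.mapFunctor (L ⋙ U)).obj A) (P := P.map U) ⟨k, a, rfl, rfl⟩ p f)).map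
        (freeComparison (L := L) (U := U) P A).toHom =
      ((freePCat P ((VGraph.mapFunctor L).obj A)).mapObj U).of
        (((freePCat P ((VGraph.mapFunctor L).obj A)).mapObj U).op a p fun i =>
          f i ≫ U.map ((freeIncl P ((VGraph.mapFunctor L).obj A)).map _ _)) :=
  of_form_freeExtGraph (P := P.map U) (B := (freePCat P ((VGraph.mapFunctor L).obj A)).mapObj U)
    (A := (VGraph.mapFunctor (L ⋙ U)).obj A)
    ((VGraph.mapFunctor U).map (freeIncl P ((VGraph.mapFunctor L).obj A))) ⟨k, a, rfl, rfl⟩ p f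

theorem gen_form_freeComparison {A : VGraph W} {x y : A.obj} (w : A.Walk x y) :
    gen (U.map (prod.fst : summand P (A := (VGraph.mapFunctor L).obj A) w ⟶ _))
      (fun i => U.map (prod.snd ≫ Pi.π _ i)) ≫
      formι (P := P.map U) (A := (VGraph.mapFunctor (L ⋙ U)).obj A) w ≫
        (freeComparison (L := L) (U := U) P A).toHom.map x y =
      U.map (formι (P := P) (A := (VGraph.mapFunctor L).obj A) w) := by
  obtain ⟨k, a, rfl, rfl⟩ := w
  refine (Category.assoc _ _ _).symm.trans ?_
  refine (VGraph.of_injective (of_form_freeComparison (P := P) (A := A) (L := L) (U := U) a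
    (U.map prod.fst) (fun i => U.map (prod.snd ≫ Pi.π _ i)))).trans ?_
  refine Eq.trans ?_ (congrArg U.map ((form_eq_op_incl (P := P) (A := (VGraph.mapFunctor L).obj A)
    a _ _).symm.trans (form_id (A := (VGraph.mapFunctor L).obj A) ⟨k, a, rfl, rfl⟩)))
  refine Eq.trans ?_ ((freePCat P ((VGraph.mapFunctor L).obj A)).mapObj_op_map U a _ _)
  exact PCatData.op_congr' _ rfl fun i => (U.map_comp _ _).symm

variable [∀ J : Type u, PreservesColimitsOfShape (Discrete J) U]

theorem isIso_freeComparison_map (A : VGraph W) (x y : A.obj) :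
    IsIso ((freeComparison (L := L) (U := U) P A).toHom.map x y) := by
  have hc := mapFreeIsColimit P U (A := (VGraph.mapFunctor L).obj A) x y
  let κ := fun w : A.Walk x y =>
    gen (U.map (prod.fst : summand P (A := (VGraph.mapFunctor L).obj A) w ⟶ _))
      (fun i => U.map (prod.snd ≫ Pi.π _ i))
  have hκ : ∀ w, IsIso (κ w) := fun w => isIso_gen_map _ _
  have hε : ∀ w, Epi (κ w) := fun w => @IsIso.epi_of_iso _ _ _ _ _ (hκ w)
  let ν := Cofan.IsColimit.desc hc (fun w => κ w ≫
    formι (P := P.map U) (A := (VGraph.mapFunctor (L ⋙ U)).obj A) w)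
  have hν : ∀ w, U.map (formι (P := P) (A := (VGraph.mapFunctor L).obj A) w) ≫ ν = κ w ≫
    formι (P := P.map U) (A := (VGraph.mapFunctor (L ⋙ U)).obj A) w :=
      Cofan.IsColimit.fac hc _
  have hm : ∀ w, κ w ≫ formι (P := P.map U) (A := (VGraph.mapFunctor (L ⋙ U)).obj A) w ≫
      (freeComparison (L := L) (U := U) P A).toHom.map x y = _ := gen_form_freeComparison
  refine ⟨ν, Cofan.IsColimit.hom_ext (freeIsColimit (P.map U)
    (A := (VGraph.mapFunctor (L ⋙ U)).obj A) x y) _ _ fun w => ?_,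
    Cofan.IsColimit.hom_ext hc _ _ fun w => ?_⟩
  · refine (hε w).left_cancellation _ _ ?_
    refine Eq.trans ?_ (congrArg (κ w ≫ ·) (Category.comp_id _).symm)
    refine Eq.trans ?_ (hν w)
    refine Eq.trans ?_ (congrArg (· ≫ ν) (hm w))
    refine Eq.trans ?_ (Category.assoc _ _ _).symm
    exact congrArg (κ w ≫ ·) (Category.assoc _ _ _).symm
  · refine Eq.trans ?_ (Category.comp_id _).symm
    refine Eq.trans ?_ (hm w)
    refine (Category.assoc _ _ _).symm.trans ?_
    exact (congrArg (· ≫ _) (hν w)).trans (Category.assoc _ _ _)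

variable (P) in
theorem isIso_freeComparison (A : VGraph W) :
    IsIso (freeComparison (L := L) (U := U) P A).toHom :=
  VGraph.isIso_of_bijective _ Function.bijective_id (isIso_freeComparison_map A)

variable [∀ J : Type u, PreservesColimitsOfShape (Discrete J) (L ⋙ U)]

omit [∀ J : Type u, PreservesColimitsOfShape (Discrete J) U] in
theorem lawApp_freeComparison (B : VGraph W) :
    lawApp adj P ((VGraph.mapFunctor (L ⋙ U)).obj B) ≫
      ((freeFunctor (P.map U)).map ((VGraph.mapMonad adj.toMonad).μ.app B)).toHom ≫
        (freeComparison (L := L) (U := U) P B).toHom =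
      (VGraph.mapFunctor (L ⋙ U)).map (freeComparison (L := L) (U := U) P B).toHom ≫
        (VGraph.mapFunctor U).map
          ((mapAdj adj).counit.app (freePCat P ((VGraph.mapFunctor L).obj B)).toVGraph) := by
  refine mapFree_hom_ext_arr (P := P.map U) (A := (VGraph.mapFunctor (L ⋙ U)).obj B) (L ⋙ U)
    (fun _ => rfl) fun {k} a {X} p f => ?_
  refine (VGraph.Arr.map_comp _ _ _).trans ?_
  refine (congrArg (VGraph.Arr.map _) (of_form_lawApp adj P
    (A := (VGraph.mapFunctor (L ⋙ U)).obj B) a p f)).trans ?_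
  refine (VGraph.Arr.map_comp _ _ _).trans ?_
  refine (congrArg (VGraph.Arr.map _) (of_form_freeMap (P := P.map U)
    (A := (VGraph.mapFunctor (L ⋙ U)).obj ((VGraph.mapFunctor (L ⋙ U)).obj B)) _ a
    (act adj p) _)).trans ?_
  refine (of_form_freeComparison (P := P) (A := B) (L := L) (U := U) a (act adj p) _).trans ?_
  refine Eq.trans ?_ (VGraph.Arr.map_comp _ _ _).symm
  refine Eq.trans ?_ (congrArg (VGraph.Arr.map _) ((VGraph.Arr.mapF_map (L ⋙ U) _ _).trans
    (congrArg (VGraph.Arr.mapF (L ⋙ U))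
      (of_form_freeComparison (P := P) (A := B) (L := L) (U := U) a p f)))).symm
  refine Eq.trans (congrArg (VGraph.Arr.mk _ _) ?_) (congrArg (VGraph.Arr.mk _ _) (act_eq adj _))
  refine Eq.trans ?_ (act_op adj (freePCat P ((VGraph.mapFunctor L).obj B)) a p _).symm
  refine PCatData.op_congr' _ rfl fun i => ?_
  refine Eq.trans ?_ (act_comp_map adj _ _).symm
  exact congrArg (· ≫ _) (act_eq adj (f i)).symm

/-- The monad of the adjunction between `W`-graphs and `(V, P)`-categories is the composite of the
monads for free `(W, UP)`-categories and of the adjunction between `V` and `W`. -/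
theorem nonempty_monadIsoAlong_composite {D : Type (u + 1)} [Category.{u} D] (Φ : VGraph W ⥤ D)
    [Φ.Full] [Φ.Faithful] {M : D ⥤ PCat P}
    (adj' : M ⊣ PCat.forget P ⋙ VGraph.mapFunctor U ⋙ Φ) :
    Nonempty (MonadIsoAlong Φ (canonicalLaw adj P).composite adj'.toMonad) := by
  let adj₂ := (mapAdj adj).comp (freeAdj P)
  have hunit : ∀ A, (canonicalLaw adj P).composite.η.app A ≫
      (freeComparison (L := L) (U := U) P A).toHom = adj₂.unit.app A := by
    intro A
    refine (Category.assoc _ _ _).trans ?_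
    exact (congrArg ((mapAdj adj).unit.app A ≫ ·) (freeIncl_freeExt _)).trans
      (Adjunction.comp_unit_app (mapAdj adj) (freeAdj P) A).symm
  have hiso := fun A => isIso_freeComparison (L := L) (U := U) P A
  refine monadIsoAlong_of_universal _ Φ adj'
    (fun A => freePCat P ((VGraph.mapFunctor L).obj A))
    (fun A => Φ.mapIso (@asIso _ _ _ _ (freeComparison (L := L) (U := U) P A).toHom (hiso A)))
    (fun A Y f => ?_) (fun A B f => ?_)
  · obtain ⟨f, rfl⟩ := Φ.map_surjective f
    have e : ∀ h : freePCat P ((VGraph.mapFunctor L).obj A) ⟶ Y,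
        (Φ.map ((canonicalLaw adj P).composite.η.app A) ≫
          Φ.map (freeComparison (L := L) (U := U) P A).toHom) ≫
            (PCat.forget P ⋙ VGraph.mapFunctor U ⋙ Φ).map h =
          Φ.map (adj₂.homEquiv A Y h) := by
      intro h
      refine Eq.trans ?_ (congrArg Φ.map ((congrArg
        (· ≫ (PCat.forget P ⋙ VGraph.mapFunctor U).map h) (hunit A)).trans
          (adj₂.homEquiv_unit _ _ h).symm))
      refine Eq.trans ?_ (Φ.map_comp _ _).symm
      exact congrArg (· ≫ _) (Φ.map_comp _ _).symm
    refine ⟨(adj₂.homEquiv A Y).symm f, ?_, fun h hh => ?_⟩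
    · exact (e _).trans (congrArg Φ.map (Equiv.apply_symm_apply _ _))
    · exact (Equiv.eq_symm_apply _).mpr (Φ.map_injective ((e h).symm.trans hh))
  · let fB := f ≫ (freeComparison (L := L) (U := U) P B).toHom
    let h : freePCat P ((VGraph.mapFunctor L).obj A) ⟶
        freePCat P ((VGraph.mapFunctor L).obj B) :=
      freeExt ((VGraph.mapFunctor L).map fB ≫ (mapAdj adj).counit.app
        (freePCat P ((VGraph.mapFunctor L).obj B)).toVGraph)
    refine ⟨h, ?_⟩
    refine (Φ.map_comp _ _).symm.trans (Eq.trans ?_ (Φ.map_comp _ _))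
    refine congrArg Φ.map ?_
    let TA := (VGraph.mapFunctor (L ⋙ U)).obj A
    let TB := (VGraph.mapFunctor (L ⋙ U)).obj B
    let Ff : freePCat (P.map U) TA ⟶ freePCat (P.map U) ((VGraph.mapFunctor (L ⋙ U)).obj
        (freeGraph (P.map U) TB)) :=
      (freeFunctor (P.map U)).map ((VGraph.mapFunctor (L ⋙ U)).map f)
    let Fl := (freeFunctor (P.map U)).map (lawApp adj P TB)
    let Fe := freeExt (𝟙 (freePCat (P.map U) ((VGraph.mapFunctor (L ⋙ U)).obj TB)).toVGraph)
    let Fm := (freeFunctor (P.map U)).map ((VGraph.mapMonad adj.toMonad).μ.app B)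
    let FB := freeComparison (L := L) (U := U) P B
    have key : Ff ≫ Fl ≫ Fe ≫ Fm ≫ FB = freeComparison (L := L) (U := U) P A ≫
        PCat.mapHom U h := by
      refine freePCat_hom_ext ?_
      have e1 : freeIncl (P.map U) TA ≫ Ff.toHom = _ := freeIncl_comp_map _
      have e2 := freeIncl_comp_map (P := P.map U) (lawApp adj P TB)
      have e3 := freeIncl_freeExt
        (𝟙 (freePCat (P.map U) ((VGraph.mapFunctor (L ⋙ U)).obj TB)).toVGraph)
      have e4 : freeIncl (P.map U) TA ≫ (freeComparison (L := L) (U := U) P A).toHom = _ :=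
        freeIncl_freeExt _
      have e5 : freeIncl P ((VGraph.mapFunctor L).obj A) ≫ h.toHom = _ := freeIncl_freeExt _
      refine (Category.assoc _ _ _).symm.trans ?_
      refine (congrArg (· ≫ _) e1).trans ?_
      refine (Category.assoc _ _ _).trans ?_
      refine Eq.trans (congrArg ((VGraph.mapFunctor (L ⋙ U)).map f ≫ ·)
        (a₂ := (VGraph.mapFunctor (L ⋙ U)).map FB.toHom ≫ (VGraph.mapFunctor U).map
          ((mapAdj adj).counit.app (freePCat P ((VGraph.mapFunctor L).obj B)).toVGraph)) ?_) ?_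
      · refine Eq.trans ?_ (lawApp_freeComparison adj B)
        refine (Category.assoc _ _ _).symm.trans ?_
        refine (congrArg (· ≫ _) e2).trans ?_
        refine (Category.assoc _ _ _).trans ?_
        refine congrArg (lawApp adj P TB ≫ ·) ?_
        refine (Category.assoc _ _ _).symm.trans ?_
        exact (congrArg (· ≫ Fm.toHom ≫ FB.toHom) e3).trans (Category.id_comp _)
      · refine Eq.trans ?_ (Category.assoc _ _ _)
        refine Eq.trans ?_ (congrArg (· ≫ (VGraph.mapFunctor U).map h.toHom) e4.symm)
        refine Eq.trans ?_ ((VGraph.mapFunctor U).map_comp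
          (freeIncl P ((VGraph.mapFunctor L).obj A)) h.toHom)
        refine Eq.trans ?_ (congrArg (VGraph.mapFunctor U).map e5.symm)
        refine Eq.trans ?_ ((VGraph.mapFunctor U).map_comp ((VGraph.mapFunctor L).map fB)
          ((mapAdj adj).counit.app (freePCat P ((VGraph.mapFunctor L).obj B)).toVGraph)).symm
        refine (Category.assoc _ _ _).symm.trans (congrArg (· ≫ _) ?_)
        exact ((VGraph.mapFunctor (L ⋙ U)).map_comp _ _).symm
    refine Eq.trans ?_ (congrArg PCat.Hom.toHom key)
    refine (Category.assoc _ _ _).trans (congrArg (Ff.toHom ≫ ·) ?_)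
    refine (Category.assoc _ _ _).trans (congrArg (Fl.toHom ≫ ·) ?_)
    exact Category.assoc _ _ _

end

/-! ### Monadicity -/

section

variable {V : Type (u + 1)} [Category.{u} V] {W : Type (u + 1)} [Category.{u} W]
variable {U : V ⥤ W} {L : W ⥤ V} (adj : L ⊣ U)

theorem faithful_of_comparison [(Monad.comparison adj).IsEquivalence] : U.Faithful :=
  inferInstanceAs (Monad.comparison adj ⋙ adj.toMonad.forget).Faithful

theorem reflectsIsomorphisms_of_comparison [(Monad.comparison adj).IsEquivalence] :
    U.ReflectsIsomorphisms :=
  inferInstanceAs (Monad.comparison adj ⋙ adj.toMonad.forget).ReflectsIsomorphisms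

theorem exists_map_eq [(Monad.comparison adj).IsEquivalence] {Y Z : V} (f : U.obj Y ⟶ U.obj Z)
    (h : act adj f = act adj (𝟙 (U.obj Y)) ≫ f) : ∃ g : Y ⟶ Z, U.map g = f := by
  obtain ⟨g, hg⟩ := (Monad.comparison adj).map_surjective
    (⟨f, by
      refine (act_eq adj f).symm.trans (h.trans (congrArg (· ≫ f) ?_))
      refine (act_eq adj _).trans ?_
      rw [L.map_id, U.map_id]
      exact Category.id_comp _⟩ : (Monad.comparison adj).obj Y ⟶ (Monad.comparison adj).obj Z)
  exact ⟨g, congrArg Monad.Algebra.Hom.f hg⟩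

theorem exists_algebra_iso [(Monad.comparison adj).IsEquivalence] {C : W}
    (a : U.obj (L.obj C) ⟶ C) (h1 : adj.unit.app C ≫ a = 𝟙 C)
    (h2 : U.map (adj.counit.app (L.obj C)) ≫ a = U.map (L.map a) ≫ a) :
    ∃ (D : V) (i : U.obj D ≅ C), ∀ {X : W} (d : X ⟶ U.obj D),
      act adj d ≫ i.hom = U.map (L.map (d ≫ i.hom)) ≫ a := by
  let T : adj.toMonad.Algebra := { A := C, a := a, unit := h1, assoc := h2 }
  let D := (Monad.comparison adj).objPreimage T
  let i := (Monad.comparison adj).objObjPreimageIso T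
  let j : U.obj D ⟶ C := i.hom.f
  refine ⟨D, adj.toMonad.forget.mapIso i, fun d => ?_⟩
  have h : U.map (L.map j) ≫ a = U.map (adj.counit.app D) ≫ j := i.hom.h
  have h' : U.map (L.map (d ≫ j)) ≫ a = act adj d ≫ j := by
    rw [L.map_comp, U.map_comp, Category.assoc, h, ← Category.assoc, act_eq]
  exact h'.symm

theorem VGraph.obj_congr {A B : VGraph V} {F G : A ⟶ B} (h : F = G) (x : A.obj) :
    F.obj x = G.obj x := by
  rw [h]

/-- The extension of an arrow of shape `X` to an arrow of shape `U(L(X))`. -/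
def VGraph.Arr.act {A : VGraph V} {X : W} (e : VGraph.Arr X ((VGraph.mapFunctor U).obj A)) :
    VGraph.Arr (U.obj (L.obj X)) ((VGraph.mapFunctor U).obj A) :=
  ⟨e.src, e.tgt, IterOp.act adj (Y := A.hom e.src e.tgt) e.arr⟩

theorem VGraph.Arr.act_map {A B : VGraph V} (F : A ⟶ B) {X : W}
    (e : VGraph.Arr X ((VGraph.mapFunctor U).obj A)) :
    (e.act adj).map ((VGraph.mapFunctor U).map F) =
      (e.map ((VGraph.mapFunctor U).map F)).act adj :=
  congrArg (VGraph.Arr.mk _ _) (act_comp_map adj _ _).symm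

theorem VGraph.Arr.act_act {A : VGraph V} {X : W}
    (e : VGraph.Arr X ((VGraph.mapFunctor U).obj A)) :
    (e.act adj).act adj = (e.act adj).pre (U.map (adj.counit.app (L.obj X))) :=
  congrArg (VGraph.Arr.mk _ _) (IterOp.act_act adj _)

theorem VGraph.Arr.act_pre {A : VGraph V} {X Y : W} (d : Y ⟶ X)
    (e : VGraph.Arr X ((VGraph.mapFunctor U).obj A)) :
    (e.pre d).act adj = (e.act adj).pre (U.map (L.map d)) :=
  congrArg (VGraph.Arr.mk _ _) (act_comp adj _ _)

theorem VGraph.Arr.unit_act {A : VGraph V} {X : W}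
    (e : VGraph.Arr X ((VGraph.mapFunctor U).obj A)) :
    (e.act adj).pre (adj.unit.app X) = e :=
  congrArg (VGraph.Arr.mk _ _) (IterOp.unit_act adj _)

/-- A morphism of graphs that commutes with the actions is the image of a morphism. -/
theorem exists_mapFunctor_map_eq [(Monad.comparison adj).IsEquivalence] {A B : VGraph V}
    (F : (VGraph.mapFunctor U).obj A ⟶ (VGraph.mapFunctor U).obj B)
    (h : ∀ {X : W} (e : VGraph.Arr X ((VGraph.mapFunctor U).obj A)),
      (e.map F).act adj = (e.act adj).map F) :
    ∃ G : A ⟶ B, (VGraph.mapFunctor U).map G = F := by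
  have key : ∀ x y : A.obj, ∃ g : A.hom x y ⟶ B.hom (F.obj x) (F.obj y), U.map g = F.map x y := by
    intro x y
    have e := h (((VGraph.mapFunctor U).obj A).of (𝟙 (U.obj (A.hom x y))))
    refine exists_map_eq adj (Y := A.hom x y) (Z := B.hom (F.obj x) (F.obj y)) (F.map x y) ?_
    refine Eq.trans ?_ (VGraph.of_injective e)
    exact congrArg (act adj (Y := B.hom (F.obj x) (F.obj y))) (Category.id_comp _).symm
  choose g hg using key
  exact ⟨⟨F.obj, g⟩, VGraph.hom_ext_arr (fun _ => rfl) fun x y =>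
    congrArg (VGraph.Arr.mk _ _) (hg x y)⟩

theorem mapFunctor_map_injective [U.Faithful] {A B : VGraph V} {F G : A ⟶ B}
    (h : (VGraph.mapFunctor U).map F = (VGraph.mapFunctor U).map G) : F = G := by
  refine VGraph.hom_ext_arr (VGraph.obj_congr (A := (VGraph.mapFunctor U).obj A)
    (B := (VGraph.mapFunctor U).obj B) h) fun x y => ?_
  obtain ⟨Fo, Fm⟩ := F
  obtain ⟨Go, Gm⟩ := G
  obtain rfl : Fo = Go := congrArg VGraph.Hom.obj h
  have e := congrArg (VGraph.Arr.map · (((VGraph.mapFunctor U).obj A).of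
    (𝟙 (U.obj (A.hom x y))))) h
  have e' := VGraph.of_injective e
  refine congrArg B.of (U.map_injective ?_)
  exact (Category.id_comp _).symm.trans (e'.trans (Category.id_comp _))

variable [HasFiniteProducts V] [HasFiniteProducts W] [PreservesFiniteProducts U]
variable {P : Operad V}

theorem mapObj_of_map {A B : PCat P} (F : A ⟶ B) {X : W} {k : ℕ} (a : Fin (k + 1) → A.obj)
    (p : X ⟶ U.obj (P.obj k)) (f : ∀ i : Fin k, X ⟶ U.obj (A.hom (a i.castSucc) (a i.succ))) :
    ((A.mapObj U).of ((A.mapObj U).op a p f)).map ((VGraph.mapFunctor U).map F.toHom) =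
      (B.mapObj U).of ((B.mapObj U).op (fun t => F.toHom.obj (a t)) p
        (fun i => f i ≫ U.map (F.toHom.map _ _))) :=
  congrArg ((B.mapObj U).of) (PCat.map_op (PCat.mapHom U F) a p f)

/-- A morphism of graphs whose image commutes with the composition of generalized elements is a
morphism of `(V, P)`-categories. -/
theorem exists_toHom_eq [U.Faithful] {A B : PCat P} (G : A.toVGraph ⟶ B.toVGraph)
    (h : ∀ {k : ℕ} (a : Fin (k + 1) → A.obj) {X : W} (p : X ⟶ U.obj (P.obj k))
      (f : ∀ i : Fin k, X ⟶ U.obj (A.hom (a i.castSucc) (a i.succ))),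
      ((A.mapObj U).of ((A.mapObj U).op a p f)).map ((VGraph.mapFunctor U).map G) =
        (B.mapObj U).of ((B.mapObj U).op (fun t => G.obj (a t)) p
          (fun i => f i ≫ U.map (G.map _ _)))) :
    ∃ F : A ⟶ B, F.toHom = G := by
  refine ⟨PCat.homMk G fun a X p f => U.map_injective ?_, rfl⟩
  have e := VGraph.of_injective (h a (U.map p) (fun i => U.map (f i)))
  refine (U.map_comp _ _).trans ?_
  refine (congrArg (· ≫ U.map (G.map _ _)) (A.mapObj_op_map U a p f)).symm.trans (e.trans ?_)
  refine Eq.trans ?_ (B.mapObj_op_map U (fun i => G.obj (a i)) p fun i => f i ≫ G.map _ _)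
  exact PCatData.op_congr' _ rfl fun i => (U.map_comp _ _).symm

section

variable {A B : PCat P} {f g : A ⟶ B} {C : VGraph W}
  {π : (VGraph.mapFunctor U).obj B.toVGraph ⟶ C}
  (H : IsSplitCoequalizer ((VGraph.mapFunctor U).map f.toHom) ((VGraph.mapFunctor U).map g.toHom) π)

include H

omit [HasFiniteProducts W] [PreservesFiniteProducts U] in
theorem split_section_map {X : W} (e : VGraph.Arr X C) : (e.map H.rightSection).map π = e := by
  rw [← VGraph.Arr.map_comp, H.rightSection_π, VGraph.Arr.map_id]

omit [HasFiniteProducts W] [PreservesFiniteProducts U] in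
theorem split_leftSection_bottom {X : W}
    (e : VGraph.Arr X ((VGraph.mapFunctor U).obj B.toVGraph)) :
    (e.map H.leftSection).map ((VGraph.mapFunctor U).map g.toHom) = e := by
  refine (VGraph.Arr.map_comp _ _ _).symm.trans ?_
  exact (congrArg (fun F => VGraph.Arr.map F e) H.leftSection_bottom).trans (VGraph.Arr.map_id _)

omit [HasFiniteProducts W] [PreservesFiniteProducts U] in
theorem split_leftSection_top {X : W}
    (e : VGraph.Arr X ((VGraph.mapFunctor U).obj B.toVGraph)) :
    (e.map H.leftSection).map ((VGraph.mapFunctor U).map f.toHom) =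
      (e.map π).map H.rightSection := by
  refine (VGraph.Arr.map_comp _ _ _).symm.trans ?_
  exact (congrArg (fun F => VGraph.Arr.map F e) H.leftSection_top).trans (VGraph.Arr.map_comp _ _ _)

omit [HasFiniteProducts W] [PreservesFiniteProducts U] in
theorem split_condition {X : W} (e : VGraph.Arr X ((VGraph.mapFunctor U).obj A.toVGraph)) :
    (e.map ((VGraph.mapFunctor U).map f.toHom)).map π =
      (e.map ((VGraph.mapFunctor U).map g.toHom)).map π := by
  refine (VGraph.Arr.map_comp _ _ _).symm.trans (Eq.trans ?_ (VGraph.Arr.map_comp _ _ _))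
  exact congrArg (fun F => VGraph.Arr.map F e) H.condition

omit [HasFiniteProducts W] [PreservesFiniteProducts U] in
theorem split_act {X : W} (e : VGraph.Arr X ((VGraph.mapFunctor U).obj B.toVGraph)) :
    (e.act adj).map π = (((e.map π).map H.rightSection).act adj).map π := by
  have h1 := split_condition H ((e.map H.leftSection).act adj)
  rw [VGraph.Arr.act_map, VGraph.Arr.act_map, split_leftSection_bottom,
    split_leftSection_top] at h1
  exact h1.symm

theorem split_op {X : W} {k : ℕ} (a : Fin (k + 1) → B.obj)
    (p : X ⟶ U.obj (P.obj k)) (e : ∀ i : Fin k, X ⟶ U.obj (B.hom (a i.castSucc) (a i.succ)))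
    (a' : Fin (k + 1) → B.obj) (e' : ∀ i : Fin k, X ⟶ U.obj (B.hom (a' i.castSucc) (a' i.succ)))
    (ha : ∀ t, a' t = H.rightSection.obj (π.obj (a t)))
    (he : ∀ i, (B.mapObj U).of (e' i) = (((B.mapObj U).of (e i)).map π).map H.rightSection) :
    ((B.mapObj U).of ((B.mapObj U).op a p e)).map π =
      ((B.mapObj U).of ((B.mapObj U).op a' p e')).map π := by
  have h1 := split_condition H ((A.mapObj U).of ((A.mapObj U).op
    (fun t => H.leftSection.obj (a t)) p (fun i => e i ≫ H.leftSection.map _ _)))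
  have h2 : ∀ x : B.obj, f.toHom.obj (H.leftSection.obj x) = H.rightSection.obj (π.obj x) :=
    VGraph.obj_congr H.leftSection_top
  have h3 : ∀ x : B.obj, g.toHom.obj (H.leftSection.obj x) = x :=
    VGraph.obj_congr H.leftSection_bottom
  have hf := mapObj_of_map (U := U) f
    (fun t => H.leftSection.obj (a t)) p (fun i => e i ≫ H.leftSection.map _ _)
  have hg := mapObj_of_map (U := U) g
    (fun t => H.leftSection.obj (a t)) p (fun i => e i ≫ H.leftSection.map _ _)
  refine (congrArg (VGraph.Arr.map π) ?_).trans
    ((congrArg (VGraph.Arr.map π) hg).symm.trans (h1.symm.trans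
      ((congrArg (VGraph.Arr.map π) hf).trans (congrArg (VGraph.Arr.map π) ?_))))
  · exact (B.mapObj U).op_congr (fun t => (h3 (a t)).symm) rfl fun i =>
      (split_leftSection_bottom H ((B.mapObj U).of (e i))).symm
  · exact (B.mapObj U).op_congr (fun t => (h2 (a t)).trans (ha t).symm) rfl fun i =>
      (split_leftSection_top H ((B.mapObj U).of (e i))).trans (he i).symm

omit [HasFiniteProducts W] [PreservesFiniteProducts U] in
/-- The quotient of a split pair lifts to `V`, since its hom-objects are algebras. -/
theorem exists_split_lift [(Monad.comparison adj).IsEquivalence] :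
    ∃ (D : VGraph V) (i : (VGraph.mapFunctor U).obj D ≅ C),
      ∀ {X : W} (e : VGraph.Arr X ((VGraph.mapFunctor U).obj D)),
        (e.act adj).map i.hom = (((e.map i.hom).map H.rightSection).act adj).map π := by
  have hs : ∀ c : C.obj, π.obj (H.rightSection.obj c) = c := VGraph.obj_congr H.rightSection_π
  have h0 : ∀ c c' : C.obj, ∃ a : U.obj (L.obj (C.hom c c')) ⟶ C.hom c c',
      C.of a = (((C.of (𝟙 (C.hom c c'))).map H.rightSection).act adj).map π := fun c c' =>
    VGraph.exists_of_eq _ (hs c) (hs c')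
  choose a ha using h0
  have ha' : ∀ {X : W} (e : VGraph.Arr X C), C.of (U.map (L.map e.arr) ≫ a e.src e.tgt) =
      ((e.map H.rightSection).act adj).map π := by
    intro X e
    have e1 : (C.of (𝟙 (C.hom e.src e.tgt))).pre e.arr = e :=
      congrArg (VGraph.Arr.mk _ _) (Category.comp_id _)
    rw [← VGraph.Arr.pre_of, ha, ← VGraph.Arr.map_pre, ← VGraph.Arr.act_pre, ← VGraph.Arr.map_pre,
      e1]
  have h1 : ∀ c c', adj.unit.app (C.hom c c') ≫ a c c' = 𝟙 _ := by
    intro c c'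
    refine VGraph.of_injective ?_
    rw [← VGraph.Arr.pre_of, ha, ← VGraph.Arr.map_pre, VGraph.Arr.unit_act, split_section_map]
    rfl
  have h2 : ∀ c c', U.map (adj.counit.app (L.obj (C.hom c c'))) ≫ a c c' =
      U.map (L.map (a c c')) ≫ a c c' := by
    intro c c'
    refine VGraph.of_injective ?_
    refine Eq.trans ?_ (ha' (C.of (a c c'))).symm
    rw [ha, ← split_act adj H, VGraph.Arr.act_act, VGraph.Arr.map_pre, ← ha, VGraph.Arr.pre_of]
  choose D i hi using fun c c' => exists_algebra_iso adj (a c c') (h1 c c') (h2 c c')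
  refine ⟨⟨C.obj, D⟩, ⟨⟨id, fun c c' => (i c c').hom⟩, ⟨id, fun c c' => (i c c').inv⟩,
    VGraph.hom_ext_arr (fun _ => rfl) fun c c' => congrArg (VGraph.Arr.mk _ _)
      (i c c').hom_inv_id,
    VGraph.hom_ext_arr (fun _ => rfl) fun c c' => congrArg (VGraph.Arr.mk _ _)
      (i c c').inv_hom_id⟩, fun {X} e => ?_⟩
  refine Eq.trans ?_ (ha' (VGraph.Arr.map _ e))
  exact congrArg (VGraph.Arr.mk _ _) (hi e.src e.tgt e.arr)

end

section

variable [(Monad.comparison adj).IsEquivalence]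
variable {A B : PCat P} {f g : A ⟶ B} {D : VGraph V}
  {π : (VGraph.mapFunctor U).obj B.toVGraph ⟶ (VGraph.mapFunctor U).obj D}
  (H : IsSplitCoequalizer ((VGraph.mapFunctor U).map f.toHom) ((VGraph.mapFunctor U).map g.toHom) π)
  (hD : ∀ {X : W} (e : VGraph.Arr X ((VGraph.mapFunctor U).obj D)),
    e.act adj = ((e.map H.rightSection).act adj).map π)

/-- The composition on the quotient of a split pair. -/
noncomputable def splitOp {X : W} {k : ℕ} (c : Fin (k + 1) → D.obj)
    (p : X ⟶ U.obj (P.obj k)) (d : ∀ i : Fin k, X ⟶ U.obj (D.hom (c i.castSucc) (c i.succ))) :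
    VGraph.Arr X ((VGraph.mapFunctor U).obj D) :=
  ((B.mapObj U).of ((B.mapObj U).op (fun t => H.rightSection.obj (c t)) p
    (fun i => d i ≫ H.rightSection.map _ _))).map π

theorem splitOp_pre {X Y : W} (x : Y ⟶ X) {k : ℕ} (c : Fin (k + 1) → D.obj)
    (p : X ⟶ U.obj (P.obj k)) (d : ∀ i : Fin k, X ⟶ U.obj (D.hom (c i.castSucc) (c i.succ))) :
    (splitOp H c p d).pre x = splitOp H c (x ≫ p) (fun i => x ≫ d i) := by
  refine (VGraph.Arr.map_pre _ _ _).symm.trans (congrArg (VGraph.Arr.map π) ?_)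
  refine congrArg (B.mapObj U).of (((B.mapObj U).comp_op x (fun t => H.rightSection.obj (c t)) p
    (fun i => d i ≫ H.rightSection.map _ _)).trans ?_)
  exact congrArg ((B.mapObj U).op _ _) (funext fun i => (Category.assoc _ _ _).symm)

theorem splitOp_map {X : W} {k : ℕ} (a : Fin (k + 1) → B.obj)
    (p : X ⟶ U.obj (P.obj k)) (e : ∀ i : Fin k, X ⟶ U.obj (B.hom (a i.castSucc) (a i.succ))) :
    ((B.mapObj U).of ((B.mapObj U).op a p e)).map π =
      splitOp H (fun t => π.obj (a t)) p (fun i => e i ≫ π.map _ _) :=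
  split_op H a p e _ _ (fun _ => rfl) fun _ => rfl

omit [(Monad.comparison adj).IsEquivalence] in
include hD in
theorem splitOp_act {X : W} {k : ℕ} (c : Fin (k + 1) → D.obj)
    (p : X ⟶ U.obj (P.obj k)) (d : ∀ i : Fin k, X ⟶ U.obj (D.hom (c i.castSucc) (c i.succ))) :
    (splitOp H c p d).act adj =
      splitOp H c (act adj p) (fun i => act adj (Y := D.hom _ _) (d i)) := by
  refine (hD _).trans ?_
  refine (split_act adj H _).symm.trans ?_
  refine (congrArg (VGraph.Arr.map π) (congrArg (VGraph.Arr.mk _ _) (act_op adj B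
    (fun t => H.rightSection.obj (c t)) p (fun i => d i ≫ H.rightSection.map _ _)))).trans ?_
  refine split_op H _ _ _ _ _ (fun t => congrArg H.rightSection.obj
    (VGraph.obj_congr H.rightSection_π (c t)).symm) fun i => ?_
  exact congrArg (VGraph.Arr.map H.rightSection) (hD (((VGraph.mapFunctor U).obj D).of (d i)))

include hD in
theorem exists_split_comp {k : ℕ} (c : Fin (k + 1) → D.obj) :
    ∃ ω : (P.obj k ⨯ ∏ᶜ fun i : Fin k => D.hom (c i.castSucc) (c i.succ)) ⟶
        D.hom (c 0) (c (Fin.last k)),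
      ((VGraph.mapFunctor U).obj D).of (U.map ω) =
        splitOp H c (U.map prod.fst) (fun i => U.map (prod.snd ≫ Pi.π _ i)) := by
  have hs : ∀ c, π.obj (H.rightSection.obj c) = c := VGraph.obj_congr H.rightSection_π
  obtain ⟨ω, hω⟩ := VGraph.exists_of_eq (splitOp H c (U.map
    (prod.fst : (P.obj k ⨯ ∏ᶜ fun i : Fin k => D.hom (c i.castSucc) (c i.succ)) ⟶ _))
    (fun i => U.map (prod.snd ≫ Pi.π _ i))) (hs _) (hs _)
  obtain ⟨ω', rfl⟩ := exists_map_eq adj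
    (Y := P.obj k ⨯ ∏ᶜ fun i : Fin k => D.hom (c i.castSucc) (c i.succ))
    (Z := D.hom (c 0) (c (Fin.last k))) ω (by
      refine VGraph.of_injective (A := (VGraph.mapFunctor U).obj D) ?_
      refine (congrArg (VGraph.Arr.act adj) hω).trans ?_
      refine (splitOp_act adj H hD _ _ _).trans ?_
      refine Eq.trans ?_ (congrArg (VGraph.Arr.pre _) hω.symm)
      refine Eq.trans ?_ (splitOp_pre H _ _ _ _).symm
      have e : ∀ {Y Z : V} (z : Y ⟶ Z), act adj (U.map z) = act adj (𝟙 (U.obj Y)) ≫ U.map z :=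
        fun z => (congrArg (act adj) (Category.id_comp _).symm).trans (act_comp_map adj _ _)
      rw [e]
      exact congrArg (splitOp H c _) (funext fun i => e _))
  exact ⟨ω', hω⟩

/-- The data of a `(V, P)`-category on the quotient of a split pair. -/
noncomputable def splitData : PCatData P :=
  { D with comp := fun c => (exists_split_comp adj H hD c).choose }

theorem splitData_op {X : W} {k : ℕ} (c : Fin (k + 1) → D.obj)
    (p : X ⟶ U.obj (P.obj k)) (d : ∀ i : Fin k, X ⟶ U.obj (D.hom (c i.castSucc) (c i.succ))) :
    ((VGraph.mapFunctor U).obj D).of (((splitData adj H hD).mapData U).op c p d) =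
      splitOp H c p d := by
  obtain ⟨Y, x, p', d', rfl, hd⟩ := exists_lift U _ _ p d
  obtain rfl : (fun i => x ≫ U.map (d' i)) = d := funext hd
  refine (congrArg ((VGraph.mapFunctor U).obj D).of ((splitData adj H hD).mapData_op U x c p'
    d')).trans ?_
  refine (congrArg ((VGraph.mapFunctor U).obj D).of (congrArg (x ≫ ·) (U.map_comp _ _))).trans ?_
  refine (congrArg (fun e => VGraph.Arr.pre x (VGraph.Arr.pre (U.map (gen p' d')) e))
    (exists_split_comp adj H hD c).choose_spec).trans ?_
  refine (congrArg (VGraph.Arr.pre x) (splitOp_pre H _ _ _ _)).trans ?_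
  refine (splitOp_pre H _ _ _ _).trans ?_
  refine congrArg₂ (splitOp H c) (congrArg (x ≫ ·) ?_) (funext fun i => congrArg (x ≫ ·) ?_)
  · exact (U.map_comp _ _).symm.trans (congrArg U.map (gen_fst _ _))
  · exact (U.map_comp _ _).symm.trans (congrArg U.map (gen_snd _ _ _))

theorem splitData_op_map {X : V} {k : ℕ} (c : Fin (k + 1) → D.obj)
    (p : X ⟶ P.obj k) (d : ∀ i : Fin k, X ⟶ D.hom (c i.castSucc) (c i.succ)) :
    ((VGraph.mapFunctor U).obj D).of (U.map ((splitData adj H hD).op c p d)) =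
      splitOp H c (U.map p) (fun i => U.map (d i)) := by
  refine Eq.trans ?_ (splitData_op adj H hD c _ _)
  refine congrArg ((VGraph.mapFunctor U).obj D).of ?_
  refine ((Category.id_comp _).symm.trans ((splitData adj H hD).mapData_op U (𝟙 _) c p d).symm).trans
    ?_
  exact PCatData.op_congr' _ (Category.id_comp _) fun i => Category.id_comp _

omit [HasFiniteProducts V] [HasFiniteProducts W] [PreservesFiniteProducts U]
  [(Monad.comparison adj).IsEquivalence] in
theorem of_map_injective [U.Faithful] {X : V} {x y : D.obj} {d d' : X ⟶ D.hom x y}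
    (h : ((VGraph.mapFunctor U).obj D).of (U.map d) = ((VGraph.mapFunctor U).obj D).of (U.map d')) :
    d = d' :=
  U.map_injective (VGraph.of_injective h)

omit [HasFiniteProducts V] [HasFiniteProducts W] [PreservesFiniteProducts U]
  [(Monad.comparison adj).IsEquivalence] in
theorem of_map_castHom {X : V} {x y x' y' : D.obj} (d : X ⟶ D.hom x y) (hx : x = x')
    (hy : y = y') : ((VGraph.mapFunctor U).obj D).of (U.map (d ≫ D.castHom hx hy)) =
      ((VGraph.mapFunctor U).obj D).of (U.map d) := by
  subst hx hy
  exact congrArg (VGraph.Arr.mk _ _) (congrArg U.map (Category.comp_id _))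

/-- The `(V, P)`-category structure on the quotient of a split pair. -/
noncomputable def splitPCat : PCat P where
  toPCatData := splitData adj H hD
  one_op {X} a f := by
    have := faithful_of_comparison adj
    refine of_map_injective (U := U) (D := D) ?_
    refine (splitData_op_map adj H hD a _ f).trans ?_
    have e : (B.mapObj U).op (fun t => H.rightSection.obj (a t)) (U.map (P.one X))
        (fun i => U.map (f i) ≫ H.rightSection.map _ _) = U.map (f 0) ≫ H.rightSection.map _ _ := by
      refine Eq.trans ?_ ((B.mapObj U).one_op (fun t => H.rightSection.obj (a t))
        (fun i => U.map (f i) ≫ H.rightSection.map _ _))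
      refine PCatData.op_congr' _ ?_ fun _ => rfl
      exact (Category.id_comp _).symm.trans (P.toOperadData.map_one U (𝟙 _)).symm
    refine (congrArg (fun z => VGraph.Arr.map π ((B.mapObj U).of z)) e).trans ?_
    exact split_section_map H (((VGraph.mapFunctor U).obj D).of (U.map (f 0)))
  mul_op {X m N k} h a p q f := by
    have := faithful_of_comparison adj
    refine of_map_injective (U := U) (D := D) ?_
    refine (splitData_op_map adj H hD a _ f).trans ?_
    refine Eq.trans ?_ (of_map_castHom (U := U) (D := D) _ _ _).symm
    refine Eq.trans ?_ (splitData_op_map adj H hD (fun t => a (blockPt h t)) p _).symm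
    have e : ∀ i : Fin m, ∃ e : U.obj X ⟶ U.obj (B.hom
        (H.rightSection.obj (a (blockPt h i.castSucc)))
        (H.rightSection.obj (a (blockPt h i.succ)))), (B.mapObj U).of e =
        (B.mapObj U).of ((B.mapObj U).op (fun j => H.rightSection.obj (a (blockInner h i j)))
          (U.map (q i)) (fun j => U.map (f (blockIdx h i j)) ≫ H.rightSection.map _ _)) :=
      fun i => VGraph.exists_of_eq (A := (B.mapObj U).toVGraph) _ (congrArg (fun t => H.rightSection.obj (a t))
        (blockInner_zero h i)) (congrArg (fun t => H.rightSection.obj (a t)) (blockInner_last h i))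
    choose e he using e
    have e1 := (B.mapObj U).op_glue h (fun t => H.rightSection.obj (a t)) (U.map p)
      (fun i => U.map (q i)) (fun s => U.map (f s) ≫ H.rightSection.map _ _)
      (fun t => H.rightSection.obj (a (blockPt h t))) e (fun _ => rfl) he
    have e2 : U.map (P.mul h p q) = (P.map U).mul h (U.map p) (fun i => U.map (q i)) := by
      refine ((Category.id_comp _).symm.trans (P.toOperadData.map_mul U (𝟙 _) h p q).symm).trans ?_
      exact (P.map U).mul_congr h (Category.id_comp _) fun i => Category.id_comp _
    refine (congrArg (fun z => splitOp H a z _) e2).trans ?_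
    refine (congrArg (VGraph.Arr.map π) e1.symm).trans ?_
    refine split_op H _ _ _ _ _ (fun t => congrArg H.rightSection.obj
      (VGraph.obj_congr H.rightSection_π (a (blockPt h t))).symm) fun i => ?_
    refine congrArg (VGraph.Arr.map H.rightSection) ((of_map_castHom (U := U) (D := D) _ _ _).trans
      ((splitData_op_map adj H hD _ (q i) _).trans ?_))
    exact congrArg (VGraph.Arr.map π) (he i).symm

include hD in
theorem exists_split_proj : ∃ q : B ⟶ splitPCat adj H hD,
    (VGraph.mapFunctor U).map q.toHom = π := by
  have := faithful_of_comparison adj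
  obtain ⟨G, hG⟩ := exists_mapFunctor_map_eq adj π fun e =>
    (hD (e.map π)).trans (split_act adj H e).symm
  obtain ⟨q, hq⟩ := exists_toHom_eq (U := U) (A := B) (B := splitPCat adj H hD) G
    (fun a X p e => by
      refine (congrArg (fun F => VGraph.Arr.map F ((B.mapObj U).of ((B.mapObj U).op a p e)))
        hG).trans ?_
      refine (splitOp_map H a p e).trans ?_
      subst hG
      exact (splitData_op adj H hD (fun t => G.obj (a t)) p _).symm)
  exact ⟨q, (congrArg (VGraph.mapFunctor U).map hq).trans hG⟩

include hD in
theorem exists_split_desc {Y : PCat P} (h : B ⟶ Y) (hh : f ≫ h = g ≫ h) :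
    ∃ k : splitPCat adj H hD ⟶ Y,
      π ≫ (VGraph.mapFunctor U).map k.toHom = (VGraph.mapFunctor U).map h.toHom := by
  have := faithful_of_comparison adj
  let k₀ := H.rightSection ≫ (VGraph.mapFunctor U).map h.toHom
  have hk : π ≫ k₀ = (VGraph.mapFunctor U).map h.toHom := by
    have e1 : (VGraph.mapFunctor U).map f.toHom ≫ (VGraph.mapFunctor U).map h.toHom =
        (VGraph.mapFunctor U).map g.toHom ≫ (VGraph.mapFunctor U).map h.toHom := by
      rw [← Functor.map_comp, ← Functor.map_comp]
      exact congrArg (fun F : A ⟶ Y => (VGraph.mapFunctor U).map F.toHom) hh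
    refine (Category.assoc _ _ _).symm.trans ?_
    refine (congrArg (· ≫ _) H.leftSection_top.symm).trans ?_
    refine (Category.assoc _ _ _).trans ?_
    refine (congrArg (_ ≫ ·) e1).trans ?_
    refine (Category.assoc _ _ _).symm.trans ?_
    exact (congrArg (· ≫ _) H.leftSection_bottom).trans (Category.id_comp _)
  have hk' : ∀ {X : W} (e : VGraph.Arr X ((VGraph.mapFunctor U).obj B.toVGraph)),
      (e.map π).map k₀ = e.map ((VGraph.mapFunctor U).map h.toHom) := fun e =>
    (VGraph.Arr.map_comp _ _ _).symm.trans (congrArg (fun F => VGraph.Arr.map F e) hk)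
  have hs : ∀ {X : W} (e : VGraph.Arr X ((VGraph.mapFunctor U).obj D)),
      (e.map H.rightSection).map ((VGraph.mapFunctor U).map h.toHom) = e.map k₀ := fun e =>
    (VGraph.Arr.map_comp _ _ _).symm
  obtain ⟨G, hG⟩ := exists_mapFunctor_map_eq adj k₀ fun e => by
    rw [hD e, hk', VGraph.Arr.act_map, hs]
  obtain ⟨k, hk₁⟩ := exists_toHom_eq (U := U) (A := splitPCat adj H hD) (B := Y) G
    (fun c X p d => by
      refine (congrArg (fun F => VGraph.Arr.map F (((splitPCat adj H hD).mapObj U).of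
        (((splitPCat adj H hD).mapObj U).op c p d))) hG).trans ?_
      refine (congrArg (VGraph.Arr.map k₀) (splitData_op adj H hD c p d)).trans ?_
      refine (hk' _).trans ?_
      refine (mapObj_of_map (U := U) h (fun t => H.rightSection.obj (c t)) p _).trans ?_
      refine PCatData.op_congr _ (fun t => ?_) rfl fun i => ?_
      · exact (VGraph.obj_congr hG (c t)).symm
      · refine (hs (((VGraph.mapFunctor U).obj D).of (d i))).trans ?_
        exact congrArg (fun F => VGraph.Arr.map F (((VGraph.mapFunctor U).obj D).of (d i)))
          hG.symm)
  refine ⟨k, Eq.trans ?_ hk⟩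
  exact congrArg (π ≫ ·) ((congrArg (VGraph.mapFunctor U).map hk₁).trans hG)

end

/-- Split pairs have coequalizers, and these are preserved. -/
theorem exists_coequalizer [(Monad.comparison adj).IsEquivalence] {A B : PCat P} {f g : A ⟶ B}
    {C : VGraph W} {π : (VGraph.mapFunctor U).obj B.toVGraph ⟶ C}
    (H : IsSplitCoequalizer ((VGraph.mapFunctor U).map f.toHom)
      ((VGraph.mapFunctor U).map g.toHom) π) :
    ∃ (Q : PCat P) (q : B ⟶ Q) (w : f ≫ q = g ≫ q), Nonempty (IsColimit (Cofork.ofπ q w)) ∧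
      Nonempty (IsSplitCoequalizer ((PCat.forget P ⋙ VGraph.mapFunctor U).map f)
        ((PCat.forget P ⋙ VGraph.mapFunctor U).map g)
        ((PCat.forget P ⋙ VGraph.mapFunctor U).map q)) := by
  have := faithful_of_comparison adj
  obtain ⟨D, i, hi⟩ := exists_split_lift adj H
  let H' : IsSplitCoequalizer ((VGraph.mapFunctor U).map f.toHom)
      ((VGraph.mapFunctor U).map g.toHom) (π ≫ i.inv) :=
    { rightSection := i.hom ≫ H.rightSection
      leftSection := H.leftSection
      condition := by
        refine (Category.assoc _ _ _).symm.trans (Eq.trans ?_ (Category.assoc _ _ _))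
        exact congrArg (· ≫ i.inv) H.condition
      rightSection_π := by
        rw [Category.assoc, ← Category.assoc _ π, H.rightSection_π, Category.id_comp,
          i.hom_inv_id]
      leftSection_bottom := H.leftSection_bottom
      leftSection_top := by
        rw [Category.assoc, i.inv_hom_id_assoc]
        exact H.leftSection_top }
  have hD : ∀ {X : W} (e : VGraph.Arr X ((VGraph.mapFunctor U).obj D)),
      e.act adj = ((e.map H'.rightSection).act adj).map (π ≫ i.inv) := by
    intro X e
    have e1 : ∀ {Y : W} (z : VGraph.Arr Y ((VGraph.mapFunctor U).obj D)),
        (z.map i.hom).map i.inv = z := fun z => by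
      rw [← VGraph.Arr.map_comp, i.hom_inv_id, VGraph.Arr.map_id]
    have e2 : e.map H'.rightSection = (e.map i.hom).map H.rightSection :=
      VGraph.Arr.map_comp _ _ _
    rw [e2, VGraph.Arr.map_comp, ← hi, e1]
  obtain ⟨q, hq⟩ := exists_split_proj adj H' hD
  have inj : ∀ {X Y : PCat P} {F G : X ⟶ Y}, (VGraph.mapFunctor U).map F.toHom =
      (VGraph.mapFunctor U).map G.toHom → F = G := fun h =>
    PCat.hom_ext (mapFunctor_map_injective h)
  have w : f ≫ q = g ≫ q := inj (by
    refine ((VGraph.mapFunctor U).map_comp f.toHom q.toHom).trans (Eq.trans ?_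
      ((VGraph.mapFunctor U).map_comp g.toHom q.toHom).symm)
    rw [hq]
    exact H'.condition)
  refine ⟨_, q, w, ⟨Cofork.IsColimit.mk' _ fun s => ?_⟩, ⟨?_⟩⟩
  · have hk := exists_split_desc adj H' hD s.π s.condition
    refine ⟨hk.choose, inj ?_, fun {m} hm => inj ?_⟩
    · refine ((VGraph.mapFunctor U).map_comp q.toHom _).trans ?_
      refine (congrArg (· ≫ _) hq).trans hk.choose_spec
    · have e1 : (π ≫ i.inv) ≫ (VGraph.mapFunctor U).map m.toHom =
          (π ≫ i.inv) ≫ (VGraph.mapFunctor U).map hk.choose.toHom := by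
        refine Eq.trans ?_ hk.choose_spec.symm
        refine (congrArg (· ≫ _) hq.symm).trans ?_
        refine ((VGraph.mapFunctor U).map_comp q.toHom _).symm.trans ?_
        exact congrArg (fun F : B ⟶ s.pt => (VGraph.mapFunctor U).map F.toHom) hm
      have e2 := congrArg (H'.rightSection ≫ ·) e1
      have e3 : ∀ {Z : VGraph W} (z : (VGraph.mapFunctor U).obj D ⟶ Z),
          H'.rightSection ≫ (π ≫ i.inv) ≫ z = z := fun z => by
        rw [← Category.assoc, H'.rightSection_π, Category.id_comp]
      exact (e3 _).symm.trans (e2.trans (e3 _))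
  · have hq' : (PCat.forget P ⋙ VGraph.mapFunctor U).map q = π ≫ i.inv := hq
    rw [hq']
    exact H'

omit [HasFiniteProducts V] [HasFiniteProducts W] [PreservesFiniteProducts U] in
theorem VGraph.isIso_map {A B : VGraph V} (F : A ⟶ B) [IsIso F] (x y : A.obj) :
    IsIso (F.map x y) := by
  have h1 : F ≫ inv F = 𝟙 _ := IsIso.hom_inv_id _
  have h2 : inv F ≫ F = 𝟙 _ := IsIso.inv_hom_id _
  have e1 := VGraph.Arr.map_comp F (inv F) (A.of (𝟙 (A.hom x y)))
  have e2 := VGraph.Arr.map_comp (inv F) F (B.of (𝟙 (B.hom (F.obj x) (F.obj y))))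
  rw [h1, VGraph.Arr.map_id] at e1
  rw [h2, VGraph.Arr.map_id] at e2
  have hx := VGraph.obj_congr h1
  have k1 : F.map x y ≫ (inv F).map _ _ ≫ A.castHom (hx x) (hx y) = 𝟙 _ := by
    refine VGraph.of_injective (Eq.trans ?_ e1.symm)
    refine (congrArg A.of (Category.assoc _ _ _).symm).trans ((VGraph.of_castHom _ _ _).trans ?_)
    exact congrArg (fun z => A.of (z ≫ _)) (Category.id_comp _).symm
  have k2 : ((inv F).map _ _ ≫ A.castHom (hx x) (hx y)) ≫ F.map x y = 𝟙 _ := by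
    refine VGraph.of_injective (Eq.trans ?_ e2.symm)
    refine (congrArg (VGraph.Arr.map F) (VGraph.of_castHom _ (hx x) (hx y))).trans ?_
    exact congrArg (fun z => VGraph.Arr.map F (A.of z)) (Category.id_comp _).symm
  exact ⟨_, k1, k2⟩

omit [HasFiniteProducts W] [PreservesFiniteProducts U] in
theorem reflectsIsomorphisms_forget_mapFunctor [U.ReflectsIsomorphisms] :
    (PCat.forget P ⋙ VGraph.mapFunctor U).ReflectsIsomorphisms where
  reflects {A B} F hF := by
    have hF' : IsIso ((VGraph.mapFunctor U).map F.toHom) := hF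
    let G := inv ((VGraph.mapFunctor U).map F.toHom)
    have h1 : (VGraph.mapFunctor U).map F.toHom ≫ G = 𝟙 _ := IsIso.hom_inv_id _
    have h2 : G ≫ (VGraph.mapFunctor U).map F.toHom = 𝟙 _ := IsIso.inv_hom_id _
    have : IsIso F.toHom := by
      refine VGraph.isIso_of_bijective _ (Function.bijective_iff_has_inverse.mpr
        ⟨G.obj, VGraph.obj_congr h1, VGraph.obj_congr h2⟩) fun x y => ?_
      have := VGraph.isIso_map ((VGraph.mapFunctor U).map F.toHom) x y
      have : IsIso (U.map (F.toHom.map x y)) := this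
      exact isIso_of_reflects_iso _ U
    exact PCat.isIso_of_toHom F

theorem splitCoequalizer_of_fullyFaithful {C D : Type (u + 1)} [Category.{u} C] [Category.{u} D]
    (Φ : C ⥤ D) [Φ.IsEquivalence] {X Y : C} {f g : X ⟶ Y} {Z : D} {h : Φ.obj Y ⟶ Z}
    (H : IsSplitCoequalizer (Φ.map f) (Φ.map g) h) :
    ∃ (Z' : C) (h' : Y ⟶ Z'), Nonempty (IsSplitCoequalizer f g h') := by
  let i := Φ.objObjPreimageIso Z
  refine ⟨Φ.objPreimage Z, Φ.preimage (h ≫ i.inv), ⟨?_⟩⟩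
  exact
    { rightSection := Φ.preimage (i.hom ≫ H.rightSection)
      leftSection := Φ.preimage H.leftSection
      condition := Φ.map_injective (by simp [H.condition_assoc])
      rightSection_π := Φ.map_injective (by simp)
      leftSection_bottom := Φ.map_injective (by simp)
      leftSection_top := Φ.map_injective (by simp) }

/-- Monadicity passes from `V` to the category of `(V, P)`-categories. -/
theorem comparison_isEquivalence [(Monad.comparison adj).IsEquivalence] {D : Type (u + 1)}
    [Category.{u} D] (Φ : VGraph W ⥤ D) [Φ.IsEquivalence] {M : D ⥤ PCat P}
    (adj' : M ⊣ PCat.forget P ⋙ VGraph.mapFunctor U ⋙ Φ) :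
    (Monad.comparison adj').IsEquivalence := by
  have := reflectsIsomorphisms_of_comparison adj
  let R := PCat.forget P ⋙ VGraph.mapFunctor U
  have hR : R.ReflectsIsomorphisms := reflectsIsomorphisms_forget_mapFunctor
  let R' := PCat.forget P ⋙ VGraph.mapFunctor U ⋙ Φ
  have hR' : R'.ReflectsIsomorphisms := inferInstanceAs (R ⋙ Φ).ReflectsIsomorphisms
  have key : ∀ {A B : PCat P} (f g : A ⟶ B) [R'.IsSplitPair f g],
      HasCoequalizer f g ∧ PreservesColimit (parallelPair f g) R' := by
    intro A B f g hfg
    obtain ⟨Z, h, ⟨H⟩⟩ := hfg.splittable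
    obtain ⟨Z', h', ⟨H'⟩⟩ := splitCoequalizer_of_fullyFaithful Φ H
    obtain ⟨Q, q, w, ⟨hc⟩, ⟨hs⟩⟩ := exists_coequalizer adj H'
    refine ⟨⟨⟨_, hc⟩⟩, ?_⟩
    have : PreservesColimit (parallelPair f g) R :=
      preservesColimit_of_preserves_colimit_cocone hc
        ((isColimitMapCoconeCoforkEquiv R w).symm hs.isCoequalizer)
    exact inferInstanceAs (PreservesColimit _ (R ⋙ Φ))
  have : Monad.HasCoequalizerOfIsSplitPair R' := ⟨fun f g _ => (key f g).1⟩
  have : Monad.PreservesColimitOfIsSplitPair R' := ⟨fun f g _ => (key f g).2⟩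
  have : Monad.ReflectsColimitOfIsSplitPair R' := ⟨fun f g _ => by
    have := (key f g).1
    have := (key f g).2
    exact reflectsColimit_of_reflectsIsomorphisms _ _⟩
  exact (Monad.monadicOfHasPreservesReflectsGSplitCoequalizers adj').eqv

end

/-! ### Elements of products and coproducts -/

section

variable {V : Type (u + 1)} [Category.{u} V]

theorem cofan_exists_element (K : V ⥤ Type u) {J : Type u}
    [PreservesColimitsOfShape (Discrete J) K] {Y : J → V} {c : V} {ι : ∀ j, Y j ⟶ c}
    (hc : IsColimit (Cofan.mk c ι)) (x : K.obj c) : ∃ (j : J) (y : K.obj (Y j)),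
      K.map (ι j) y = x :=
  Cofan.inj_jointly_surjective_of_isColimit (isColimitCofanMkObjOfIsColimit K _ _ hc) x

theorem cofan_element_injective (K : V ⥤ Type u) {J : Type u}
    [PreservesColimitsOfShape (Discrete J) K] {Y : J → V} {c : V} {ι : ∀ j, Y j ⟶ c}
    (hc : IsColimit (Cofan.mk c ι)) {j j' : J} (y : K.obj (Y j)) (y' : K.obj (Y j'))
    (h : K.map (ι j) y = K.map (ι j') y') :
    (⟨j, y⟩ : Σ j, K.obj (Y j)) = ⟨j', y'⟩ := by
  have hK := isColimitCofanMkObjOfIsColimit K _ _ hc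
  obtain rfl : j = j' := Cofan.eq_of_inj_apply_eq_of_isColimit hK y y' h
  rw [Cofan.inj_injective_of_isColimit hK j h]

variable [HasFiniteProducts V] (K : V ⥤ Type u) [PreservesFiniteProducts K]

theorem exists_gen_element {k : ℕ} {Q : V} {B : Fin k → V} (q : K.obj Q)
    (b : ∀ i, K.obj (B i)) : ∃ z : K.obj (Q ⨯ ∏ᶜ B), K.map prod.fst z = q ∧
      ∀ i, K.map (prod.snd ≫ Pi.π B i) z = b i := by
  have := isIso_gen_map (U := K) Q B
  let κ := gen (K.map (prod.fst : (Q ⨯ ∏ᶜ B) ⟶ Q)) (fun i => K.map (prod.snd ≫ Pi.π B i))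
  let m : PUnit ⟶ K.obj Q ⨯ ∏ᶜ fun i => K.obj (B i) := gen (↾fun _ => q) (fun i => ↾fun _ => b i)
  have h1 : (m ≫ inv κ) ≫ K.map prod.fst = ↾fun _ => q := by
    rw [← gen_fst (K.map (prod.fst : (Q ⨯ ∏ᶜ B) ⟶ Q)) (fun i => K.map (prod.snd ≫ Pi.π B i)),
      Category.assoc, IsIso.inv_hom_id_assoc, gen_fst]
  have h2 : ∀ i, (m ≫ inv κ) ≫ K.map (prod.snd ≫ Pi.π B i) = ↾fun _ => b i := fun i => by
    rw [← gen_snd (K.map (prod.fst : (Q ⨯ ∏ᶜ B) ⟶ Q)) (fun i => K.map (prod.snd ≫ Pi.π B i)) i,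
      Category.assoc, IsIso.inv_hom_id_assoc, gen_snd]
  exact ⟨(m ≫ inv κ) PUnit.unit, congrArg (fun f : PUnit ⟶ K.obj Q => f PUnit.unit) h1,
    fun i => congrArg (fun f : PUnit ⟶ K.obj (B i) => f PUnit.unit) (h2 i)⟩

theorem gen_element_ext {k : ℕ} {Q : V} {B : Fin k → V} {z z' : K.obj (Q ⨯ ∏ᶜ B)}
    (h : K.map prod.fst z = K.map prod.fst z')
    (h' : ∀ i, K.map (prod.snd ≫ Pi.π B i) z = K.map (prod.snd ≫ Pi.π B i) z') : z = z' := by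
  have := isIso_gen_map (U := K) Q B
  let κ := gen (K.map (prod.fst : (Q ⨯ ∏ᶜ B) ⟶ Q)) (fun i => K.map (prod.snd ≫ Pi.π B i))
  have e : (↾fun _ : PUnit => z) ≫ κ = (↾fun _ : PUnit => z') ≫ κ := by
    refine gen_hom_ext ?_ fun i => ?_
    · rw [Category.assoc, Category.assoc, gen_fst]
      ext
      exact h
    · rw [Category.assoc, Category.assoc, gen_snd]
      ext
      exact h' i
  have := (cancel_mono κ).mp e
  exact congrArg (fun f : PUnit ⟶ K.obj (Q ⨯ ∏ᶜ B) => f PUnit.unit) this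

/-- The element of a product with given components. -/
noncomputable def genEl {k : ℕ} {Q : V} {B : Fin k → V} (q : K.obj Q)
    (b : ∀ i, K.obj (B i)) : K.obj (Q ⨯ ∏ᶜ B) := (exists_gen_element K q b).choose

theorem genEl_fst {k : ℕ} {Q : V} {B : Fin k → V} (q : K.obj Q)
    (b : ∀ i, K.obj (B i)) : K.map prod.fst (genEl K q b) = q :=
  (exists_gen_element K q b).choose_spec.1

theorem genEl_snd {k : ℕ} {Q : V} {B : Fin k → V} (q : K.obj Q)
    (b : ∀ i, K.obj (B i)) (i : Fin k) : K.map (prod.snd ≫ Pi.π B i) (genEl K q b) = b i :=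
  (exists_gen_element K q b).choose_spec.2 i

end

/-- Products distribute over coproducts in a category with a jointly conservative family of functors
to sets that preserve finite products and coproducts. -/
theorem finDistributive_of_family {V : Type (u + 1)} [Category.{u} V] [HasFiniteProducts V]
    [HasCoproducts.{u} V] {I : Type} (F : I → V ⥤ Type u) (hprod : ∀ i, PreservesFiniteProducts (F i))
    (hcoprod : ∀ i (J : Type u), PreservesColimitsOfShape (Discrete J) (F i))
    (hF : ∀ {X Y : V} (f : X ⟶ Y), (∀ i, Function.Bijective ((F i).map f)) → IsIso f) :
    FinDistributive V where
  isColimit {m} X H Y := by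
    let ζ := fun h : (∀ i, H i) => prod.map (𝟙 X) (Limits.Pi.map fun i => Sigma.ι (Y i) (h i))
    let θ := Sigma.desc ζ
    have hθ : ∀ h, Sigma.ι _ h ≫ θ = ζ h := fun h => Sigma.ι_desc ζ h
    have key : IsIso θ := by
      refine hF θ fun a => ?_
      have := hprod a
      have := hcoprod a
      have e0 : ∀ h z, (F a).map θ ((F a).map (Sigma.ι _ h) z) = (F a).map (ζ h) z := fun h z => by
        rw [← hθ, Functor.map_comp]
        rfl
      have e1 : ∀ h z, (F a).map prod.fst ((F a).map (ζ h) z) = (F a).map prod.fst z :=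
        fun h z => by
          have : ζ h ≫ prod.fst = prod.fst := (prod.map_fst _ _).trans (Category.comp_id _)
          rw [← this, Functor.map_comp]
          rfl
      have e2 : ∀ h z i, (F a).map (prod.snd ≫ Pi.π _ i) ((F a).map (ζ h) z) =
          (F a).map (Sigma.ι (Y i) (h i)) ((F a).map (prod.snd ≫ Pi.π _ i) z) := fun h z i => by
        have : ζ h ≫ prod.snd ≫ Pi.π _ i = (prod.snd ≫ Pi.π _ i) ≫ Sigma.ι (Y i) (h i) := by
          simp [ζ]
        have := congrArg (fun f => (F a).map f z) this
        rw [(F a).map_comp (ζ h), (F a).map_comp _ (Sigma.ι (Y i) (h i))] at this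
        exact this
      refine ⟨fun z z' hz => ?_, fun w => ?_⟩
      · obtain ⟨h, z, rfl⟩ := cofan_exists_element (F a) (coproductIsCoproduct _) z
        obtain ⟨h', z', rfl⟩ := cofan_exists_element (F a) (coproductIsCoproduct _) z'
        rw [e0, e0] at hz
        have hh : ∀ i, (⟨h i, (F a).map (prod.snd ≫ Pi.π _ i) z⟩ : Σ j, (F a).obj (Y i j)) =
            ⟨h' i, (F a).map (prod.snd ≫ Pi.π _ i) z'⟩ := fun i =>
          cofan_element_injective (F a) (coproductIsCoproduct (Y i)) _ _
            ((e2 h z i).symm.trans ((congrArg _ hz).trans (e2 h' z' i)))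
        obtain rfl : h = h' := funext fun i => congrArg Sigma.fst (hh i)
        refine congrArg _ (gen_element_ext (F a) ?_ fun i => ?_)
        · exact (e1 h z).symm.trans ((congrArg _ hz).trans (e1 h z'))
        · exact eq_of_heq (Sigma.mk.inj (hh i)).2
      · have hw : ∀ i, ∃ (j : H i) (y : (F a).obj (Y i j)), (F a).map (Sigma.ι (Y i) j) y =
            (F a).map (prod.snd ≫ Pi.π _ i) w := fun i =>
          cofan_exists_element (F a) (coproductIsCoproduct (Y i)) _
        choose h y hy using hw
        refine ⟨(F a).map (Sigma.ι (fun h : (∀ i, H i) => X ⨯ ∏ᶜ fun i => Y i (h i)) h)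
          (genEl (F a) ((F a).map prod.fst w) y), ?_⟩
        rw [e0]
        refine gen_element_ext (F a) ?_ fun i => ?_
        · rw [e1, genEl_fst]
        · rw [e2, genEl_snd, hy]
    have e : (coproductIsCoproduct _).desc (Cofan.mk (X ⨯ ∏ᶜ fun i => ∐ Y i) ζ) = θ :=
      Cofan.IsColimit.hom_ext (coproductIsCoproduct _) _ _ fun h =>
        ((coproductIsCoproduct _).fac _ ⟨h⟩).trans (hθ h).symm
    exact ⟨IsColimit.ofPointIso (coproductIsCoproduct _) (i := e ▸ key)⟩

/-! ### Products and coproducts of `n`-globular sets -/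

namespace NGSet

variable {n : ℕ}

theorem le_of_cell (B : NGSet.{u} n) {k : ℕ} (x : B.obj.cells k) : k ≤ n := by
  by_contra hk
  exact (B.property k (Nat.lt_of_not_le hk)).false x

variable (n) in
/-- The functor of `k`-cells. -/
def cellsFunctor (k : ℕ) : NGSet.{u} n ⥤ Type u where
  obj A := A.obj.cells k
  map f := ↾fun x => f.hom.map x

theorem isIso_of_bijective {A B : NGSet.{u} n} (f : A ⟶ B)
    (h : ∀ k ≤ n, Function.Bijective ((cellsFunctor n k).map f)) : IsIso f := by
  have h' : ∀ k, Function.Bijective (f.hom.map (k := k)) := by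
    intro k
    by_cases hk : k ≤ n
    · exact h k hk
    · exact ⟨fun x => absurd (le_of_cell A x) hk, fun x => absurd (le_of_cell B x) hk⟩
  let e := fun k => Equiv.ofBijective _ (h' k)
  have he : ∀ {k} (x : A.obj.cells k), (e k).symm (f.hom.map x) = x := fun x =>
    Equiv.ofBijective_symm_apply_apply _ (h' _) x
  have he' : ∀ {k} (x : B.obj.cells k), f.hom.map ((e k).symm x) = x := fun x =>
    Equiv.ofBijective_apply_symm_apply _ (h' _) x
  refine ⟨⟨⟨fun {k} x => (e k).symm x, fun x => ?_, fun x => ?_⟩⟩, ?_, ?_⟩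
  · refine (h' _).1 ?_
    rw [he', f.hom.map_src, he']
  · refine (h' _).1 ?_
    rw [he', f.hom.map_tgt, he']
  · apply ObjectProperty.hom_ext
    apply GSet.Hom.ext
    funext k x
    exact he x
  · apply ObjectProperty.hom_ext
    apply GSet.Hom.ext
    funext k x
    exact he' x

/-- The coproduct of a family of `n`-globular sets. -/
def sigma {J : Type u} (A : J → NGSet.{u} n) : NGSet.{u} n where
  obj :=
    { cells := fun k => Σ j, (A j).obj.cells k
      src := fun x => ⟨x.1, (A x.1).obj.src x.2⟩
      tgt := fun x => ⟨x.1, (A x.1).obj.tgt x.2⟩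
      src_src := fun x => congrArg (Sigma.mk x.1) ((A x.1).obj.src_src x.2)
      tgt_src := fun x => congrArg (Sigma.mk x.1) ((A x.1).obj.tgt_src x.2) }
  property := fun k hk => ⟨fun x => ((A x.1).property k hk).false x.2⟩

/-- The coproduct inclusions. -/
def sigmaι {J : Type u} (A : J → NGSet.{u} n) (j : J) : A j ⟶ sigma A :=
  ⟨⟨fun x => ⟨j, x⟩, fun _ => rfl, fun _ => rfl⟩⟩

/-- The universal property of the coproduct. -/
def sigmaIsColimit {J : Type u} (A : J → NGSet.{u} n) :
    IsColimit (Cofan.mk (sigma A) (sigmaι A)) :=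
  Cofan.IsColimit.mk _
    (fun s => ⟨⟨fun x => (s.inj x.1).hom.map x.2, fun x => (s.inj x.1).hom.map_src x.2,
      fun x => (s.inj x.1).hom.map_tgt x.2⟩⟩)
    (fun s j => rfl)
    (fun s f h => by
      apply ObjectProperty.hom_ext
      apply GSet.Hom.ext
      funext k x
      exact congrArg (fun g => GSet.Hom.map (InducedCategory.Hom.hom g) x.2) (h x.1))

instance : HasCoproducts.{u} (NGSet.{u} n) := fun J =>
  { has_colimit := fun K =>
      have key : ∀ A : J → NGSet.{u} n, HasColimit (Discrete.functor A) := fun A =>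
        ⟨⟨⟨_, sigmaIsColimit A⟩⟩⟩
      have := key (K.obj ∘ Discrete.mk)
      hasColimit_of_iso Discrete.natIsoFunctor }

/-- A cofan of `n`-globular sets is a coproduct if it is so on cells. -/
theorem isColimit_of_bijective {J : Type u} {A : J → NGSet.{u} n} (c : Cofan A)
    (h : ∀ k ≤ n, Function.Bijective
      (fun x : Σ j, (A j).obj.cells k => (c.inj x.1).hom.map x.2)) :
    Nonempty (IsColimit c) := by
  have : IsIso ((sigmaIsColimit A).desc c) := isIso_of_bijective _ h
  exact ⟨(sigmaIsColimit A).ofPointIso⟩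

instance (k : ℕ) (J : Type u) :
    PreservesColimitsOfShape (Discrete J) (cellsFunctor.{u} n k) := by
  have : ∀ A : J → NGSet.{u} n, PreservesColimit (Discrete.functor A) (cellsFunctor n k) := by
    intro A
    refine preservesColimit_of_preserves_colimit_cocone (sigmaIsColimit A) ?_
    refine (isColimitMapCoconeCofanMkEquiv _ _ _).symm ?_
    refine ((Cofan.nonempty_isColimit_iff_bijective_fromSigma _).mpr ?_).some
    exact Function.bijective_id
  exact preservesColimitsOfShape_of_discrete _

theorem bijective_of_isColimit {J : Type u} {A : J → NGSet.{u} n} {c : Cofan A}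
    (hc : IsColimit c) (k : ℕ) : Function.Bijective
      (fun x : Σ j, (A j).obj.cells k => (c.inj x.1).hom.map x.2) := by
  have hc' : IsColimit (Cofan.mk c.pt c.inj) := IsColimit.ofIsoColimit hc (Cofan.ext (Iso.refl _))
  refine ⟨fun x y h => ?_, fun x => ?_⟩
  · exact cofan_element_injective (cellsFunctor n k) hc' x.2 y.2 h
  · obtain ⟨j, y, h⟩ := cofan_exists_element (cellsFunctor n k) hc' x
    exact ⟨⟨j, y⟩, h⟩

/-- The projections of the product. -/
def piProj {m : ℕ} (A : Fin m → NGSet.{u} n) (j : Fin m) : pi A ⟶ A j :=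
  ⟨⟨fun x => x.1 j, fun _ => rfl, fun _ => rfl⟩⟩

/-- The universal property of the product. -/
def piIsLimit {m : ℕ} (A : Fin m → NGSet.{u} n) : IsLimit (Fan.mk (pi A) (piProj A)) :=
  Fan.IsLimit.mk _
    (fun s => ⟨⟨fun x => ⟨fun j => (s.proj j).hom.map x, le_of_cell _ x⟩,
      fun x => Subtype.ext (funext fun j => (s.proj j).hom.map_src x),
      fun x => Subtype.ext (funext fun j => (s.proj j).hom.map_tgt x)⟩⟩)
    (fun s j => rfl)
    (fun s f h => by
      apply ObjectProperty.hom_ext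
      apply GSet.Hom.ext
      funext k x
      apply Subtype.ext
      funext j
      exact congrArg (fun g => GSet.Hom.map (InducedCategory.Hom.hom g) x) (h j))

theorem preservesFiniteProducts_cellsFunctor {k : ℕ} (hk : k ≤ n) :
    PreservesFiniteProducts (cellsFunctor.{u} n k) where
  preserves m := by
    have : ∀ A : Fin m → NGSet.{u} n, PreservesLimit (Discrete.functor A) (cellsFunctor n k) := by
      intro A
      refine preservesLimit_of_preserves_limit_cone (piIsLimit A) ?_
      refine (isLimitMapConeFanMkEquiv _ _ _).symm ?_
      exact Fan.IsLimit.mk _ (fun s => ↾fun x => ⟨fun j => s.proj j x, hk⟩) (fun s j => rfl)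
        (fun s f h => by
          ext x
          apply Subtype.ext
          funext j
          exact congrArg (fun g => g x) (h j))
    exact preservesLimitsOfShape_of_discrete _

end NGSet

/-- Products distribute over coproducts in a category with a conservative functor to `n`-globular
sets that preserves finite products and coproducts. -/
theorem finDistributive_of_functor {V : Type (u + 1)} [Category.{u} V] [HasFiniteProducts V]
    [HasCoproducts.{u} V] {n : ℕ} (U : V ⥤ NGSet.{u} n) [PreservesFiniteProducts U]
    [∀ J : Type u, PreservesColimitsOfShape (Discrete J) U] [U.ReflectsIsomorphisms] :
    FinDistributive V := by
  have h1 : ∀ k : Fin (n + 1), PreservesFiniteProducts (NGSet.cellsFunctor.{u} n k) := fun k =>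
    NGSet.preservesFiniteProducts_cellsFunctor (Nat.le_of_lt_succ k.isLt)
  refine finDistributive_of_family (fun k : Fin (n + 1) => U ⋙ NGSet.cellsFunctor n k)
    (fun k => ⟨fun m => inferInstance⟩) (fun k J => inferInstance) fun f hf => ?_
  have : IsIso (U.map f) :=
    NGSet.isIso_of_bijective _ fun k hk => hf ⟨k, Nat.lt_succ_of_le hk⟩
  exact isIso_of_reflects_iso f U

instance (n : ℕ) : FinDistributive (NGSet.{u} n) := finDistributive_of_functor (𝟭 _)

/-! ### Graphs enriched in `n`-globular sets as `(n + 1)`-globular sets -/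

namespace NGSet

variable {n : ℕ}

instance : (ofGraph.{u} n).Faithful where
  map_injective {A B} f g h := by
    have h0 : ∀ x : A.obj, f.obj x = g.obj x := fun x =>
      congrArg (fun F => GSet.Hom.map (k := 0) (InducedCategory.Hom.hom F) x) h
    obtain ⟨fo, fm⟩ := f
    obtain ⟨go, gm⟩ := g
    obtain rfl : fo = go := funext h0
    congr 1
    funext x y
    apply ObjectProperty.hom_ext
    apply GSet.Hom.ext
    funext k c
    have := congrArg (fun F : (ofGraph n).obj A ⟶ (ofGraph n).obj _ => F.hom.map (k := k + 1)
      (⟨x, y, c⟩ : Σ x y : A.obj, (A.hom x y).obj.cells k)) h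
    exact eq_of_heq (Sigma.mk.inj (eq_of_heq (Sigma.mk.inj this).2)).2

theorem exists_ofGraph_map_cell {A B : VGraph (NGSet.{u} n)}
    (g : (ofGraph n).obj A ⟶ (ofGraph n).obj B) (k : ℕ) (x y : A.obj)
    (c : (A.hom x y).obj.cells k) :
    ∃ d : (B.hom (g.hom.map (k := 0) x) (g.hom.map (k := 0) y)).obj.cells k,
      g.hom.map (k := k + 1) ⟨x, y, c⟩ = ⟨g.hom.map (k := 0) x, g.hom.map (k := 0) y, d⟩ := by
  have key : (g.hom.map (k := k + 1) ⟨x, y, c⟩).1 = g.hom.map (k := 0) x ∧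
      (g.hom.map (k := k + 1) ⟨x, y, c⟩).2.1 = g.hom.map (k := 0) y := by
    induction k with
    | zero => exact ⟨(g.hom.map_src (k := 0) ⟨x, y, c⟩).symm, (g.hom.map_tgt (k := 0) ⟨x, y, c⟩).symm⟩
    | succ k ih =>
      obtain ⟨h1, h2⟩ := ih ((A.hom x y).obj.src c)
      have e := g.hom.map_src (k := k + 1) ⟨x, y, c⟩
      exact ⟨(congrArg Sigma.fst e).symm.trans h1, (congrArg (fun z => z.2.1) e).symm.trans h2⟩
  generalize g.hom.map (k := k + 1) ⟨x, y, c⟩ = z at key ⊢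
  obtain ⟨x', y', d⟩ := z
  obtain ⟨rfl, rfl⟩ := key
  exact ⟨d, rfl⟩

instance : (ofGraph.{u} n).Full where
  map_surjective {A B} g := by
    choose d hd using exists_ofGraph_map_cell g
    refine ⟨⟨g.hom.map (k := 0), fun x y => ⟨⟨fun {k} c => d k x y c, fun {k} c => ?_,
      fun {k} c => ?_⟩⟩⟩, ?_⟩
    · have e := g.hom.map_src (k := k + 1) ⟨x, y, c⟩
      have e' := (hd k x y ((A.hom x y).obj.src c)).symm.trans (e.trans
        (congrArg ((ofGraph n).obj B).obj.src (hd (k + 1) x y c)))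
      exact eq_of_heq (Sigma.mk.inj (eq_of_heq (Sigma.mk.inj e').2)).2
    · have e := g.hom.map_tgt (k := k + 1) ⟨x, y, c⟩
      have e' := (hd k x y ((A.hom x y).obj.tgt c)).symm.trans (e.trans
        (congrArg ((ofGraph n).obj B).obj.tgt (hd (k + 1) x y c)))
      exact eq_of_heq (Sigma.mk.inj (eq_of_heq (Sigma.mk.inj e').2)).2
    · apply ObjectProperty.hom_ext
      apply GSet.Hom.ext
      funext k c
      cases k with
      | zero => rfl
      | succ k => exact (hd k c.1 c.2.1 c.2.2).symm

/-- The iterated source. -/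
def src₀ (A : GSet.{u}) : ∀ {k : ℕ}, A.cells k → A.cells 0
  | 0, c => c
  | _ + 1, c => src₀ A (A.src c)

/-- The iterated target. -/
def tgt₀ (A : GSet.{u}) : ∀ {k : ℕ}, A.cells k → A.cells 0
  | 0, c => c
  | _ + 1, c => tgt₀ A (A.tgt c)

theorem src₀_tgt (A : GSet.{u}) : ∀ {k : ℕ} (c : A.cells (k + 2)),
    src₀ A (A.tgt c) = src₀ A (A.src c)
  | k, c => congrArg (src₀ A (k := k)) (A.src_src c).symm

theorem tgt₀_src (A : GSet.{u}) : ∀ {k : ℕ} (c : A.cells (k + 2)),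
    tgt₀ A (A.src c) = tgt₀ A (A.tgt c)
  | k, c => congrArg (tgt₀ A (k := k)) (A.tgt_src c)

/-- The graph of an `(n + 1)`-globular set. -/
def toGraph (A : NGSet.{u} (n + 1)) : VGraph (NGSet.{u} n) where
  obj := A.obj.cells 0
  hom x y :=
    { obj :=
        { cells := fun k => {c : A.obj.cells (k + 1) // src₀ A.obj c = x ∧ tgt₀ A.obj c = y}
          src := fun c => ⟨A.obj.src c.1, c.2.1, (tgt₀_src A.obj c.1).trans c.2.2⟩
          tgt := fun c => ⟨A.obj.tgt c.1, (src₀_tgt A.obj c.1).trans c.2.1, c.2.2⟩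
          src_src := fun c => Subtype.ext (A.obj.src_src c.1)
          tgt_src := fun c => Subtype.ext (A.obj.tgt_src c.1) }
      property := fun k hk => ⟨fun c => (A.property (k + 1) (Nat.succ_lt_succ hk)).false c.1⟩ }

/-- The comparison of an `(n + 1)`-globular set with the cells of its graph. -/
def ofGraphToGraph (A : NGSet.{u} (n + 1)) : (ofGraph n).obj (toGraph A) ⟶ A :=
  ⟨⟨fun {k} => match k with
      | 0 => fun x => x
      | _ + 1 => fun c => c.2.2.1,
    fun {k} => match k with
      | 0 => fun c => c.2.2.2.1.symm
      | _ + 1 => fun _ => rfl,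
    fun {k} => match k with
      | 0 => fun c => c.2.2.2.2.symm
      | _ + 1 => fun _ => rfl⟩⟩

instance : (ofGraph.{u} n).EssSurj where
  mem_essImage A := by
    have : IsIso (ofGraphToGraph A) := by
      refine isIso_of_bijective _ fun k _ => ?_
      match k with
      | 0 => exact Function.bijective_id
      | k + 1 =>
        refine ⟨fun c d h => ?_, fun c => ⟨⟨_, _, c, rfl, rfl⟩, rfl⟩⟩
        obtain ⟨_, _, c, rfl, rfl⟩ := c
        obtain ⟨_, _, d, rfl, rfl⟩ := d
        obtain rfl : c = d := h
        rfl
    exact ⟨toGraph A, ⟨asIso (ofGraphToGraph A)⟩⟩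

instance : (ofGraph.{u} n).IsEquivalence where

end NGSet

/-! ### Elements of graphs and coproducts -/

namespace VGraph

variable {W : Type (u + 1)} [Category.{u} W]

/-- The elements of the hom-objects of a graph, with respect to a functor to sets. -/
def El (K : W ⥤ Type u) (A : VGraph W) : Type u := Σ x y : A.obj, K.obj (A.hom x y)

/-- The action of a morphism on elements. -/
def El.map {K : W ⥤ Type u} {A B : VGraph W} (F : A ⟶ B) (e : El K A) : El K B :=
  ⟨F.obj e.1, F.obj e.2.1, K.map (F.map e.1 e.2.1) e.2.2⟩

theorem El.mk_injective {K : W ⥤ Type u} {A : VGraph W} {x y : A.obj} {e e' : K.obj (A.hom x y)}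
    (h : (⟨x, y, e⟩ : El K A) = ⟨x, y, e'⟩) : e = e' :=
  eq_of_heq (Sigma.mk.inj (eq_of_heq (Sigma.mk.inj h).2)).2

/-- A family of morphisms is a coproduct on objects and on elements of hom-objects. -/
structure IsElCoproduct (K : W ⥤ Type u) {J : Type u} {A : J → VGraph W} {C : VGraph W}
    (ι : ∀ j, A j ⟶ C) : Prop where
  obj : Function.Bijective (fun x : Σ j, (A j).obj => (ι x.1).obj x.2)
  el : Function.Bijective (fun e : Σ j, El K (A j) => e.2.map (ι e.1))

namespace IsElCoproduct

variable {K : W ⥤ Type u} {J : Type u} {A : J → VGraph W} {C : VGraph W} {ι : ∀ j, A j ⟶ C}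
  (h : IsElCoproduct K ι)

include h

theorem exists_obj (c : C.obj) : ∃ j x, (ι j).obj x = c := by
  obtain ⟨⟨j, x⟩, hx⟩ := h.obj.2 c
  exact ⟨j, x, hx⟩

theorem index_eq {j j' : J} {x : (A j).obj} {x' : (A j').obj} (e : (ι j).obj x = (ι j').obj x') :
    j = j' :=
  congrArg Sigma.fst (h.obj.1 (a₁ := ⟨j, x⟩) (a₂ := ⟨j', x'⟩) e)

theorem obj_injective (j : J) : Function.Injective (ι j).obj := fun x x' e =>
  eq_of_heq (Sigma.mk.inj (h.obj.1 (a₁ := ⟨j, x⟩) (a₂ := ⟨j, x'⟩) e)).2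

theorem map_bijective (j : J) (x y : (A j).obj) :
    Function.Bijective (K.map ((ι j).map x y)) := by
  refine ⟨fun e e' he => ?_, fun c => ?_⟩
  · have := h.el.1 (a₁ := ⟨j, x, y, e⟩) (a₂ := ⟨j, x, y, e'⟩)
      (congrArg (fun z => (⟨_, _, z⟩ : El K C)) he)
    exact El.mk_injective (eq_of_heq (Sigma.mk.inj this).2)
  · obtain ⟨⟨j', x', y', e⟩, he⟩ := h.el.2 ⟨(ι j).obj x, (ι j).obj y, c⟩
    have h1 : (ι j').obj x' = (ι j).obj x := congrArg Sigma.fst he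
    have h2 : (ι j').obj y' = (ι j).obj y := congrArg (fun z : El K C => z.2.1) he
    obtain rfl := h.index_eq h1
    obtain rfl := h.obj_injective _ h1
    obtain rfl := h.obj_injective _ h2
    exact ⟨e, El.mk_injective he⟩

theorem index_eq_of_el {j j' : J} {x : (A j).obj} {y : (A j').obj}
    (c : K.obj (C.hom ((ι j).obj x) ((ι j').obj y))) : j = j' := by
  obtain ⟨⟨i, x', y', e⟩, he⟩ := h.el.2 ⟨(ι j).obj x, (ι j').obj y, c⟩
  exact (h.index_eq (congrArg Sigma.fst he)).symm.trans
    (h.index_eq (congrArg (fun z : El K C => z.2.1) he))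

end IsElCoproduct

theorem isElCoproduct_of {K : W ⥤ Type u} {J : Type u} {A : J → VGraph W} {C : VGraph W}
    {ι : ∀ j, A j ⟶ C} (hobj : Function.Bijective (fun x : Σ j, (A j).obj => (ι x.1).obj x.2))
    (hmap : ∀ j x y, Function.Bijective (K.map ((ι j).map x y)))
    (hindex : ∀ {j j' : J} {x : (A j).obj} {y : (A j').obj}
      (_ : K.obj (C.hom ((ι j).obj x) ((ι j').obj y))), j = j') : IsElCoproduct K ι where
  obj := hobj
  el := by
    refine ⟨fun ⟨j, x, y, e⟩ ⟨j', x', y', e'⟩ he => ?_, fun ⟨c, c', e⟩ => ?_⟩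
    · have h1 : (⟨j, x⟩ : Σ j, (A j).obj) = ⟨j', x'⟩ := hobj.1 (congrArg Sigma.fst he)
      cases h1
      have h2 : (⟨j, y⟩ : Σ j, (A j).obj) = ⟨j, y'⟩ :=
        hobj.1 (congrArg (fun z : El K C => z.2.1) he)
      cases h2
      obtain rfl : e = e' := (hmap j x y).1 (El.mk_injective he)
      rfl
    · obtain ⟨⟨j, x⟩, rfl⟩ := hobj.2 c
      obtain ⟨⟨j', y⟩, rfl⟩ := hobj.2 c'
      obtain rfl := hindex e
      obtain ⟨d, rfl⟩ := (hmap j x y).2 e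
      exact ⟨⟨j, x, y, d⟩, rfl⟩

end VGraph

section

variable {W : Type (u + 1)} [Category.{u} W] [HasFiniteProducts W] [HasCoproducts.{u} W]
variable (K : W ⥤ Type u) [PreservesFiniteProducts K] {P : Operad W} {A : VGraph W}

omit [HasFiniteProducts W] [HasCoproducts.{u} W] [PreservesFiniteProducts K] in
theorem map_comp_element {X Y Z : W} (f : X ⟶ Y) (g : Y ⟶ Z) (z : K.obj X) :
    K.map (f ≫ g) z = K.map g (K.map f z) := by
  rw [K.map_comp]
  rfl

omit [HasCoproducts.{u} W] in
theorem map_gen_element {X Q : W} {k : ℕ} {B : Fin k → W} (p : X ⟶ Q) (f : ∀ i, X ⟶ B i)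
    (z : K.obj X) : K.map (gen p f) z = genEl K (K.map p z) (fun i => K.map (f i) z) := by
  refine gen_element_ext K ?_ fun i => ?_
  · refine (map_comp_element K _ _ _).symm.trans ?_
    rw [gen_fst, genEl_fst]
  · refine (map_comp_element K _ _ _).symm.trans ?_
    rw [gen_snd, genEl_snd]

/-- The elements of free `(W, P)`-categories. -/
noncomputable def cell {m : ℕ} (a : Fin (m + 1) → A.obj) (p : K.obj (P.obj m))
    (f : ∀ i : Fin m, K.obj (A.hom (a i.castSucc) (a i.succ))) : (freeGraph P A).El K :=
  ⟨a 0, a (Fin.last m), K.map (formι (P := P) (A := A) ⟨m, a, rfl, rfl⟩) (genEl K p f)⟩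

theorem cell_map [FinDistributive W] {B : VGraph W} (G : A ⟶ B) {m : ℕ} (a : Fin (m + 1) → A.obj)
    (p : K.obj (P.obj m)) (f : ∀ i : Fin m, K.obj (A.hom (a i.castSucc) (a i.succ))) :
    (cell K a p f).map ((freeFunctor P).map G).toHom =
      cell K (P := P) (A := B) (fun t => G.obj (a t)) p (fun i => K.map (G.map _ _) (f i)) := by
  have h0 := (congrArg (fun e => VGraph.Arr.map ((freeFunctor P).map G).toHom
      ((freeGraph P A).of e)) (form_id (P := P) (A := A) ⟨m, a, rfl, rfl⟩)).symm.trans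
    (of_form_freeMap G a prod.fst (fun i => prod.snd ≫ Pi.π _ i))
  have h := congrArg (fun e : VGraph.Arr (summand P (A := A) (x := a 0) (y := a (Fin.last m))
      ⟨m, a, rfl, rfl⟩) (freeGraph P B) =>
    (⟨e.src, e.tgt, K.map e.arr (genEl K p f)⟩ : (freeGraph P B).El K)) h0
  have h1 : K.map (formι (P := P) (A := A) ⟨m, a, rfl, rfl⟩ ≫ ((freeFunctor P).map G).toHom.map _ _)
      (genEl K p f) = K.map (((freeFunctor P).map G).toHom.map (a 0) (a (Fin.last m)))
        (K.map (formι (P := P) (A := A) ⟨m, a, rfl, rfl⟩) (genEl K p f)) :=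
    map_comp_element K _ _ _
  refine (congrArg (fun z => (⟨_, _, z⟩ : (freeGraph P B).El K)) h1).symm.trans (h.trans ?_)
  refine congrArg (fun z => (⟨_, _, z⟩ : (freeGraph P B).El K)) ?_
  refine (map_comp_element K (gen prod.fst
    (fun i => (prod.snd ≫ Pi.π _ i) ≫ G.map (a i.castSucc) (a i.succ)))
      (formι (P := P) (A := B) ⟨m, fun t => G.obj (a t), rfl, rfl⟩) (genEl K p f)).trans ?_
  refine congrArg (K.map (formι (P := P) (A := B) ⟨m, fun t => G.obj (a t), rfl, rfl⟩)) ?_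
  refine (map_gen_element K _ _ _).trans (gen_element_ext K ?_ fun i => ?_)
  · rw [genEl_fst, genEl_fst, genEl_fst]
  · rw [genEl_snd, genEl_snd]
    refine (map_comp_element K _ _ _).trans ?_
    exact congrArg (K.map (G.map _ _)) (genEl_snd K p f i)

variable [∀ J : Type u, PreservesColimitsOfShape (Discrete J) K]

theorem exists_cell_eq (e : (freeGraph P A).El K) :
    ∃ (m : ℕ) (a : Fin (m + 1) → A.obj) (p : K.obj (P.obj m))
      (f : ∀ i : Fin m, K.obj (A.hom (a i.castSucc) (a i.succ))), cell K a p f = e := by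
  obtain ⟨x, y, c⟩ := e
  obtain ⟨⟨m, a, rfl, rfl⟩, z, rfl⟩ := cofan_exists_element K (freeIsColimit P (A := A) x y) c
  refine ⟨m, a, K.map prod.fst z, fun i => K.map (prod.snd ≫ Pi.π _ i) z, ?_⟩
  refine congrArg (fun z => (⟨_, _, K.map (formι (P := P) (A := A) ⟨m, a, rfl, rfl⟩) z⟩ :
    (freeGraph P A).El K)) (gen_element_ext K ?_ fun i => ?_)
  · rw [genEl_fst]
  · rw [genEl_snd]

theorem cell_injective {m m' : ℕ} {a : Fin (m + 1) → A.obj} {p : K.obj (P.obj m)}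
    {f : ∀ i : Fin m, K.obj (A.hom (a i.castSucc) (a i.succ))}
    {a' : Fin (m' + 1) → A.obj} {p' : K.obj (P.obj m')}
    {f' : ∀ i : Fin m', K.obj (A.hom (a' i.castSucc) (a' i.succ))}
    (h : cell K a p f = cell K a' p' f') :
    (⟨m, a, p, fun i => ⟨_, _, f i⟩⟩ :
      Σ m, (Fin (m + 1) → A.obj) × K.obj (P.obj m) × (Fin m → A.El K)) =
    ⟨m', a', p', fun i => ⟨_, _, f' i⟩⟩ := by
  have key : ∀ {x y x' y' : A.obj} (w : A.Walk x y) (z : K.obj (summand P w)) (w' : A.Walk x' y')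
      (z' : K.obj (summand P w')), (⟨x, y, K.map (formι w) z⟩ : (freeGraph P A).El K) =
        ⟨x', y', K.map (formι w') z'⟩ →
      (⟨x, y, w, z⟩ : Σ (x y : A.obj) (w : A.Walk x y), K.obj (summand P w)) = ⟨x', y', w', z'⟩ := by
    intro x y x' y' w z w' z' h
    obtain rfl : x = x' := congrArg Sigma.fst h
    obtain rfl : y = y' := congrArg (fun e : (freeGraph P A).El K => e.2.1) h
    have := cofan_element_injective K (freeIsColimit P (A := A) x y) z z' (VGraph.El.mk_injective h)
    exact congrArg (fun e => (⟨x, y, e⟩ :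
      Σ (x y : A.obj) (w : A.Walk x y), K.obj (summand P w))) this
  have e := congrArg (fun e : (Σ (x y : A.obj) (w : A.Walk x y), K.obj (summand P w)) =>
    (⟨e.2.2.1.1, e.2.2.1.2.1, K.map prod.fst e.2.2.2,
      fun i => ⟨_, _, K.map (prod.snd ≫ Pi.π _ i) e.2.2.2⟩⟩ :
        Σ m, (Fin (m + 1) → A.obj) × K.obj (P.obj m) × (Fin m → A.El K))) (key _ _ _ _ h)
  have e0 : ∀ {m : ℕ} (a : Fin (m + 1) → A.obj) (p : K.obj (P.obj m))
      (f : ∀ i : Fin m, K.obj (A.hom (a i.castSucc) (a i.succ))),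
      (⟨m, a, p, fun i => ⟨_, _, f i⟩⟩ :
        Σ m, (Fin (m + 1) → A.obj) × K.obj (P.obj m) × (Fin m → A.El K)) =
      ⟨m, a, K.map prod.fst (genEl K p f),
        fun i => ⟨_, _, K.map (prod.snd ≫ Pi.π _ i) (genEl K p f)⟩⟩ := by
    intro m a p f
    simp only [genEl_fst, genEl_snd]
  exact (e0 a p f).trans (e.trans (e0 a' p' f').symm)

theorem VGraph.IsElCoproduct.free [FinDistributive W] {J : Type u} {A : J → VGraph W}
    {C : VGraph W} {ι : ∀ j, A j ⟶ C} (h : IsElCoproduct K ι) :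
    IsElCoproduct K (fun j => ((freeFunctor P).map (ι j)).toHom) where
  obj := h.obj
  el := by
    refine ⟨fun ⟨j, e⟩ ⟨j', e'⟩ he => ?_, fun e => ?_⟩
    · obtain ⟨m, a, p, f, rfl⟩ := exists_cell_eq K e
      obtain ⟨m', a', p', f', rfl⟩ := exists_cell_eq K e'
      have he' := cell_injective K ((cell_map K (ι j) a p f).symm.trans
        (he.trans (cell_map K (ι j') a' p' f')))
      obtain rfl : m = m' := congrArg Sigma.fst he'
      have he2 := eq_of_heq (Sigma.mk.inj he').2
      have h1 := (Prod.mk.inj he2).1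
      obtain ⟨h2, h3⟩ := Prod.mk.inj (Prod.mk.inj he2).2
      obtain rfl : j = j' := h.index_eq (congrFun h1 0)
      obtain rfl : a = a' := funext fun t => h.obj_injective j (congrFun h1 t)
      obtain rfl : p = p' := h2
      obtain rfl : f = f' := funext fun i => (h.map_bijective j _ _).1
        (VGraph.El.mk_injective (congrFun h3 i))
      rfl
    · obtain ⟨m, b, p, f, rfl⟩ := exists_cell_eq K e
      obtain ⟨j, x, hx⟩ := h.exists_obj (b 0)
      have hb : ∀ t, ∃ x, (ι j).obj x = b t := by
        intro t
        induction t using Fin.induction with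
        | zero => exact ⟨x, hx⟩
        | succ i ih =>
          obtain ⟨x, hx⟩ := ih
          obtain ⟨j', y, hy⟩ := h.exists_obj (b i.succ)
          have fi := f i
          rw [← hx, ← hy] at fi
          obtain rfl := h.index_eq_of_el fi
          exact ⟨y, hy⟩
      choose a ha using hb
      obtain rfl : (fun t => (ι j).obj (a t)) = b := funext ha
      choose g hg using fun i : Fin m => (h.map_bijective j (a i.castSucc) (a i.succ)).2 (f i)
      obtain rfl : (fun i => K.map ((ι j).map _ _) (g i)) = f := funext hg
      exact ⟨⟨j, cell K a p g⟩, cell_map K (ι j) a p g⟩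

end

/-! ### Preservation of coproducts -/

section

variable {n : ℕ}

open NGSet

theorem isElCoproduct_of_isColimit {J : Type u} {A : J → VGraph (NGSet.{u} n)}
    {C : VGraph (NGSet.{u} n)} {ι : ∀ j, A j ⟶ C} (hc : IsColimit (Cofan.mk C ι)) (k : ℕ) :
    VGraph.IsElCoproduct (cellsFunctor n k) ι := by
  have h := isColimitCofanMkObjOfIsColimit (ofGraph n) _ _ hc
  exact ⟨bijective_of_isColimit h 0, bijective_of_isColimit h (k + 1)⟩

theorem isColimit_of_isElCoproduct {J : Type u} {A : J → VGraph (NGSet.{u} n)}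
    {C : VGraph (NGSet.{u} n)} {ι : ∀ j, A j ⟶ C}
    (h : ∀ k ≤ n, VGraph.IsElCoproduct (cellsFunctor n k) ι) :
    Nonempty (IsColimit (Cofan.mk C ι)) := by
  obtain ⟨hc⟩ := isColimit_of_bijective (Cofan.mk ((ofGraph n).obj C)
      (fun j => (ofGraph n).map (ι j))) fun k hk => by
    match k, hk with
    | 0, _ => exact (h 0 (Nat.zero_le n)).obj
    | k + 1, hk => exact (h k (Nat.le_of_succ_le_succ hk)).el
  exact ⟨isColimitOfIsColimitCofanMkObj (ofGraph n) _ _ hc⟩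

theorem isEmpty_cells_map (Q : NGSet.{u} n ⥤ NGSet.{u} n)
    [∀ J : Type u, PreservesColimitsOfShape (Discrete J) Q] (B : NGSet.{u} n)
    (hB : ∀ k, IsEmpty (B.obj.cells k)) (k : ℕ) : IsEmpty ((Q.obj B).obj.cells k) := by
  obtain ⟨hc⟩ := isColimit_of_bijective (n := n) (J := PEmpty) (A := fun x => x.elim)
    (Cofan.mk B fun x => x.elim) fun k _ =>
      ⟨fun x => x.1.elim, fun x => ((hB k).false x).elim⟩
  refine ⟨fun x => ?_⟩
  obtain ⟨j, _⟩ := cofan_exists_element (Q ⋙ cellsFunctor n k) hc x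
  exact j.elim

theorem isElCoproduct_mapFunctor (Q : NGSet.{u} n ⥤ NGSet.{u} n)
    [∀ J : Type u, PreservesColimitsOfShape (Discrete J) Q] {J : Type u}
    {A : J → VGraph (NGSet.{u} n)} {C : VGraph (NGSet.{u} n)} {ι : ∀ j, A j ⟶ C}
    (h : ∀ k, VGraph.IsElCoproduct (cellsFunctor n k) ι) (k : ℕ) :
    VGraph.IsElCoproduct (cellsFunctor n k) (fun j => (VGraph.mapFunctor Q).map (ι j)) := by
  refine VGraph.isElCoproduct_of (h k).obj (fun j x y => ?_) fun {j j' x y} z => ?_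
  · have : IsIso ((ι j).map x y) :=
      isIso_of_bijective _ fun l _ => (h l).map_bijective j x y
    exact (isIso_iff_bijective ((cellsFunctor n k).map (Q.map ((ι j).map x y)))).mp inferInstance
  · by_contra hj
    exact (isEmpty_cells_map Q (C.hom ((ι j).obj x) ((ι j').obj y))
      (fun l => ⟨fun c => hj ((h l).index_eq_of_el c)⟩) k).false z

theorem preservesCoproducts_freeFunctor (P : Operad (NGSet.{u} n)) (Q : NGSet.{u} n ⥤ NGSet.{u} n)
    [∀ J : Type u, PreservesColimitsOfShape (Discrete J) Q] (J : Type u) :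
    PreservesColimitsOfShape (Discrete J)
      (VGraph.mapFunctor Q ⋙ freeFunctor P ⋙ PCat.forget P) := by
  have hV : HasColimitsOfShape (Discrete J) (VGraph (NGSet.{u} n)) :=
    Adjunction.hasColimitsOfShape_of_equivalence (ofGraph n)
  have : ∀ A : J → VGraph (NGSet.{u} n), PreservesColimit (Discrete.functor A)
      (VGraph.mapFunctor Q ⋙ freeFunctor P ⋙ PCat.forget P) := by
    intro A
    have hc := coproductIsCoproduct A
    refine preservesColimit_of_preserves_colimit_cocone hc ?_
    refine (isColimitMapCoconeCofanMkEquiv _ _ _).symm ?_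
    refine (isColimit_of_isElCoproduct fun k hk => ?_).some
    have := preservesFiniteProducts_cellsFunctor.{u} hk
    exact (isElCoproduct_mapFunctor Q (isElCoproduct_of_isColimit hc) k).free
  exact preservesColimitsOfShape_of_discrete _

end

/-! ### Coproduct-preserving monadic functors -/

section

variable {V : Type (u + 1)} [Category.{u} V] {n : ℕ} {U : V ⥤ NGSet.{u} n} {L : NGSet.{u} n ⥤ V}
variable (adj : L ⊣ U) [(Monad.comparison adj).IsEquivalence]
variable [∀ J : Type u, PreservesColimitsOfShape (Discrete J) (L ⋙ U)]

include adj

theorem coproducts_of_monadic : HasCoproducts.{u} V ∧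
    ∀ J : Type u, PreservesColimitsOfShape (Discrete J) U := by
  let : MonadicRightAdjoint U := ⟨L, adj, inferInstance⟩
  have hc : ∀ J : Type u, CreatesColimitsOfShape (Discrete J) U := fun J =>
    { CreatesColimit := fun {K} => by
        have : PreservesColimitsOfShape (Discrete J) (monadicLeftAdjoint U ⋙ U) :=
          inferInstanceAs (PreservesColimitsOfShape (Discrete J) (L ⋙ U))
        exact monadicCreatesColimitOfPreservesColimit U K }
  refine ⟨fun J => ?_, fun J => ?_⟩
  · have := hc J
    exact hasColimitsOfShape_of_hasColimitsOfShape_createsColimitsOfShape U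
  · have := hc J
    infer_instance

end

theorem preservesFiniteProducts_of_adjunction {V : Type (u + 1)} [Category.{u} V]
    {W : Type (u + 1)} [Category.{u} W] {U : V ⥤ W} {L : W ⥤ V} (adj : L ⊣ U) :
    PreservesFiniteProducts U := by
  have := adj.rightAdjoint_preservesLimits
  exact ⟨fun _ => inferInstance⟩

instance : (NGSet.ofType.{u}).Faithful where
  map_injective {S T f g} h := by
    ext x
    exact congrArg (fun φ => φ.hom.map (k := 0) x) h

instance : (NGSet.ofType.{u}).Full where
  map_surjective {S T} f := ⟨↾fun x => f.hom.map (k := 0) x, by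
    apply ObjectProperty.hom_ext
    apply GSet.Hom.ext
    funext k x
    match k, x with
    | 0, x => rfl⟩

instance : (NGSet.ofType.{u}).EssSurj where
  mem_essImage B := by
    let f : NGSet.ofType.obj (B.obj.cells 0) ⟶ B := ⟨⟨fun {k} => match k with
      | 0 => fun x => x
      | _ + 1 => fun x => x.elim, fun x => x.elim, fun x => x.elim⟩⟩
    have : IsIso f := NGSet.isIso_of_bijective f fun k hk => by
      obtain rfl : k = 0 := Nat.le_zero.mp hk
      exact Function.bijective_id
    exact ⟨_, ⟨asIso f⟩⟩

instance : (NGSet.ofType.{u}).IsEquivalence where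

theorem comparison_isEquivalence_of_isEquivalence {C : Type (u + 1)} [Category.{u} C]
    {D : Type (u + 1)} [Category.{u} D] {L : C ⥤ D} {U : D ⥤ C} (adj : L ⊣ U) [U.IsEquivalence] :
    (Monad.comparison adj).IsEquivalence := by
  let : Reflective U := { L := L, adj := adj }
  have : (Monad.comparison adj).EssSurj := Reflective.comparison_essSurj (R := U)
  exact { full := Reflective.comparison_full adj }

/-- The data of a left adjoint exhibiting `U` as monadic, for a monad preserving small coproducts. -/
structure CoproductMonadic {V : Type (u + 1)} [Category.{u} V] {n : ℕ} (U : V ⥤ NGSet.{u} n) where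
  left : NGSet.{u} n ⥤ V
  adj : left ⊣ U
  isEquivalence : (Monad.comparison adj).IsEquivalence
  preserves : ∀ J : Type u, PreservesColimitsOfShape (Discrete J) (left ⋙ U)

namespace CoproductMonadic

theorem nonempty_of_isEquivalence {V : Type (u + 1)} [Category.{u} V] {n : ℕ}
    (U : V ⥤ NGSet.{u} n) [U.IsEquivalence] : Nonempty (CoproductMonadic U) := by
  exact ⟨U.inv, U.asEquivalence.symm.toAdjunction,
    comparison_isEquivalence_of_isEquivalence _, fun J => inferInstance⟩

section

variable {V : Type (u + 1)} [Category.{u} V] [HasFiniteProducts V] {n : ℕ} {U : V ⥤ NGSet.{u} n}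
variable (d : CoproductMonadic U)

include d

omit [HasFiniteProducts V] in
theorem preservesFiniteProducts : PreservesFiniteProducts U :=
  preservesFiniteProducts_of_adjunction d.adj

variable (P : Operad V)

theorem exists_monadIsoAlong [PreservesFiniteProducts U] {M : NGSet.{u} (n + 1) ⥤ PCat P}
    (adj' : M ⊣ PCat.forget P ⋙ VGraph.mapFunctor U ⋙ NGSet.ofGraph n) :
    ∃ (l : DistribLaw (freePCatStr (P.map U)).fc (VGraph.mapMonad d.adj.toMonad)),
      IsCanonicalLaw (freePCatStr (P.map U)) d.adj.toMonad
        (fun k => U.map (d.adj.counit.app (P.obj k))) l ∧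
      Nonempty (MonadIsoAlong (NGSet.ofGraph n) l.composite adj'.toMonad) := by
  have := d.isEquivalence
  have := d.preserves
  obtain ⟨_, _⟩ := coproducts_of_monadic d.adj
  have := reflectsIsomorphisms_of_comparison d.adj
  have := finDistributive_of_functor U
  exact ⟨canonicalLaw d.adj P, canonicalLaw_isCanonical d.adj P,
    nonempty_monadIsoAlong_composite d.adj (NGSet.ofGraph n) adj'⟩

theorem nonempty_next : Nonempty (CoproductMonadic
    (PCat.forget P ⋙ VGraph.mapFunctor U ⋙ NGSet.ofGraph n)) := by
  have := d.isEquivalence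
  have := d.preserves
  have := d.preservesFiniteProducts
  obtain ⟨_, _⟩ := coproducts_of_monadic d.adj
  have := reflectsIsomorphisms_of_comparison d.adj
  have := finDistributive_of_functor U
  let adj' := ((NGSet.ofGraph.{u} n).asEquivalence.symm.toAdjunction.comp (mapAdj d.adj)).comp
    (freeAdj P)
  refine ⟨_, adj', comparison_isEquivalence d.adj (NGSet.ofGraph n) adj', fun J => ?_⟩
  obtain ⟨l, -, ⟨i⟩⟩ := d.exists_monadIsoAlong P adj'
  have h := preservesCoproducts_freeFunctor (P.map U) (d.left ⋙ U) J
  let e := (NGSet.ofGraph.{u} n).asEquivalence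
  have : PreservesColimitsOfShape (Discrete J) (e.inverse ⋙ l.composite.toFunctor ⋙
      NGSet.ofGraph n) :=
    inferInstanceAs (PreservesColimitsOfShape (Discrete J) (e.inverse ⋙ (VGraph.mapFunctor (d.left ⋙ U) ⋙
    freeFunctor (P.map U) ⋙ PCat.forget (P.map U)) ⋙ e.functor))
  exact preservesColimitsOfShape_of_natIso (Functor.isoWhiskerLeft e.inverse i.iso ≪≫
    (Functor.associator _ _ _).symm ≪≫ Functor.isoWhiskerRight e.counitIso adj'.toMonad.toFunctor ≪≫
    Functor.leftUnitor _)

end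

end CoproductMonadic

namespace IterativeTheory

theorem nonempty_coproductMonadic_zero {B : Base.{u}} (h : B = Base.set) :
    Nonempty (CoproductMonadic (Base.idOfEq h ⋙ NGSet.ofType)) := by
  subst h
  exact CoproductMonadic.nonempty_of_isEquivalence NGSet.ofType

theorem nonempty_coproductMonadic_succ {B B' : Base.{u}} {n : ℕ} {U : B.C ⥤ NGSet.{u} n}
    (d : CoproductMonadic U) (P : Operad B.C) (h : B' = Base.next B P) :
    Nonempty (CoproductMonadic (Base.idOfEq h ⋙ PCat.forget P ⋙ VGraph.mapFunctor U ⋙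
      NGSet.ofGraph n)) := by
  subst h
  exact d.nonempty_next P

theorem exists_monadIsoAlong {B B' : Base.{u}} {n : ℕ} {U : B.C ⥤ NGSet.{u} n}
    (d : CoproductMonadic U) (P : Operad B.C) (h : B' = Base.next B P)
    [PreservesFiniteProducts U] (d' : CoproductMonadic (Base.idOfEq h ⋙ PCat.forget P ⋙
      VGraph.mapFunctor U ⋙ NGSet.ofGraph n)) :
    ∃ (l : DistribLaw (freePCatStr (P.map U)).fc (VGraph.mapMonad d.adj.toMonad)),
      IsCanonicalLaw (freePCatStr (P.map U)) d.adj.toMonad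
        (fun k => U.map (d.adj.counit.app (P.obj k))) l ∧
      Nonempty (MonadIsoAlong (NGSet.ofGraph n) l.composite d'.adj.toMonad) := by
  subst h
  exact d.exists_monadIsoAlong P d'.adj

variable (τ : IterativeTheory.{u})

theorem nonempty_coproductMonadic : ∀ n, Nonempty (CoproductMonadic (τ.U n))
  | 0 => nonempty_coproductMonadic_zero τ.V_zero
  | n + 1 => nonempty_coproductMonadic_succ (nonempty_coproductMonadic n).some (τ.P n)
      (τ.V_succ n)

theorem isEquivalence_U_zero : (τ.U 0).IsEquivalence := by
  have key : ∀ {B : Base.{u}} (h : B = Base.set), (Base.idOfEq h ⋙ NGSet.ofType).IsEquivalence := by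
    intro B h
    subst h
    exact inferInstanceAs NGSet.ofType.IsEquivalence
  exact key τ.V_zero

end IterativeTheory

/-- The monad of an adjunction whose right adjoint is an equivalence is the identity. -/
theorem nonempty_toMonad_iso_id {C : Type (u + 1)} [Category.{u} C]
    {D : Type (u + 1)} [Category.{u} D] {L : C ⥤ D} {U : D ⥤ C} (adj : L ⊣ U) [U.IsEquivalence] :
    Nonempty (adj.toMonad ≅ Monad.id C) := by
  have := adj.isEquivalence_left_of_isEquivalence_right
  have hη : IsIso adj.unit := inferInstance
  exact ⟨(MonadIso.mk (M := Monad.id C) (N := adj.toMonad) (@asIso _ _ _ _ adj.unit hη)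
    (fun X => Category.id_comp _) (fun X => by
      refine (Category.id_comp _).trans (Eq.symm ((Category.assoc _ _ _).trans ?_))
      exact (congrArg (adj.unit.app X ≫ ·) (adj.right_triangle_components (L.obj X))).trans
        (Category.comp_id _))).symm⟩

end IterOp

theorem mainTheorem4 (τ : IterOp.IterativeTheory.{u}) :
    ∃ (Q : ∀ n : ℕ, CategoryTheory.Monad (IterOp.NGSet.{u} n)) (E : ∀ n : ℕ, (τ.V n).C ≌ (Q n).Algebra),
      (∀ n, Nonempty ((E n).functor ⋙ (Q n).forget ≅ τ.U n)) ∧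
      Nonempty (Q 0 ≅ CategoryTheory.Monad.id (IterOp.NGSet.{u} 0)) ∧
      (∀ n, ∃ (F : IterOp.FreePCat ((τ.P n).map ((E n).functor ⋙ (Q n).forget)))
          (l : IterOp.DistribLaw F.fc (IterOp.VGraph.mapMonad (Q n))),
        F.IsCoproductOfWalks ∧
        IterOp.IsCanonicalLaw F (Q n) (fun k => ((E n).functor.obj ((τ.P n).obj k)).a) l ∧
        Nonempty (IterOp.MonadIsoAlong (IterOp.NGSet.ofGraph n) l.composite (Q (n + 1)))) ∧
      ∀ (n : ℕ) (J : Type u),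
        PreservesColimitsOfShape (Discrete J) (Q n).toFunctor := by
  let d := fun n => (τ.nonempty_coproductMonadic n).some
  have hd : ∀ n, (Monad.comparison (d n).adj).IsEquivalence := fun n => (d n).isEquivalence
  refine ⟨fun n => (d n).adj.toMonad, fun n => (Monad.comparison (d n).adj).asEquivalence,
    fun n => ⟨Iso.refl _⟩, ?_, fun n => ?_, fun n J => (d n).preserves J⟩
  · have := τ.isEquivalence_U_zero
    exact IterOp.nonempty_toMonad_iso_id _
  · have := (d n).preservesFiniteProducts
    obtain ⟨l, h, h'⟩ :=
      IterOp.IterativeTheory.exists_monadIsoAlong (d n) (τ.P n) (τ.V_succ n) (d (n + 1))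
    exact ⟨IterOp.freePCatStr ((τ.P n).map (τ.U n)), l,
      IterOp.freePCatStr_isCoproductOfWalks, h, h'⟩
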